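/- **Setting.** For each sample size $n$ let $k=k_n\in\mathbb N$, $\mathcal X=\mathcal X_n\subseteq\mathbb R^d$ ($d$ fixed), a class $\mathcal G=\mathcal G_n$ of real functions and a measurable map $p=p_n:\mathbb R^d\to\mathbb R^k$ be given, and let $(y_i,x_i)$, $i=1,\dots,n$, be a sample with $x_i\in\mathcal X$ a.s.; all objects may depend on $n$. Let $\|\cdot\|$ be the Euclidean norm, $p_i=p(x_i)$, let $F$ be the law of $x_i$, and put $\xi_k=\sup_{x\in\mathcal X}\|p(x)\|$, $Q=E[p_ip_i']$, $\mathbb G_n[f(x_i)]=n^{-1/2}\sum_{i=1}^n(f(x_i)-E[f(x_i)])$. Let $\beta=\arg\min_bE[(y_i-p_i'b)^2]$, let $\hat\beta$ be a measurable minimiser of $b\mapsto\frac1n\sum_{i=1}^n(y_i-p_i'b)^2$, and put $\hat g(x)=p(x)'\hat\beta$. For a function $f$ let $\beta_f=\arg\min_bE[(f(x_i)-p_i'b)^2]$ and $r_f(x)=f(x)-p(x)'\beta_f$. Assume: * **A.1.** For each $n$, the vectors $(y_i,x_i)$, $i=1,\dots,n$, are i.i.d. and $y_i=g(x_i)+\epsilon_i$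 with $E[\epsilon_i\mid x_i]=0$ and $g=g_n\in\mathcal G$ measurable. * **A.2.** The eigenvalues of $Q$ are bounded above and away from zero, uniformly over $n$. * **A.3.** For each $n$ there are finite constants $c_k\ge0$ and $\ell_k$ (possibly depending on $n$) such that for each $f\in\mathcal G$, $\left(\int r_f^2\,dF\right)^{1/2}\le c_k$ and $\sup_{x\in\mathcal X}|r_f(x)|\le\ell_kc_k$. Write $r=r_g$, $r_i=r(x_i)$, and $$\widetilde\Omega=Q^{-1}E[(\epsilon_i+r_i)^2p_ip_i']Q^{-1},\qquad \Omega_0=Q^{-1}E[\epsilon_i^2p_ip_i']Q^{-1},\qquad R_{2n}(\alpha)=\alpha'Q^{-1}\mathbb G_n[p_ir_i].$$ **Theorem (Pointwise Normality).** Under A.1–A.3, assume in addition that 1. $\sup_{x\in\mathcal X}E[\epsilon_i^21\{|\epsilon_i|>M\}\mid x_i=x]\to0$ as $M\to\infty$, uniformly over $n$; 2. $\inf_{x\in\mathcal X}E[\epsilon_i^2\mid x_i=x]\ge C$ for all $n$, for some constant $C>0$ that does not depend on $n$; 3. $(\xi_k^2\log n/n)^{1/2}(1+k^{1/2}\ell_kc_k)\to0$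 as $n\to\infty$; where in 1 and 2 the supremum and the infimum over $x$ are essential ones with respect to $F$. Then the following hold as $n\to\infty$, with convergence in distribution. (a) For any sequence $\alpha=\alpha_n\in\mathbb R^k$ with $\|\alpha\|=1$, $$\sqrt n\,\frac{\alpha'(\hat\beta-\beta)}{\|\alpha'\Omega^{1/2}\|}\to N(0,1)$$ with $\Omega=\widetilde\Omega$; if $R_{2n}(\alpha)\to_P0$, this also holds with $\Omega=\Omega_0$. (b) Let $x=x_n\in\mathcal X$ be any sequence with $p(x)\ne0$, and let $s(x)=\Omega^{1/2}p(x)$, where $\Omega=\widetilde\Omega$, or $\Omega=\Omega_0$ if $R_{2n}(p(x)/\|p(x)\|)\to_P0$. Then $$\sqrt n\,\frac{p(x)'(\hat\beta-\beta)}{\|s(x)\|}\to N(0,1).$$ (c) If, in the situation of (b), $\sqrt n\,r(x)=o(\|s(x)\|)$, then $$\sqrt n\,\frac{\hat g(x)-g(x)}{\|s(x)\|}\to N(0,1).$$ -/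

import Mathlib

open MeasureTheory ProbabilityTheory Filter Topology
open scoped ENNReal Matrix

namespace LSSeries

noncomputable section

/-- Euclidean space `ℝᵐ`. -/
abbrev Euc (m : ℕ) : Type := EuclideanSpace ℝ (Fin m)

/-- `b` minimises `b ↦ ∫ (u - q'b)² dm`. The integral is `[0, ∞]`-valued. -/
def IsLeastSquares {S : Type*} [MeasurableSpace S] {k : ℕ} (m : Measure S) (u : S → ℝ)
    (q : S → Euc k) (b : Euc k) : Prop :=
  ∀ b' : Euc k,
    ∫⁻ s, ENNReal.ofReal ((u s - inner ℝ (q s) b) ^ 2) ∂m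
      ≤ ∫⁻ s, ENNReal.ofReal ((u s - inner ℝ (q s) b') ^ 2) ∂m

/-- `arg min_b ∫ (u - q'b)² dm`. -/
def leastSquares {S : Type*} [MeasurableSpace S] {k : ℕ} (m : Measure S) (u : S → ℝ)
    (q : S → Euc k) : Euc k :=
  Classical.epsilon (IsLeastSquares m u q)

/-- `b` is a least squares estimate for the data `(x i, y i)`, `i < n`, with regressors `p`:
it minimises the empirical criterion `𝔼ₙ[(y_i - p(x_i)'b)²]`. -/
def IsEstimate {d k n : ℕ} (p : Euc d → Euc k) (x : Fin n → Euc d) (y : Fin n → ℝ)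
    (b : Euc k) : Prop :=
  ∀ b' : Euc k,
    (n : ℝ)⁻¹ * ∑ i, (y i - inner ℝ (p (x i)) b) ^ 2
      ≤ (n : ℝ)⁻¹ * ∑ i, (y i - inner ℝ (p (x i)) b') ^ 2

/-- The data of a series regression model with `d` covariates: the number `k` of series terms,
the set `𝒳` of covariate values, the class `𝒢` of functions, the regression function `g`, the
vector `p` of approximating functions and the joint law of a pair `(x_i, y_i)`. -/
structure Model (d : ℕ) where
  k : ℕ
  𝒳 : Set (Euc d)
  𝒢 : Set (Euc d → ℝ)
  g : Euc d → ℝ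
  p : Euc d → Euc k
  law : Measure (Euc d × ℝ)
  isProbabilityMeasure_law : IsProbabilityMeasure law
  measurable_g : Measurable g
  measurable_p : Measurable p

attribute [instance] Model.isProbabilityMeasure_law

namespace Model

variable {d : ℕ} (M : Model d)

/-- The law of the covariates. -/
def F : Measure (Euc d) := M.law.fst

/-- The conditional law of `y_i` given `x_i = x`. -/
def cond (x : Euc d) : Measure ℝ := M.law.condKernel x

/-- `Q = E[p_i p_i']`. -/
def Q : Matrix (Fin M.k) (Fin M.k) ℝ :=
  Matrix.of fun a b => ∫ x, M.p x a * M.p x b ∂M.F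

/-- `β = arg min_b E[(y_i - p_i'b)²]`. -/
def beta : Euc M.k := leastSquares M.law (fun z => z.2) (fun z => M.p z.1)

/-- `β_f = arg min_b E[(f(x_i) - p_i'b)²]`. -/
def betaOf (f : Euc d → ℝ) : Euc M.k := leastSquares M.F f M.p

/-- The approximation error `r_f(x) = f(x) - p(x)'β_f`. -/
def rOf (f : Euc d → ℝ) (x : Euc d) : ℝ := f x - inner ℝ (M.p x) (M.betaOf f)

/-- The approximation error `r = r_g` of the regression function. -/
def r (x : Euc d) : ℝ := M.rOf M.g x

/-- `ξ_k = sup_{x ∈ 𝒳} ‖p(x)‖`. -/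
def xi : ℝ≥0∞ := ⨆ x ∈ M.𝒳, ‖M.p x‖ₑ

/-- `E[ε_i² | x_i = x]`. -/
def condVar (x : Euc d) : ℝ≥0∞ :=
  ∫⁻ y, ENNReal.ofReal ((y - M.g x) ^ 2) ∂M.cond x

/-- `E[ε_i² 1{|ε_i| > t} | x_i = x]`. -/
def condTail (t : ℝ) (x : Euc d) : ℝ≥0∞ :=
  ∫⁻ y in {y | t < |y - M.g x|}, ENNReal.ofReal ((y - M.g x) ^ 2) ∂M.cond x

/-- The infimum over `x` of `E[ε_i² | x_i = x]`. As a conditional expectation given `x_i = x` is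
only determined up to null sets of the law of `x_i`, this is an essential infimum. -/
def sigmaLowSq : ℝ≥0∞ := essInf M.condVar M.F

/-- The (essential) supremum over `x` of `E[ε_i² 1{|ε_i| > t} | x_i = x]`. -/
def supTail (t : ℝ) : ℝ≥0∞ := essSup (M.condTail t) M.F

/-- `Q⁻¹ E[(ε_i + r_i)² p_i p_i'] Q⁻¹`. -/
def OmegaTilde : Matrix (Fin M.k) (Fin M.k) ℝ :=
  M.Q⁻¹ * (Matrix.of fun a b =>
    ∫ z, ((z.2 - M.g z.1) + M.r z.1) ^ 2 * (M.p z.1 a * M.p z.1 b) ∂M.law) * M.Q⁻¹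

/-- `Q⁻¹ E[ε_i² p_i p_i'] Q⁻¹`. -/
def OmegaZero : Matrix (Fin M.k) (Fin M.k) ℝ :=
  M.Q⁻¹ * (Matrix.of fun a b =>
    ∫ z, (z.2 - M.g z.1) ^ 2 * (M.p z.1 a * M.p z.1 b) ∂M.law) * M.Q⁻¹

/-- `R_{2n}(α) = α' Q⁻¹ 𝔾ₙ[p_i r_i]`, for covariates `x i`, `i < n`. -/
def R2 {n : ℕ} (α : Euc M.k) (x : Fin n → Euc d) : ℝ :=
  inner ℝ α (Matrix.toEuclideanLin M.Q⁻¹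
    ((Real.sqrt n)⁻¹ • ∑ i, (M.r (x i) • M.p (x i) - ∫ x', M.r x' • M.p x' ∂M.F)))

end Model

/-- The square root `A^{1/2}` of a symmetric positive semidefinite matrix. -/
def msqrt {k : ℕ} (A : Matrix (Fin k) (Fin k) ℝ) : Matrix (Fin k) (Fin k) ℝ :=
  cfc Real.sqrt A

/-- The norm `‖α' A^{1/2}‖`. -/
def rowNorm {k : ℕ} (A : Matrix (Fin k) (Fin k) ℝ) (α : Euc k) : ℝ :=
  ‖WithLp.toLp 2 (α.ofLp ᵥ* msqrt A)‖

/-- `s(x) = A^{1/2} p(x)`, where `v = p(x)`. -/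
def sVec {k : ℕ} (A : Matrix (Fin k) (Fin k) ℝ) (v : Euc k) : Euc k :=
  Matrix.toEuclideanLin (msqrt A) v

/-- The sampling condition for one sample size: the pairs `(x_i, y_i)`, `i < n`, are
i.i.d. with the law of the model, `x_i ∈ 𝒳`, `g ∈ 𝒢` and `E[ε_i | x_i] = 0` for
`ε_i = y_i - g(x_i)`. -/
structure ConditionA1 {d n : ℕ} (M : Model d) {Ω : Type*} [MeasurableSpace Ω] (μ : Measure Ω)
    (x : Fin n → Ω → Euc d) (y : Fin n → Ω → ℝ) : Prop where
  measurable_x : ∀ i, Measurable (x i)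
  measurable_y : ∀ i, Measurable (y i)
  indep : iIndepFun (fun i ω => (x i ω, y i ω)) μ
  map_eq : ∀ i, μ.map (fun ω => (x i ω, y i ω)) = M.law
  mem_X : ∀ᵐ x' ∂M.F, x' ∈ M.𝒳
  mem_G : M.g ∈ M.𝒢
  integrable_noise : ∀ᵐ x' ∂M.F, Integrable (fun t => t - M.g x') (M.cond x')
  noise_mean : ∀ᵐ x' ∂M.F, ∫ t, (t - M.g x') ∂M.cond x' = 0

/-- Uniformly over `n`, the eigenvalues of `Q` are bounded above and away from zero. -/
def ConditionA2 {d : ℕ} (M : ℕ → Model d) : Prop :=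
  ∃ lo hi : ℝ, 0 < lo ∧ ∀ n, ∀ t ∈ spectrum ℝ (M n).Q, lo ≤ t ∧ t ≤ hi

/-- `‖r_f‖_{F,2} ≤ c` and `‖r_f‖_{F,∞} ≤ ℓ c` for every `f ∈ 𝒢`. -/
def ConditionA3 {d : ℕ} (M : Model d) (c ℓ : ℝ) : Prop :=
  0 ≤ c ∧ ∀ f ∈ M.𝒢,
    eLpNorm (M.rOf f) 2 M.F ≤ ENNReal.ofReal c ∧ ∀ x ∈ M.𝒳, |M.rOf f x| ≤ ℓ * c

/-- `X n → 0` in probability. -/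
def ToZeroInProb {Ω : ℕ → Type*} [∀ n, MeasurableSpace (Ω n)] (μ : ∀ n, Measure (Ω n))
    (X : ∀ n, Ω n → ℝ) : Prop :=
  ∀ δ : ℝ, 0 < δ → Tendsto (fun n => μ n {ω | δ < |X n ω|}) atTop (𝓝 0)

/-- `X n → N(0,1)` in distribution. -/
def ToStdNormal {Ω : ℕ → Type*} [∀ n, MeasurableSpace (Ω n)] (μ : ∀ n, Measure (Ω n))
    [∀ n, IsProbabilityMeasure (μ n)] (X : ∀ n, Ω n → ℝ) : Prop :=
  TendstoInDistribution X atTop (fun z : ℝ => z) μ (gaussianReal 0 1)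

end

end LSSeries

open LSSeries

/-! Write `a = Q⁻¹α`, `Δ = β̂ - β`, and `Q̂` for the empirical Gram matrix. Orthogonality of `p` to
`ε` and to `r` shows that `β` is also the projection coefficient of `g`, so the empirical normal
equations read `n Q̂ Δ = Σ pᵢ(εᵢ + rᵢ)`. With `v = (Q - Q̂)a` and `Q̂ b = v`, this gives `√n α'Δ =
n^{-1/2} Σ a'pᵢ(εᵢ + rᵢ) + n^{-1/2} Σ b'pᵢ(εᵢ + rᵢ)`. The first sum is the linear part, the second
the remainder.

The remainder vanishes in probability (`Regular.measure_remainder_gt_le`,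
`RegularSeq.remainder_toZeroInProb`). Since `b` depends on the covariates only, its `ε` part is
conditionally centred, with second moment at most `V b'Q̂b ≤ V ‖v‖²/τ` when `Q̂ ≥ τ`, and `E‖v‖²` is
of order `ξ²/n`. Its `r` part is at most `(‖v‖/τ) ‖n^{-1/2} Σ rᵢpᵢ‖`, where the summands `rᵢpᵢ` are
centred; this product is of order `ξ n^{-1/2} k^{1/2} ℓc`.

Only a lower bound on `Q̂` is needed, and it comes from a trace potential rather than from a matrix
law of large numbers. Start from `S = s·1`, add the matrices `pᵢpᵢ'` one by one, and follow `E tr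
S^{-m}`. One step contracts the potential towards a fixed level
(`integral_trace_inv_pow_add_vecMulVec_le`), by a deterministic estimate for rank-one updates
(`trace_inv_pow_mul` type bounds, proved in `trace_pow_mul_downdate_pow_le`). Markov's inequality
then bounds the smallest eigenvalue, with failure probability `2k/2^m`; taking `m` of order `log n`
is what uses the logarithm in the rate condition.

The linear part, divided by its standard deviation `σ`, is a row-wise i.i.d. sum, and Lindeberg's
theorem applies. The standard deviation stays away from zero because the cross term between `ε` and
`r` vanishes. A large summand forces a large `|ε|`, since `|a'p| ≤ ξ/lo` and the rate condition
makes `r` small relative to the threshold, so uniform integrability finishes. Replacing `r` by `0`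
in the linear part changes it by `R₂ₙ(α)`, which yields the version with `Ω₀`. Statement (b) is (a)
rescaled, and (c) differs from (b) by the deterministic bias. -/

namespace LSSeries

/-! ### Characteristic functions, Slutsky's lemma and Lindeberg's theorem. -/

section Limits

variable {Ω : ℕ → Type*} [∀ n, MeasurableSpace (Ω n)] {μ : ∀ n, Measure (Ω n)}
  [∀ n, IsProbabilityMeasure (μ n)]

/-- Lévy's continuity theorem; only laws enter, so the probability spaces may vary with `n`. -/
theorem toStdNormal_iff_charFun {X : ∀ n, Ω n → ℝ} (hX : ∀ n, AEMeasurable (X n) (μ n)) :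
    ToStdNormal μ X ↔ ∀ t : ℝ, Tendsto (fun n => charFun ((μ n).map (X n)) t) atTop
      (𝓝 (Complex.exp (-t ^ 2 / 2))) := by
  have key : (∀ t : ℝ, Tendsto (fun n => charFun ((μ n).map (X n)) t) atTop
      (𝓝 (charFun ((gaussianReal 0 1).map (fun z : ℝ => z)) t))) ↔
      ∀ t : ℝ, Tendsto (fun n => charFun ((μ n).map (X n)) t) atTop
      (𝓝 (Complex.exp (-t ^ 2 / 2))) := by
    refine forall_congr' fun t => ?_
    have : charFun ((gaussianReal 0 1).map (fun z : ℝ => z)) t = Complex.exp (-t ^ 2 / 2) := by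
      rw [show (fun z : ℝ => z) = id from rfl, Measure.map_id, charFun_gaussianReal]
      simp [neg_div]
    rw [this]
  rw [← key]
  constructor
  · intro h
    exact ProbabilityMeasure.tendsto_iff_tendsto_charFun.1 h.tendsto
  · intro h
    exact ⟨hX, by fun_prop, ProbabilityMeasure.tendsto_iff_tendsto_charFun.2 h⟩

theorem charFun_map_real {S : Type*} [MeasurableSpace S] {m : Measure S} {X : S → ℝ}
    (hX : AEMeasurable X m) (t : ℝ) :
    charFun (m.map X) t = ∫ s, Complex.exp (t * X s * Complex.I) ∂m := by
  rw [charFun_apply_real, integral_map hX (by fun_prop)]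

theorem norm_exp_mul_I_sub_le (a b : ℝ) :
    ‖Complex.exp (a * Complex.I) - Complex.exp (b * Complex.I)‖ ≤ |a - b| := by
  have : Complex.exp (a * Complex.I) - Complex.exp (b * Complex.I)
      = Complex.exp (b * Complex.I) * (Complex.exp (Complex.I * (a - b : ℝ)) - 1) := by
    rw [mul_sub, ← Complex.exp_add]; congr 2
    · push_cast; ring
    · simp
  rw [this, norm_mul, Complex.norm_exp_ofReal_mul_I, one_mul]
  exact Real.norm_exp_I_mul_ofReal_sub_one_le

theorem norm_exp_mul_I_sub_le_two (a b : ℝ) :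
    ‖Complex.exp (a * Complex.I) - Complex.exp (b * Complex.I)‖ ≤ 2 := by
  refine (norm_sub_le _ _).trans ?_
  rw [Complex.norm_exp_ofReal_mul_I, Complex.norm_exp_ofReal_mul_I]; norm_num

/-- The map `u ↦ exp(iu)` is 1-Lipschitz and has oscillation at most 2: the first bound is used
where `X` and `Y` are within `δ`, the second elsewhere. -/
theorem norm_charFun_map_sub_le {S : Type*} [MeasurableSpace S] {m : Measure S}
    [IsProbabilityMeasure m] {X Y : S → ℝ} (hX : AEMeasurable X m) (hY : AEMeasurable Y m)
    (t : ℝ) {δ : ℝ} (hδ : 0 ≤ δ) :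
    ‖charFun (m.map Y) t - charFun (m.map X) t‖
      ≤ |t| * δ + 2 * m.real {s | δ < |Y s - X s|} := by
  have hb : ∀ Z : S → ℝ, AEMeasurable Z m →
      Integrable (fun s => Complex.exp (t * Z s * Complex.I)) m := by
    intro Z hZ
    refine Integrable.of_bound (by fun_prop) 1 (ae_of_all _ fun s => ?_)
    rw [← Complex.ofReal_mul, Complex.norm_exp_ofReal_mul_I]
  have hs : NullMeasurableSet {s | δ < |Y s - X s|} m :=
    nullMeasurableSet_lt (by fun_prop) (by fun_prop)
  rw [charFun_map_real hX, charFun_map_real hY, ← integral_sub (hb _ hY) (hb _ hX)]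
  have hind : Integrable ({s | δ < |Y s - X s|}.indicator fun _ => (2 : ℝ)) m :=
    (integrable_const _).indicator₀ hs
  calc _ ≤ ∫ s, (|t| * δ + {s | δ < |Y s - X s|}.indicator (fun _ => (2 : ℝ)) s) ∂m := by
        refine norm_integral_le_of_norm_le ((integrable_const _).add hind)
          (ae_of_all _ fun s => ?_)
        rw [← Complex.ofReal_mul, ← Complex.ofReal_mul]
        by_cases h : δ < |Y s - X s|
        · rw [Set.indicator_of_mem (by exact h)]
          have := norm_exp_mul_I_sub_le_two (t * Y s) (t * X s)
          have : 0 ≤ |t| * δ := by positivity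
          linarith
        · rw [Set.indicator_of_notMem (by exact h), add_zero]
          refine (norm_exp_mul_I_sub_le _ _).trans ?_
          rw [← mul_sub, abs_mul]
          gcongr
          exact not_lt.1 h
    _ = _ := by
        rw [integral_add (integrable_const _) hind, integral_indicator₀ hs]
        simp [mul_comm]

/-- Slutsky's lemma for perturbations that vanish in probability, through characteristic functions.
-/
theorem ToStdNormal.of_toZeroInProb_sub {X Y : ∀ n, Ω n → ℝ} (hX : ToStdNormal μ X)
    (hY : ∀ n, AEMeasurable (Y n) (μ n))
    (h : ToZeroInProb μ (fun n ω => Y n ω - X n ω)) : ToStdNormal μ Y := by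
  have hXm := hX.forall_aemeasurable
  rw [toStdNormal_iff_charFun hXm] at hX
  rw [toStdNormal_iff_charFun hY]
  intro t
  have h0 : Tendsto (fun n => charFun ((μ n).map (Y n)) t - charFun ((μ n).map (X n)) t)
      atTop (𝓝 0) := by
    rw [Metric.tendsto_nhds]
    intro ε hε
    set δ : ℝ := ε / (2 * (|t| + 1)) with hδ
    have hδ0 : 0 < δ := by positivity
    have h1 : Tendsto (fun n => (μ n).real {ω | δ < |Y n ω - X n ω|}) atTop (𝓝 0) := by
      have := (ENNReal.tendsto_toReal ENNReal.zero_ne_top).comp (h δ hδ0)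
      simpa [Function.comp_def, Measure.real] using this
    filter_upwards [h1.eventually_lt_const (show (0:ℝ) < ε / 4 by positivity)] with n hn
    rw [dist_zero_right]
    refine (norm_charFun_map_sub_le (hXm n) (hY n) t hδ0.le).trans_lt ?_
    have : |t| * δ ≤ ε / 2 := by
      rw [hδ, mul_div_assoc', div_le_iff₀ (by positivity)]
      nlinarith [abs_nonneg t]
    linarith
  have := (hX t).add h0
  simpa using this

theorem norm_exp_mul_I_taylor_le_sq (u : ℝ) :
    ‖Complex.exp (u * Complex.I) - 1 - u * Complex.I + u ^ 2 / 2‖ ≤ 4 * u ^ 2 := by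
  by_cases h : |u| ≤ 1
  · have h1 : ‖(u * Complex.I : ℂ)‖ ≤ 1 := by simpa using h
    have h2 := Complex.norm_exp_sub_one_sub_id_le h1
    calc _ ≤ ‖Complex.exp (u * Complex.I) - 1 - u * Complex.I‖ + ‖((u : ℂ) ^ 2 / 2)‖ :=
          norm_add_le _ _
      _ ≤ ‖(u * Complex.I : ℂ)‖ ^ 2 + ‖((u : ℂ) ^ 2 / 2)‖ := by gcongr
      _ = |u| ^ 2 + |u| ^ 2 / 2 := by simp
      _ ≤ _ := by rw [sq_abs]; nlinarith [sq_nonneg u]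
  · push Not at h
    calc _ ≤ ‖Complex.exp (u * Complex.I)‖ + ‖(1 : ℂ)‖ + ‖(u * Complex.I : ℂ)‖
          + ‖((u : ℂ) ^ 2 / 2)‖ := by
          refine (norm_add_le _ _).trans ?_
          gcongr
          refine (norm_sub_le _ _).trans ?_
          gcongr
          exact norm_sub_le _ _
      _ = 1 + 1 + |u| + |u| ^ 2 / 2 := by rw [Complex.norm_exp_ofReal_mul_I]; simp
      _ ≤ 4 * |u| ^ 2 := by nlinarith
      _ = _ := by rw [sq_abs]

theorem norm_exp_mul_I_taylor_le_cube {u : ℝ} (h : |u| ≤ 1) :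
    ‖Complex.exp (u * Complex.I) - 1 - u * Complex.I + u ^ 2 / 2‖ ≤ |u| ^ 3 := by
  have h1 : ‖(u * Complex.I : ℂ)‖ ≤ 1 := by simpa using h
  have h2 := Complex.exp_bound h1 (n := 3) (by norm_num)
  have h3 : Complex.exp (u * Complex.I) - 1 - u * Complex.I + u ^ 2 / 2 =
      Complex.exp (u * Complex.I) - ∑ m ∈ Finset.range 3, (u * Complex.I : ℂ) ^ m / m.factorial := by
    simp [Finset.sum_range_succ, mul_pow, Complex.I_sq]
    ring
  rw [h3]
  refine h2.trans ?_
  have : (0:ℝ) ≤ |u| ^ 3 := by positivity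
  simp [Nat.factorial]
  nlinarith

/-- Here `s` is `1 / z ^ 2`. Small `v` takes the cubic Taylor bound, with one factor replaced by
`|t| δ`; large `v` takes the crude quadratic bound. The integral of the right side is the Lindeberg
estimate. -/
theorem norm_exp_mul_I_taylor_le {s t δ z : ℝ} (hδ : 0 ≤ δ) (hs : 0 ≤ s) (hδt : δ * |t| ≤ 1)
    (hsδ : s * z ^ 2 = 1) (hz : 0 < z) (v : ℝ) :
    ‖Complex.exp ((t / z * v : ℝ) * Complex.I) - 1 - (t / z * v : ℝ) * Complex.I
        + ((t / z * v : ℝ) : ℂ) ^ 2 / 2‖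
      ≤ s * (|t| ^ 3 * δ * v ^ 2
        + 4 * t ^ 2 * {w : ℝ | δ * z < |w|}.indicator (fun w => w ^ 2) v) := by
  have hs' : s = 1 / z ^ 2 := by field_simp; linarith
  by_cases h : δ * z < |v|
  · rw [Set.indicator_of_mem (by exact h)]
    refine (norm_exp_mul_I_taylor_le_sq _).trans ?_
    have : 0 ≤ s * (|t| ^ 3 * δ * v ^ 2) := by positivity
    have e : 4 * (t / z * v) ^ 2 = s * (4 * t ^ 2 * v ^ 2) := by rw [hs']; field_simp
    rw [e, mul_add]; linarith
  · rw [Set.indicator_of_notMem (by exact h)]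
    push Not at h
    have hu : |t / z * v| ≤ |t| * δ := by
      rw [abs_mul, abs_div, abs_of_pos hz, div_mul_eq_mul_div, div_le_iff₀ hz, mul_assoc]
      gcongr
    refine (norm_exp_mul_I_taylor_le_cube (hu.trans (by linarith))).trans ?_
    have e : |t / z * v| ^ 3 = |t / z * v| * (s * t ^ 2 * v ^ 2) := by
      rw [pow_succ', sq_abs, hs']; congr 1; field_simp
    rw [e, mul_zero, add_zero]
    calc |t / z * v| * (s * t ^ 2 * v ^ 2) ≤ (|t| * δ) * (s * t ^ 2 * v ^ 2) := by gcongr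
      _ = _ := by rw [← sq_abs t]; ring

theorem norm_charFun_sub_le {ρ : Measure ℝ} [IsProbabilityMeasure ρ] (h0 : ∫ v, v ∂ρ = 0)
    (h1 : ∫ v, v ^ 2 ∂ρ = 1) {δ t z : ℝ} (hδ : 0 ≤ δ) (hδt : δ * |t| ≤ 1) (hz : 0 < z) :
    ‖charFun ρ (t / z) - (1 - t ^ 2 / 2 * (1 / z ^ 2 : ℝ))‖
      ≤ 1 / z ^ 2 * (|t| ^ 3 * δ + 4 * t ^ 2 * ∫ v in {w : ℝ | δ * z < |w|}, v ^ 2 ∂ρ) := by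
  have hi2 : Integrable (fun v : ℝ => v ^ 2) ρ := by
    by_contra h
    rw [integral_undef h] at h1; norm_num at h1
  have hi1 : Integrable (fun v : ℝ => v) ρ := by
    have : MemLp (fun v : ℝ => v) 2 ρ := (memLp_two_iff_integrable_sq (by fun_prop)).2 hi2
    exact this.integrable (by norm_num)
  have hs : MeasurableSet {w : ℝ | δ * z < |w|} := measurableSet_lt (by fun_prop) (by fun_prop)
  have hie : Integrable (fun v : ℝ => Complex.exp ((t / z * v : ℝ) * Complex.I)) ρ := by
    refine Integrable.of_bound (by fun_prop) 1 (ae_of_all _ fun s => ?_)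
    rw [Complex.norm_exp_ofReal_mul_I]
  have hc1 : Integrable (fun v : ℝ => ((t / z * v : ℝ) : ℂ) * Complex.I) ρ :=
    ((hi1.const_mul _).ofReal).mul_const _
  have hc2 : Integrable (fun v : ℝ => ((t / z * v : ℝ) : ℂ) ^ 2 / 2) ρ := by
    have := ((hi2.const_mul ((t / z) ^ 2 / 2)).ofReal (𝕜 := ℂ))
    refine this.congr (ae_of_all _ fun v => ?_)
    simp; ring
  have e : charFun ρ (t / z) - (1 - t ^ 2 / 2 * (1 / z ^ 2 : ℝ)) =
      ∫ v : ℝ, (Complex.exp ((t / z * v : ℝ) * Complex.I) - 1 - (t / z * v : ℝ) * Complex.I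
        + ((t / z * v : ℝ) : ℂ) ^ 2 / 2) ∂ρ := by
    have hA : Integrable (fun v : ℝ => Complex.exp ((t / z * v : ℝ) * Complex.I) - 1) ρ :=
      hie.sub (integrable_const _)
    have hB : Integrable (fun v : ℝ => Complex.exp ((t / z * v : ℝ) * Complex.I) - 1
        - (t / z * v : ℝ) * Complex.I) ρ := hA.sub hc1
    rw [integral_add hB hc2, integral_sub hA hc1, integral_sub hie (integrable_const _),
      charFun_apply_real]
    have e1 : ∫ v : ℝ, ((t / z * v : ℝ) : ℂ) * Complex.I ∂ρ = 0 := by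
      rw [integral_mul_const, integral_complex_ofReal, integral_const_mul, h0]; simp
    have e2 : ∫ v : ℝ, ((t / z * v : ℝ) : ℂ) ^ 2 / 2 ∂ρ = (t : ℂ) ^ 2 / 2 * (1 / z ^ 2 : ℝ) := by
      have : ∀ v : ℝ, ((t / z * v : ℝ) : ℂ) ^ 2 / 2 = (((t / z) ^ 2 / 2 * v ^ 2 : ℝ) : ℂ) := by
        intro v; push_cast; ring
      simp_rw [this]
      rw [integral_complex_ofReal, integral_const_mul, h1]
      push_cast; field_simp
    rw [e1, e2]
    simp
    ring
  rw [e]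
  have hind : Integrable ({w : ℝ | δ * z < |w|}.indicator (fun w => w ^ 2)) ρ :=
    hi2.indicator hs
  have hb : Integrable (fun v : ℝ => 1 / z ^ 2 * (|t| ^ 3 * δ * v ^ 2
        + 4 * t ^ 2 * {w : ℝ | δ * z < |w|}.indicator (fun w => w ^ 2) v)) ρ :=
    ((hi2.const_mul _).add (hind.const_mul _)).const_mul _
  refine (norm_integral_le_of_norm_le hb (ae_of_all _ fun v =>
    norm_exp_mul_I_taylor_le hδ (by positivity) hδt (by field_simp) hz v)).trans ?_
  rw [integral_const_mul, integral_add (hi2.const_mul _) (hind.const_mul _), integral_const_mul,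
    integral_const_mul, h1, integral_indicator hs, mul_one]

/-- **Lindeberg's central limit theorem** for row-wise identically distributed arrays. -/
theorem toStdNormal_of_lindeberg {X : ∀ n, Fin n → Ω n → ℝ} {ρ : ℕ → Measure ℝ}
    [∀ n, IsProbabilityMeasure (ρ n)]
    (hXm : ∀ n i, AEMeasurable (X n i) (μ n)) (hXρ : ∀ n i, (μ n).map (X n i) = ρ n)
    (hind : ∀ n, iIndepFun (X n) (μ n))
    (h0 : ∀ᶠ n in atTop, ∫ v, v ∂ρ n = 0) (h1 : ∀ᶠ n in atTop, ∫ v, v ^ 2 ∂ρ n = 1)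
    (hL : ∀ δ : ℝ, 0 < δ → Tendsto
      (fun n : ℕ => ∫ v in {w : ℝ | δ * Real.sqrt n < |w|}, v ^ 2 ∂ρ n) atTop (𝓝 0)) :
    ToStdNormal μ (fun n ω => (Real.sqrt n)⁻¹ * ∑ i, X n i ω) := by
  have hm : ∀ n : ℕ, AEMeasurable (fun ω => (Real.sqrt n)⁻¹ * ∑ i, X n i ω) (μ n) := fun n =>
    (Finset.aemeasurable_fun_sum _ fun i _ => hXm n i).const_mul _
  rw [toStdNormal_iff_charFun hm]
  intro t
  have e : ∀ n : ℕ, charFun ((μ n).map (fun ω => (Real.sqrt n)⁻¹ * ∑ i, X n i ω)) t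
      = (1 + (charFun (ρ n) (t / Real.sqrt n) - 1)) ^ n := by
    intro n
    rw [charFun_map_mul_comp (Finset.aemeasurable_fun_sum _ fun i _ => hXm n i),
      (hind n).charFun_map_fun_sum_eq_prod (fun i => hXm n i)]
    simp [hXρ, div_eq_inv_mul]
  simp_rw [e]
  -- It suffices that `n(φₙ(t/√n) - 1)` tends to `-t²/2`, where `φₙ` is the common characteristic
  -- function of the row.
  refine Complex.tendsto_one_add_pow_exp_of_tendsto ?_
  rw [← tendsto_sub_nhds_zero_iff, Metric.tendsto_nhds]
  intro ε hε
  -- The first entry makes the cubic term at most `ε/2`, the second keeps the Taylor argument in the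
  -- unit disc; adding 1 to the denominators covers `t = 0`.
  set δ : ℝ := min (ε / (2 * (|t| ^ 3 + 1))) (1 / (|t| + 1)) with hδ
  have hδ0 : 0 < δ := by positivity
  have hδ1 : |t| ^ 3 * δ ≤ ε / 2 := by
    have : δ ≤ ε / (2 * (|t| ^ 3 + 1)) := min_le_left _ _
    calc |t| ^ 3 * δ ≤ (|t| ^ 3 + 1) * (ε / (2 * (|t| ^ 3 + 1))) := by gcongr; linarith
      _ = _ := by field_simp
  have hδ2 : δ * |t| ≤ 1 := by
    have : δ ≤ 1 / (|t| + 1) := min_le_right _ _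
    calc δ * |t| ≤ 1 / (|t| + 1) * (|t| + 1) := by gcongr; linarith
      _ = _ := by field_simp
  have hL' := (hL δ hδ0).const_mul (4 * t ^ 2)
  rw [mul_zero] at hL'
  filter_upwards [h0, h1, hL'.eventually_lt_const (show (0:ℝ) < ε / 2 by positivity),
    eventually_gt_atTop 0] with n hn0 hn1 hnL hn
  have hnR : (0:ℝ) < n := by exact_mod_cast hn
  have hz : 0 < Real.sqrt n := Real.sqrt_pos.2 hnR
  have hb := norm_charFun_sub_le hn0 hn1 hδ0.le hδ2 hz
  have hsq : Real.sqrt n ^ 2 = n := Real.sq_sqrt hnR.le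
  rw [hsq] at hb
  rw [dist_zero_right]
  have e2 : (n : ℂ) * (charFun (ρ n) (t / Real.sqrt n) - 1) - -(t:ℂ) ^ 2 / 2
      = n * (charFun (ρ n) (t / Real.sqrt n) - (1 - t ^ 2 / 2 * (1 / n : ℝ))) := by
    have : (n : ℂ) ≠ 0 := by exact_mod_cast hn.ne'
    push_cast
    field_simp
    ring
  rw [e2, norm_mul, Complex.norm_natCast]
  calc _ ≤ (n : ℝ) * (1 / n * (|t| ^ 3 * δ
          + 4 * t ^ 2 * ∫ v in {w : ℝ | δ * Real.sqrt n < |w|}, v ^ 2 ∂ρ n)) := by gcongr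
    _ = |t| ^ 3 * δ + 4 * t ^ 2 * ∫ v in {w : ℝ | δ * Real.sqrt n < |w|}, v ^ 2 ∂ρ n := by
        field_simp
    _ < ε := by linarith

end Limits

/-! ### Traces of inverse powers under rank-one updates. -/

section PowerTrace

variable {ι : Type*} [Fintype ι]

open Matrix

/-- The downdate `T - ww' / (1 + v'Tv)`, `w = Tv`, of `T = S⁻¹` belonging to `S + vv'`. -/
noncomputable def downdate (T : Matrix ι ι ℝ) (v : ι → ℝ) : Matrix ι ι ℝ :=
  T - (1 + v ⬝ᵥ (T *ᵥ v))⁻¹ • vecMulVec (T *ᵥ v) (T *ᵥ v)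

theorem isSymm_downdate {T : Matrix ι ι ℝ} (hT : T.IsSymm) (v : ι → ℝ) :
    (downdate T v).IsSymm := by
  rw [downdate, IsSymm, transpose_sub, transpose_smul, transpose_vecMulVec, hT]

variable [DecidableEq ι]

theorem exists_orthogonal_diagonalization {T : Matrix ι ι ℝ} (hT : T.IsHermitian) :
    ∃ U : Matrix ι ι ℝ, Uᵀ * U = 1 ∧ U * Uᵀ = 1 ∧ T = U * diagonal hT.eigenvalues * Uᵀ := by
  refine ⟨hT.eigenvectorUnitary, ?_, ?_, ?_⟩
  · have := Unitary.coe_star_mul_self hT.eigenvectorUnitary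
    rwa [star_eq_conjTranspose, conjTranspose_eq_transpose_of_trivial] at this
  · have := Unitary.coe_mul_star_self hT.eigenvectorUnitary
    rwa [Unitary.coe_star, star_eq_conjTranspose, conjTranspose_eq_transpose_of_trivial] at this
  · have := hT.spectral_theorem
    rw [Unitary.conjStarAlgAut_apply, star_eq_conjTranspose,
      conjTranspose_eq_transpose_of_trivial] at this
    simpa [Function.comp_def] using this

theorem conj_diagonal_pow {U : Matrix ι ι ℝ} (hU : Uᵀ * U = 1) (hU' : U * Uᵀ = 1) (l : ι → ℝ)
    (j : ℕ) : (U * diagonal l * Uᵀ) ^ j = U * diagonal (l ^ j) * Uᵀ := by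
  induction j with
  | zero => simp [hU']
  | succ j ih =>
    rw [pow_succ, ih, pow_succ, show U * diagonal (l ^ j) * Uᵀ * (U * diagonal l * Uᵀ)
      = U * diagonal (l ^ j) * (Uᵀ * U) * diagonal l * Uᵀ by simp only [Matrix.mul_assoc], hU,
      Matrix.mul_one, Matrix.mul_assoc U, diagonal_mul_diagonal]
    rfl

theorem dotProduct_conj_diagonal_mulVec (U : Matrix ι ι ℝ) (l v : ι → ℝ) :
    v ⬝ᵥ ((U * diagonal l * Uᵀ) *ᵥ v) = ∑ i, l i * (Uᵀ *ᵥ v) i ^ 2 := by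
  rw [← mulVec_mulVec, ← mulVec_mulVec, dotProduct_mulVec, ← mulVec_transpose, dotProduct]
  refine Finset.sum_congr rfl fun i _ => ?_
  rw [mulVec_diagonal]; ring

theorem trace_conj_diagonal {U : Matrix ι ι ℝ} (hU : Uᵀ * U = 1) (l : ι → ℝ) :
    (U * diagonal l * Uᵀ).trace = ∑ i, l i := by
  rw [Matrix.mul_assoc, trace_mul_comm, Matrix.mul_assoc, hU, Matrix.mul_one, trace_diagonal]

theorem dotProduct_pow_mulVec_nonneg {T : Matrix ι ι ℝ} (hT : T.PosSemidef) (v : ι → ℝ) (a : ℕ) :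
    0 ≤ v ⬝ᵥ (T ^ a *ᵥ v) := by
  simpa using (hT.pow a).dotProduct_mulVec_nonneg v

/-- Log-convexity of the moments `a ↦ v'Tᵃv` of a positive semidefinite matrix. -/
theorem dotProduct_pow_mulVec_mul_le {T : Matrix ι ι ℝ} (hT : T.PosSemidef) (v : ι → ℝ) (a b : ℕ) :
    (v ⬝ᵥ (T ^ (a + 1) *ᵥ v)) * (v ⬝ᵥ (T ^ (b + 1) *ᵥ v))
      ≤ (v ⬝ᵥ (T *ᵥ v)) * (v ⬝ᵥ (T ^ (a + b + 1) *ᵥ v)) := by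
  obtain ⟨U, hU, hU', e⟩ := exists_orthogonal_diagonalization hT.isHermitian
  set l := hT.isHermitian.eigenvalues
  have hl : ∀ i, 0 ≤ l i := hT.eigenvalues_nonneg
  have key : ∀ j, v ⬝ᵥ (T ^ j *ᵥ v) = ∑ i, l i ^ j * (Uᵀ *ᵥ v) i ^ 2 := by
    intro j
    rw [e, conj_diagonal_pow hU hU', dotProduct_conj_diagonal_mulVec]
    rfl
  have key1 := key 1
  rw [pow_one] at key1
  rw [key1, key, key, key]
  set q : ι → ℝ := fun i => (Uᵀ *ᵥ v) i ^ 2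
  have hq : ∀ i, 0 ≤ q i := fun i => sq_nonneg _
  change (∑ i, l i ^ (a + 1) * q i) * (∑ i, l i ^ (b + 1) * q i)
    ≤ (∑ i, l i ^ 1 * q i) * ∑ i, l i ^ (a + b + 1) * q i
  -- Chebyshev's association inequality: under the weights `l i * q i`, the functions `l ^ a` and `l
  -- ^ b` are similarly ordered.
  have hpos : 0 ≤ ∑ i, ∑ j, (l i * q i * (l j * q j)) *
      ((l i ^ a - l j ^ a) * (l i ^ b - l j ^ b)) := by
    refine Finset.sum_nonneg fun i _ => Finset.sum_nonneg fun j _ => ?_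
    refine mul_nonneg (mul_nonneg (mul_nonneg (hl i) (hq i)) (mul_nonneg (hl j) (hq j))) ?_
    rcases le_total (l i) (l j) with h | h
    · exact mul_nonneg_of_nonpos_of_nonpos
        (sub_nonpos.2 (pow_le_pow_left₀ (hl i) h a)) (sub_nonpos.2 (pow_le_pow_left₀ (hl i) h b))
    · exact mul_nonneg (sub_nonneg.2 (pow_le_pow_left₀ (hl j) h a))
        (sub_nonneg.2 (pow_le_pow_left₀ (hl j) h b))
  have hexp : ∑ i, ∑ j, (l i * q i * (l j * q j)) * ((l i ^ a - l j ^ a) * (l i ^ b - l j ^ b))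
      = 2 * ((∑ i, l i ^ 1 * q i) * ∑ i, l i ^ (a + b + 1) * q i)
        - 2 * ((∑ i, l i ^ (a + 1) * q i) * (∑ i, l i ^ (b + 1) * q i)) := by
    have h1 : ∀ i j, (l i * q i * (l j * q j)) * ((l i ^ a - l j ^ a) * (l i ^ b - l j ^ b))
        = (l i ^ (a + b + 1) * q i) * (l j ^ 1 * q j) + (l i ^ 1 * q i) * (l j ^ (a + b + 1) * q j)
          - (l i ^ (a + 1) * q i) * (l j ^ (b + 1) * q j)
          - (l i ^ (b + 1) * q i) * (l j ^ (a + 1) * q j) := by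
      intro i j; ring
    simp_rw [h1, Finset.sum_sub_distrib, Finset.sum_add_distrib, ← Finset.mul_sum,
      ← Finset.sum_mul]
    ring
  linarith

/-- The Sherman–Morrison formula. -/
theorem inv_add_vecMulVec {S : Matrix ι ι ℝ} (hS : S.PosDef) (v : ι → ℝ) :
    (S + vecMulVec v v)⁻¹ = downdate S⁻¹ v := by
  have hu : IsUnit S.det := (isUnit_iff_isUnit_det S).1 hS.isUnit
  have he : 0 ≤ v ⬝ᵥ (S⁻¹ *ᵥ v) := by
    simpa using hS.inv.posSemidef.dotProduct_mulVec_nonneg v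
  have hT : (S⁻¹).IsSymm := by
    have := hS.inv.isHermitian
    rwa [IsHermitian, conjTranspose_eq_transpose_of_trivial] at this
  refine inv_eq_right_inv ?_
  set e := v ⬝ᵥ (S⁻¹ *ᵥ v) with hedef
  have h1 : S * vecMulVec (S⁻¹ *ᵥ v) (S⁻¹ *ᵥ v) = vecMulVec v (S⁻¹ *ᵥ v) := by
    rw [mul_vecMulVec, mulVec_mulVec, mul_nonsing_inv _ hu, one_mulVec]
  have h2 : vecMulVec v v * S⁻¹ = vecMulVec v (S⁻¹ *ᵥ v) := by
    rw [vecMulVec_mul, ← mulVec_transpose, hT]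
  have h3 : vecMulVec v v * vecMulVec (S⁻¹ *ᵥ v) (S⁻¹ *ᵥ v) = e • vecMulVec v (S⁻¹ *ᵥ v) := by
    rw [vecMulVec_mul_vecMulVec, hedef, vecMulVec_smul]
  have hne : 1 + e ≠ 0 := by positivity
  rw [downdate, Matrix.add_mul, Matrix.mul_sub, Matrix.mul_sub, mul_nonsing_inv _ hu,
    Matrix.mul_smul, Matrix.mul_smul, h1, h2, h3, ← hedef, smul_smul]
  have : (1 + e)⁻¹ + (1 + e)⁻¹ * e = 1 := by field_simp
  have h4 : vecMulVec v (S⁻¹ *ᵥ v) = (1 + e)⁻¹ • vecMulVec v (S⁻¹ *ᵥ v)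
      + ((1 + e)⁻¹ * e) • vecMulVec v (S⁻¹ *ᵥ v) := by rw [← add_smul, this, one_smul]
  nth_rw 2 [h4]
  abel

/-- With `w = Tv` and `D = T - γ ww'`, peeling one factor `D` off the trace loses `γ w'T^a D^j w`.
If every `D` in this loss were `T`, the total would be `j γ v'T^{a+j+1}v`; log-convexity of the
moments shows that the replacement costs only the factor `1 - jδ`. The matrices `T` and `D` need not
commute, hence the mixed words `T^a D^j`. -/
theorem trace_pow_mul_downdate_pow_le {T : Matrix ι ι ℝ} (hT : T.PosSemidef) (v : ι → ℝ)
    {δ : ℝ} (hδ : v ⬝ᵥ (T *ᵥ v) / (1 + v ⬝ᵥ (T *ᵥ v)) ≤ δ) (j : ℕ) (hj : j * δ ≤ 1) (a : ℕ) :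
    (T ^ a * downdate T v ^ j).trace ≤ (T ^ (a + j)).trace
      - j * (1 - j * δ) * ((1 + v ⬝ᵥ (T *ᵥ v))⁻¹ * (v ⬝ᵥ (T ^ (a + j + 1) *ᵥ v))) := by
  have hsym : T.IsSymm := by
    have := hT.isHermitian
    rwa [IsHermitian, conjTranspose_eq_transpose_of_trivial] at this
  have he0 : 0 ≤ v ⬝ᵥ (T *ᵥ v) := by simpa using hT.dotProduct_mulVec_nonneg v
  set e := v ⬝ᵥ (T *ᵥ v) with he
  set γ := (1 + e)⁻¹ with hγ
  have hγ0 : 0 < γ := by positivity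
  have hδ0 : 0 ≤ δ := le_trans (by positivity) hδ
  set w := T *ᵥ v with hw
  have hwq : ∀ b, w ⬝ᵥ (T ^ b *ᵥ w) = v ⬝ᵥ (T ^ (b + 2) *ᵥ v) := by
    intro b
    nth_rw 1 [hw]
    rw [hw, dotProduct_comm, dotProduct_mulVec, ← mulVec_transpose, hsym, dotProduct_comm,
      mulVec_mulVec, mulVec_mulVec]
    congr 2
    rw [← pow_succ', ← pow_succ]
  have hTsym : ∀ b, (T ^ b)ᵀ = T ^ b := fun b => by rw [transpose_pow, hsym]
  have hDsym : ∀ b, (downdate T v ^ b)ᵀ = downdate T v ^ b := fun b => by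
    rw [transpose_pow, isSymm_downdate hsym]
  have hc0 : ∀ b, 0 ≤ w ⬝ᵥ (T ^ b *ᵥ w) := fun b => dotProduct_pow_mulVec_nonneg hT w b
  -- A product of two moments is absorbed into a single one, at the price `γe = e/(1+e) ≤ δ`.
  have hcc : ∀ b c : ℕ, γ * ((w ⬝ᵥ (T ^ b *ᵥ w)) * (w ⬝ᵥ (T ^ c *ᵥ w)))
      ≤ δ * (w ⬝ᵥ (T ^ (b + c + 1) *ᵥ w)) := by
    intro b c
    have h1 := dotProduct_pow_mulVec_mul_le hT v (b + 1) (c + 1)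
    have h2 := hc0 (b + c + 1)
    rw [hwq] at h2
    rw [hwq, hwq, hwq]
    calc _ ≤ γ * (e * (v ⬝ᵥ (T ^ (b + 1 + (c + 1) + 1) *ᵥ v))) := by gcongr
      _ = e / (1 + e) * (v ⬝ᵥ (T ^ (b + c + 1 + 2) *ᵥ v)) := by
          rw [hγ, show b + 1 + (c + 1) + 1 = b + c + 1 + 2 by ring]; ring
      _ ≤ _ := by gcongr
  -- mixed moments
  have hmix : ∀ j : ℕ, j * δ ≤ 1 → ∀ b : ℕ,
      (1 - j * δ) * (w ⬝ᵥ (T ^ (b + j) *ᵥ w)) ≤ w ⬝ᵥ ((T ^ b * downdate T v ^ j) *ᵥ w) ∧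
      w ⬝ᵥ ((T ^ b * downdate T v ^ j) *ᵥ w) ≤ w ⬝ᵥ (T ^ (b + j) *ᵥ w) := by
    intro j
    induction j with
    | zero => intro _ b; simp
    | succ j ih =>
      intro hj b
      push_cast at hj
      have hj' : j * δ ≤ 1 := by nlinarith
      have hrec : w ⬝ᵥ ((T ^ b * downdate T v ^ (j + 1)) *ᵥ w)
          = w ⬝ᵥ ((T ^ (b + 1) * downdate T v ^ j) *ᵥ w)
            - γ * ((w ⬝ᵥ (T ^ b *ᵥ w)) * (w ⬝ᵥ ((T ^ 0 * downdate T v ^ j) *ᵥ w))) := by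
        rw [pow_succ' (downdate T v)]
        nth_rw 1 [downdate]
        rw [← he, ← hγ, ← hw, Matrix.sub_mul, Matrix.mul_sub, sub_mulVec, dotProduct_sub,
          ← Matrix.mul_assoc, ← pow_succ, Matrix.smul_mul, Matrix.mul_smul, smul_mulVec,
          dotProduct_smul, smul_eq_mul]
        congr 2
        rw [← mulVec_mulVec, ← mulVec_mulVec, vecMulVec_mulVec, pow_zero, Matrix.one_mul]
        simp [mulVec_smul, mul_comm]
      obtain ⟨hl, hu⟩ := ih hj' (b + 1)
      obtain ⟨hl0, hu0⟩ := ih hj' 0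
      rw [show b + 1 + j = b + (j + 1) by ring] at hl hu
      rw [zero_add] at hl0 hu0
      have hc := hcc b j
      rw [show b + j + 1 = b + (j + 1) by ring] at hc
      have h0 : 0 ≤ w ⬝ᵥ ((T ^ 0 * downdate T v ^ j) *ᵥ w) :=
        le_trans (mul_nonneg (by linarith) (hc0 j)) hl0
      constructor
      · rw [hrec]
        have : γ * ((w ⬝ᵥ (T ^ b *ᵥ w)) * (w ⬝ᵥ ((T ^ 0 * downdate T v ^ j) *ᵥ w)))
            ≤ γ * ((w ⬝ᵥ (T ^ b *ᵥ w)) * (w ⬝ᵥ (T ^ j *ᵥ w))) := by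
          have := hc0 b
          gcongr
        push_cast
        linarith
      · rw [hrec]
        have : 0 ≤ γ * ((w ⬝ᵥ (T ^ b *ᵥ w)) * (w ⬝ᵥ ((T ^ 0 * downdate T v ^ j) *ᵥ w))) := by
          have := hc0 b
          positivity
        linarith
  -- The exponent `a` must stay general: each peeled factor turns `T^a` into `T^{a+1}`.
  revert hj a
  induction j with
  | zero => intro _ a; simp
  | succ j ih =>
    intro hj a
    have hj0 : (j + 1 : ℝ) * δ ≤ 1 := by exact_mod_cast hj
    have hj' : j * δ ≤ 1 := by nlinarith
    have hrec : (T ^ a * downdate T v ^ (j + 1)).trace = (T ^ (a + 1) * downdate T v ^ j).trace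
        - γ * (w ⬝ᵥ ((T ^ a * downdate T v ^ j) *ᵥ w)) := by
      rw [pow_succ' (downdate T v)]
      nth_rw 1 [downdate]
      rw [← he, ← hγ, ← hw, Matrix.sub_mul, Matrix.mul_sub, trace_sub, ← Matrix.mul_assoc,
        ← pow_succ, Matrix.smul_mul, Matrix.mul_smul, trace_smul, smul_eq_mul]
      congr 2
      rw [vecMulVec_mul, mul_vecMulVec, trace_vecMulVec, ← mulVec_transpose, hDsym,
        dotProduct_comm, dotProduct_mulVec (downdate T v ^ j *ᵥ w), ← mulVec_transpose, hTsym,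
        dotProduct_comm, mulVec_mulVec]
    have h1 := ih hj' (a + 1)
    have h2 := (hmix j hj' a).1
    have h3 := hc0 (a + j)
    rw [hwq] at h2 h3
    rw [hrec, show a + 1 + j = a + (j + 1) by ring] at *
    rw [show a + j + 2 = a + (j + 1) + 1 by ring] at h2 h3
    set c := v ⬝ᵥ (T ^ (a + (j + 1) + 1) *ᵥ v)
    have h4 : γ * ((1 - j * δ) * c) ≤ γ * (w ⬝ᵥ ((T ^ a * downdate T v ^ j) *ᵥ w)) := by gcongr
    have h5 : 0 ≤ (j + 1) * δ * (γ * c) := by positivity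
    push_cast
    nlinarith

/-- Put `e = v'S⁻¹v`. The size condition on `v` gives `me ≤ 1/2`, so `1 - me ≥ 1/2` and `(1+e)⁻¹ ≥
2/3`, and the gain `m(1 - me)(1+e)⁻¹` is at least `m/3`. -/
theorem trace_inv_pow_add_vecMulVec_le {S : Matrix ι ι ℝ} (hS : S.PosDef) {s : ℝ} (hs : 0 < s)
    (hSs : ∀ b, s * (b ⬝ᵥ b) ≤ b ⬝ᵥ (S *ᵥ b)) {m : ℕ} (hm : 0 < m) {v : ι → ℝ}
    (hv : 2 * m * (v ⬝ᵥ v) ≤ s) :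
    (((S + vecMulVec v v)⁻¹) ^ m).trace + m / 3 * (v ⬝ᵥ ((S⁻¹) ^ (m + 1) *ᵥ v))
      ≤ ((S⁻¹) ^ m).trace := by
  have hu : IsUnit S.det := (isUnit_iff_isUnit_det S).1 hS.isUnit
  have hT := hS.inv.posSemidef
  have he0 : 0 ≤ v ⬝ᵥ (S⁻¹ *ᵥ v) := by simpa using hT.dotProduct_mulVec_nonneg v
  have hm1 : (1 : ℝ) ≤ m := by exact_mod_cast hm
  have hvv : 0 ≤ v ⬝ᵥ v := by simpa using dotProduct_self_star_nonneg v
  set e := v ⬝ᵥ (S⁻¹ *ᵥ v) with he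
  -- Cauchy–Schwarz gives `e² ≤ ‖v‖² ‖S⁻¹v‖²`, and `S ≥ s` tested at `S⁻¹v` gives `s ‖S⁻¹v‖² ≤ e`.
  have hes : s * e ≤ v ⬝ᵥ v := by
    have h1 := hSs (S⁻¹ *ᵥ v)
    rw [mulVec_mulVec, mul_nonsing_inv _ hu, one_mulVec, dotProduct_comm _ v, ← he] at h1
    have h2 : e ^ 2 ≤ (v ⬝ᵥ v) * ((S⁻¹ *ᵥ v) ⬝ᵥ (S⁻¹ *ᵥ v)) := by
      have := Finset.sum_mul_sq_le_sq_mul_sq Finset.univ v (S⁻¹ *ᵥ v)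
      simpa [he, dotProduct, sq] using this
    by_contra hcon
    push Not at hcon
    have he1 : 0 < e := by
      by_contra h
      have : e = 0 := le_antisymm (not_lt.1 h) he0
      rw [this] at hcon; linarith
    have h3 : s * e ^ 2 ≤ (v ⬝ᵥ v) * e := by
      calc s * e ^ 2 ≤ s * ((v ⬝ᵥ v) * ((S⁻¹ *ᵥ v) ⬝ᵥ (S⁻¹ *ᵥ v))) := by gcongr
        _ = (v ⬝ᵥ v) * (s * ((S⁻¹ *ᵥ v) ⬝ᵥ (S⁻¹ *ᵥ v))) := by ring
        _ ≤ _ := by gcongr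
    nlinarith
  have hme : 2 * m * e ≤ 1 := by
    have : s * (2 * m * e) ≤ s * 1 := by nlinarith
    exact le_of_mul_le_mul_left this hs
  have he2 : e ≤ 1 / 2 := by nlinarith
  have hδ : e / (1 + e) ≤ e := div_le_self he0 (by linarith)
  have h := trace_pow_mul_downdate_pow_le hT v hδ m (by linarith) 0
  rw [pow_zero, Matrix.one_mul, zero_add, ← inv_add_vecMulVec hS, ← he] at h
  have hc : 0 ≤ v ⬝ᵥ ((S⁻¹) ^ (m + 1) *ᵥ v) := dotProduct_pow_mulVec_nonneg hT v _
  set c := v ⬝ᵥ ((S⁻¹) ^ (m + 1) *ᵥ v)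
  have hγ : 2 / 3 ≤ (1 + e)⁻¹ := by
    rw [le_inv_comm₀ (by norm_num) (by linarith)]; linarith
  have : m / 3 * c ≤ m * (1 - m * e) * ((1 + e)⁻¹ * c) := by
    calc m / 3 * c = m * (1 / 2) * (2 / 3 * c) := by ring
      _ ≤ m * (1 - m * e) * ((1 + e)⁻¹ * c) := by
        have h1 : 1 / 2 ≤ 1 - m * e := by linarith
        gcongr
  linarith

end PowerTrace

/-! ### Lower tail of the smallest eigenvalue of an empirical Gram matrix. -/

section LowerTail

open Matrix

variable {ι : Type*} [Fintype ι]

theorem posDef_of_isSymm {S : Matrix ι ι ℝ} (hS : S.IsSymm) {s : ℝ} (hs : 0 < s)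
    (hSs : ∀ b, s * (b ⬝ᵥ b) ≤ b ⬝ᵥ (S *ᵥ b)) : S.PosDef := by
  refine PosDef.of_dotProduct_mulVec_pos ?_ fun {b} hb => ?_
  · rwa [IsHermitian, conjTranspose_eq_transpose_of_trivial]
  · have h1 : 0 < b ⬝ᵥ b := by simpa using dotProduct_star_self_pos_iff.2 hb
    rw [star_trivial]
    exact lt_of_lt_of_le (mul_pos hs h1) (hSs b)

theorem quadForm_add_vecMulVec (S : Matrix ι ι ℝ) (v b : ι → ℝ) :
    b ⬝ᵥ ((S + vecMulVec v v) *ᵥ b) = b ⬝ᵥ (S *ᵥ b) + (b ⬝ᵥ v) ^ 2 := by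
  rw [add_mulVec, dotProduct_add, vecMulVec_mulVec]
  simp [dotProduct_comm v b, sq]

theorem quadForm_add_sum_vecMulVec {n : ℕ} (S : Matrix ι ι ℝ) (v : Fin n → ι → ℝ) (b : ι → ℝ) :
    b ⬝ᵥ ((S + ∑ i, vecMulVec (v i) (v i)) *ᵥ b) = b ⬝ᵥ (S *ᵥ b) + ∑ i, (b ⬝ᵥ v i) ^ 2 := by
  induction n with
  | zero => simp
  | succ n ih =>
    rw [Fin.sum_univ_castSucc, ← add_assoc, quadForm_add_vecMulVec, ih, Fin.sum_univ_castSucc,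
      add_assoc]

variable [DecidableEq ι]

theorem trace_inv_pow_eq {S U : Matrix ι ι ℝ} {l : ι → ℝ} (hU : Uᵀ * U = 1) (hU' : U * Uᵀ = 1)
    (hl : ∀ i, 0 < l i) (hS : S = U * diagonal l * Uᵀ) (m : ℕ) :
    (S⁻¹ ^ m) = U * diagonal (l⁻¹ ^ m) * Uᵀ := by
  rw [← conj_diagonal_pow hU hU']
  congr 1
  refine inv_eq_right_inv ?_
  rw [hS, show U * diagonal l * Uᵀ * (U * diagonal l⁻¹ * Uᵀ)
    = U * diagonal l * (Uᵀ * U) * diagonal l⁻¹ * Uᵀ by simp only [Matrix.mul_assoc], hU,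
    Matrix.mul_one, Matrix.mul_assoc U, diagonal_mul_diagonal]
  have : (fun i => l i * l⁻¹ i) = fun _ => 1 := by
    funext i
    exact mul_inv_cancel₀ (hl i).ne'
  rw [this, diagonal_one, Matrix.mul_one, hU']

theorem le_of_forall_le_quadForm {S U : Matrix ι ι ℝ} {l : ι → ℝ} (hU : Uᵀ * U = 1)
    (hS : S = U * diagonal l * Uᵀ) {s : ℝ} (hSs : ∀ b, s * (b ⬝ᵥ b) ≤ b ⬝ᵥ (S *ᵥ b)) (i : ι) :
    s ≤ l i := by
  have h := hSs (U *ᵥ Pi.single i 1)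
  rw [hS, dotProduct_conj_diagonal_mulVec, mulVec_mulVec, hU, one_mulVec, dotProduct_mulVec,
    ← mulVec_transpose, mulVec_mulVec, hU, one_mulVec] at h
  simpa [Pi.single_apply] using h

theorem trace_inv_pow_le {S : Matrix ι ι ℝ} (hS : S.PosDef) {s : ℝ} (hs : 0 < s)
    (hSs : ∀ b, s * (b ⬝ᵥ b) ≤ b ⬝ᵥ (S *ᵥ b)) (m : ℕ) :
    (S⁻¹ ^ m).trace ≤ Fintype.card ι * s⁻¹ ^ m := by
  obtain ⟨U, hU, hU', e⟩ := exists_orthogonal_diagonalization hS.isHermitian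
  rw [trace_inv_pow_eq hU hU' hS.eigenvalues_pos e, trace_conj_diagonal hU]
  calc _ ≤ ∑ _i : ι, s⁻¹ ^ m := by
        refine Finset.sum_le_sum fun i _ => ?_
        have := le_of_forall_le_quadForm hU e hSs i
        simp only [Pi.pow_apply, Pi.inv_apply]
        have h0 := hS.eigenvalues_pos i
        gcongr
    _ = _ := by simp

/-- The trace dominates each `λ⁻ᵐ`, so every eigenvalue `λ` exceeds `c`. This is why high powers of
the inverse are useful as a potential. -/
theorem le_quadForm_of_trace_inv_pow_lt {S : Matrix ι ι ℝ} (hS : S.PosDef) {c : ℝ} (hc : 0 < c)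
    {m : ℕ} (h : (S⁻¹ ^ m).trace < c⁻¹ ^ m) (b : ι → ℝ) : c * (b ⬝ᵥ b) ≤ b ⬝ᵥ (S *ᵥ b) := by
  obtain ⟨U, hU, hU', e⟩ := exists_orthogonal_diagonalization hS.isHermitian
  rw [trace_inv_pow_eq hU hU' hS.eigenvalues_pos e, trace_conj_diagonal hU] at h
  have hl : ∀ i, c ≤ hS.isHermitian.eigenvalues i := by
    intro i
    have h0 := hS.eigenvalues_pos i
    have h1 : (hS.isHermitian.eigenvalues i)⁻¹ ^ m < c⁻¹ ^ m := by
      refine lt_of_le_of_lt ?_ h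
      exact Finset.single_le_sum (f := (hS.isHermitian.eigenvalues)⁻¹ ^ m)
        (fun j _ => by have := hS.eigenvalues_pos j; simp; positivity) (Finset.mem_univ i)
    have h2 := lt_of_pow_lt_pow_left₀ m (by positivity) h1
    exact ((inv_lt_inv₀ h0 hc).1 h2).le
  have hb : b ⬝ᵥ b = ∑ i, (Uᵀ *ᵥ b) i ^ 2 := by
    have : b ⬝ᵥ b = b ⬝ᵥ ((U * diagonal 1 * Uᵀ) *ᵥ b) := by
      rw [show diagonal (1 : ι → ℝ) = 1 from diagonal_one, Matrix.mul_one, hU', one_mulVec]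
    rw [this, dotProduct_conj_diagonal_mulVec]; simp
  have hbS := (congrArg (fun A => b ⬝ᵥ (A *ᵥ b)) e).trans (dotProduct_conj_diagonal_mulVec U _ b)
  rw [hb, hbS, Finset.mul_sum]
  gcongr with i
  exact hl i

theorem measurable_det_of_entries {X : Type*} [MeasurableSpace X] {A : X → Matrix ι ι ℝ}
    (hA : ∀ i j, Measurable fun z => A z i j) : Measurable fun z => (A z).det := by
  simp_rw [det_apply]
  fun_prop

/-- By Cramer's rule; singular matrices cause no trouble because the reciprocal of a zero
determinant is zero by convention. -/
theorem measurable_inv_entry {X : Type*} [MeasurableSpace X] {A : X → Matrix ι ι ℝ}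
    (hA : ∀ i j, Measurable fun z => A z i j) (i j : ι) : Measurable fun z => (A z)⁻¹ i j := by
  simp_rw [inv_def, Matrix.smul_apply, Ring.inverse_eq_inv', smul_eq_mul]
  refine (measurable_det_of_entries hA).inv.mul ?_
  simp_rw [adjugate_apply]
  refine measurable_det_of_entries fun a b => ?_
  simp_rw [updateRow_apply]
  split_ifs
  · exact measurable_const
  · exact hA a b

theorem measurable_pow_entry {X : Type*} [MeasurableSpace X] {A : X → Matrix ι ι ℝ}
    (hA : ∀ i j, Measurable fun z => A z i j) (m : ℕ) (i j : ι) :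
    Measurable fun z => (A z ^ m) i j := by
  induction m generalizing i j with
  | zero => simp
  | succ m ih =>
    simp_rw [pow_succ, Matrix.mul_apply]
    exact Finset.measurable_fun_sum _ fun c _ => (ih i c).mul (hA c j)

theorem measurable_trace_inv_pow {X : Type*} [MeasurableSpace X] {A : X → Matrix ι ι ℝ}
    (hA : ∀ i j, Measurable fun z => A z i j) (m : ℕ) :
    Measurable fun z => ((A z)⁻¹ ^ m).trace := by
  simp_rw [trace, diag_apply]
  exact Finset.measurable_fun_sum _ fun i _ => measurable_pow_entry (measurable_inv_entry hA) m i i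

variable {X : Type*} [MeasurableSpace X]

/-- Averaging the rank-one gain over `p z` brings in `E[pp'] ≥ lo`, so the expected decrease is at
least `(m/3) lo tr S^{-(m+1)}`. Bounding `tr S^{-(m+1)}` below by an affine function of `tr S^{-m}`
gives a contraction towards `card ι * θ ^ m` that can be iterated. -/
theorem integral_trace_inv_pow_add_vecMulVec_le {F : Measure X} [IsProbabilityMeasure F]
    {p : X → ι → ℝ} (hp : Measurable p) {B lo : ℝ} (hB : ∀ᵐ z ∂F, p z ⬝ᵥ p z ≤ B) (hlo : 0 < lo)
    (hQ : ∀ b : ι → ℝ, lo * (b ⬝ᵥ b) ≤ ∫ z, (b ⬝ᵥ p z) ^ 2 ∂F)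
    {S : Matrix ι ι ℝ} (hS : S.PosDef) {s : ℝ} (hs : 0 < s)
    (hSs : ∀ b, s * (b ⬝ᵥ b) ≤ b ⬝ᵥ (S *ᵥ b)) {m : ℕ} (hm : 0 < m) (hmB : 2 * m * B ≤ s)
    {θ : ℝ} (hθ : 0 ≤ θ) :
    ∫ z, ((S + vecMulVec (p z) (p z))⁻¹ ^ m).trace ∂F
      ≤ (1 - m / 3 * lo * θ) * (S⁻¹ ^ m).trace + m / 3 * lo * θ * (Fintype.card ι * θ ^ m) := by
  obtain ⟨U, hU, hU', e⟩ := exists_orthogonal_diagonalization hS.isHermitian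
  set l := hS.isHermitian.eigenvalues with hl
  have hl0 : ∀ i, 0 < l i := hS.eigenvalues_pos
  have hint : ∀ i, Integrable (fun z => (Uᵀ *ᵥ p z) i ^ 2) F := by
    intro i
    refine Integrable.of_bound (by simp only [mulVec, dotProduct]; fun_prop) B ?_
    filter_upwards [hB] with z hz
    have h1 : p z ⬝ᵥ p z = ∑ i, (Uᵀ *ᵥ p z) i ^ 2 := by
      have : p z ⬝ᵥ p z = p z ⬝ᵥ ((U * diagonal 1 * Uᵀ) *ᵥ p z) := by
        rw [show diagonal (1 : ι → ℝ) = 1 from diagonal_one, Matrix.mul_one, hU', one_mulVec]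
      rw [this, dotProduct_conj_diagonal_mulVec]; simp
    rw [Real.norm_eq_abs, abs_of_nonneg (sq_nonneg _)]
    refine le_trans ?_ (h1 ▸ hz)
    exact Finset.single_le_sum (f := fun i => (Uᵀ *ᵥ p z) i ^ 2) (fun j _ => sq_nonneg _)
      (Finset.mem_univ i)
  have hlow : ∀ i, lo ≤ ∫ z, (Uᵀ *ᵥ p z) i ^ 2 ∂F := by
    intro i
    have h := hQ (U *ᵥ Pi.single i 1)
    have h1 : (U *ᵥ Pi.single i 1) ⬝ᵥ (U *ᵥ Pi.single i 1) = 1 := by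
      rw [dotProduct_mulVec, ← mulVec_transpose, mulVec_mulVec, hU, one_mulVec]; simp
    have h2 : ∀ z, (U *ᵥ Pi.single i 1) ⬝ᵥ p z = (Uᵀ *ᵥ p z) i := by
      intro z
      rw [dotProduct_comm, dotProduct_mulVec, ← mulVec_transpose]; simp
    simp_rw [h1, h2] at h
    linarith
  have hform : ∀ z, p z ⬝ᵥ (S⁻¹ ^ (m + 1) *ᵥ p z)
      = ∑ i, (l i)⁻¹ ^ (m + 1) * (Uᵀ *ᵥ p z) i ^ 2 := by
    intro z
    rw [trace_inv_pow_eq hU hU' hl0 e, dotProduct_conj_diagonal_mulVec]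
    rfl
  have hintF : Integrable (fun z => p z ⬝ᵥ (S⁻¹ ^ (m + 1) *ᵥ p z)) F := by
    simp_rw [hform]
    exact integrable_finsetSum _ fun i _ => (hint i).const_mul _
  have htr : ∀ j, (S⁻¹ ^ j).trace = ∑ i, (l i)⁻¹ ^ j := by
    intro j
    rw [trace_inv_pow_eq hU hU' hl0 e, trace_conj_diagonal hU]; rfl
  have hge : lo * (θ * ((S⁻¹ ^ m).trace - Fintype.card ι * θ ^ m))
      ≤ ∫ z, p z ⬝ᵥ (S⁻¹ ^ (m + 1) *ᵥ p z) ∂F := by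
    simp_rw [hform]
    rw [integral_finsetSum _ fun i _ => (hint i).const_mul _]
    simp_rw [integral_const_mul]
    have h1 : (S⁻¹ ^ m).trace - Fintype.card ι * θ ^ m = ∑ i, ((l i)⁻¹ ^ m - θ ^ m) := by
      rw [htr, Finset.sum_sub_distrib]; simp
    rw [h1, Finset.mul_sum, Finset.mul_sum]
    refine Finset.sum_le_sum fun i _ => ?_
    have hli : 0 < (l i)⁻¹ := inv_pos.2 (hl0 i)
    -- For eigenvalues with `(l i)⁻¹ ≤ θ` the left side is not positive, for the others one factor
    -- is at least `θ`.
    have h2 : θ * ((l i)⁻¹ ^ m - θ ^ m) ≤ (l i)⁻¹ ^ (m + 1) := by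
      rw [pow_succ']
      rcases le_total θ (l i)⁻¹ with h | h
      · have : 0 ≤ θ * θ ^ m := by positivity
        have : θ * (l i)⁻¹ ^ m ≤ (l i)⁻¹ * (l i)⁻¹ ^ m := by gcongr
        linarith
      · have : θ * (l i)⁻¹ ^ m ≤ θ * θ ^ m := by gcongr
        have : 0 ≤ (l i)⁻¹ * (l i)⁻¹ ^ m := by positivity
        linarith
    calc _ ≤ lo * (l i)⁻¹ ^ (m + 1) := by gcongr
      _ = (l i)⁻¹ ^ (m + 1) * lo := mul_comm _ _
      _ ≤ _ := by gcongr; exact hlow i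
  have hnn : ∀ z, 0 ≤ ((S + vecMulVec (p z) (p z))⁻¹ ^ m).trace := by
    intro z
    have h1 : (S + vecMulVec (p z) (p z)).PosDef :=
      hS.add_posSemidef (by have := posSemidef_vecMulVec_self_star (p z); rwa [star_trivial] at this)
    exact (h1.inv.posSemidef.pow m).trace_nonneg
  calc _ ≤ ∫ z, ((S⁻¹ ^ m).trace - m / 3 * (p z ⬝ᵥ (S⁻¹ ^ (m + 1) *ᵥ p z))) ∂F := by
        refine integral_mono_of_nonneg (ae_of_all _ hnn)
          ((integrable_const _).sub (hintF.const_mul _)) ?_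
        filter_upwards [hB] with z hz
        have := trace_inv_pow_add_vecMulVec_le hS hs hSs hm (v := p z)
          (le_trans (by gcongr) hmB)
        linarith
    _ = (S⁻¹ ^ m).trace - m / 3 * ∫ z, p z ⬝ᵥ (S⁻¹ ^ (m + 1) *ᵥ p z) ∂F := by
        rw [integral_sub (integrable_const _) (hintF.const_mul _), integral_const_mul]; simp
    _ ≤ (S⁻¹ ^ m).trace
        - m / 3 * (lo * (θ * ((S⁻¹ ^ m).trace - Fintype.card ι * θ ^ m))) := by gcongr
    _ = _ := by ring

/-- Integrate out the last `n` draws first, with the first draw absorbed into `S`. This is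
legitimate because `S + pp'` inherits the lower bound `s`; then apply the one-step contraction to
the first draw. -/
theorem integral_trace_inv_pow_add_sum_vecMulVec_le {F : Measure X} [IsProbabilityMeasure F]
    {p : X → ι → ℝ} (hp : Measurable p) {B lo : ℝ} (hB : ∀ᵐ z ∂F, p z ⬝ᵥ p z ≤ B) (hlo : 0 < lo)
    (hQ : ∀ b : ι → ℝ, lo * (b ⬝ᵥ b) ≤ ∫ z, (b ⬝ᵥ p z) ^ 2 ∂F)
    {s : ℝ} (hs : 0 < s) {m : ℕ} (hm : 0 < m) (hmB : 2 * m * B ≤ s)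
    {θ : ℝ} (hθ : 0 ≤ θ) (hq : m / 3 * lo * θ ≤ 1) (n : ℕ)
    {S : Matrix ι ι ℝ} (hS : S.IsSymm) (hSs : ∀ b, s * (b ⬝ᵥ b) ≤ b ⬝ᵥ (S *ᵥ b)) :
    ∫ z, ((S + ∑ i, vecMulVec (p (z i)) (p (z i)))⁻¹ ^ m).trace
        ∂(Measure.pi fun _ : Fin n => F)
      ≤ (1 - m / 3 * lo * θ) ^ n * (S⁻¹ ^ m).trace
        + (1 - (1 - m / 3 * lo * θ) ^ n) * (Fintype.card ι * θ ^ m) := by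
  induction n generalizing S with
  | zero => simp
  | succ n ih =>
    set q := m / 3 * lo * θ with hqdef
    have hpi : ∀ i, Measurable fun z => p z i := fun i => by fun_prop
    have hsymm : ∀ v : ι → ℝ, (S + vecMulVec v v).IsSymm := fun v => by
      rw [IsSymm, transpose_add, transpose_vecMulVec, hS]
    have hge : ∀ v : ι → ℝ, ∀ b, s * (b ⬝ᵥ b) ≤ b ⬝ᵥ ((S + vecMulVec v v) *ᵥ b) := fun v b => by
      rw [quadForm_add_vecMulVec]
      exact (hSs b).trans (le_add_of_nonneg_right (sq_nonneg _))
    set f : X × (Fin n → X) → ℝ := fun w =>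
      ((S + vecMulVec (p w.1) (p w.1) + ∑ i, vecMulVec (p (w.2 i)) (p (w.2 i)))⁻¹ ^ m).trace with hf
    have hfm : Measurable f := by
      refine measurable_trace_inv_pow (fun i j => ?_) m
      simp only [Matrix.add_apply, Matrix.sum_apply, vecMulVec_apply]
      fun_prop
    have hsym2 : ∀ (S' : Matrix ι ι ℝ) (v : Fin n → ι → ℝ), S'.IsSymm →
        (S' + ∑ i, vecMulVec (v i) (v i)).IsSymm := by
      intro S' v h
      rw [IsSymm, transpose_add, transpose_sum, h]
      simp [transpose_vecMulVec]
    have hge2 : ∀ (S' : Matrix ι ι ℝ) (v : Fin n → ι → ℝ),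
        (∀ b, s * (b ⬝ᵥ b) ≤ b ⬝ᵥ (S' *ᵥ b)) →
        ∀ b, s * (b ⬝ᵥ b) ≤ b ⬝ᵥ ((S' + ∑ i, vecMulVec (v i) (v i)) *ᵥ b) := by
      intro S' v h b
      rw [quadForm_add_sum_vecMulVec]
      exact (h b).trans (le_add_of_nonneg_right (Finset.sum_nonneg fun _ _ => sq_nonneg _))
    have hfint : Integrable f (F.prod (Measure.pi fun _ : Fin n => F)) := by
      refine Integrable.of_bound hfm.aestronglyMeasurable (Fintype.card ι * s⁻¹ ^ m)
        (ae_of_all _ fun w => ?_)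
      have hg := hge2 _ (fun i => p (w.2 i)) (hge (p w.1))
      have hpd := posDef_of_isSymm (hsym2 _ (fun i => p (w.2 i)) (hsymm (p w.1))) hs hg
      rw [Real.norm_eq_abs, abs_of_nonneg (hpd.inv.posSemidef.pow m).trace_nonneg]
      exact trace_inv_pow_le hpd hs hg m
    have hmp := measurePreserving_piFinSuccAbove (fun _ : Fin (n + 1) => F) 0
    have e1 : ∫ z, ((S + ∑ i, vecMulVec (p (z i)) (p (z i)))⁻¹ ^ m).trace
        ∂(Measure.pi fun _ : Fin (n + 1) => F)
        = ∫ w, f w ∂(F.prod (Measure.pi fun _ : Fin n => F)) := by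
      rw [← hmp.integral_comp' f]
      congr 1
      funext z
      rw [Fin.sum_univ_succ, ← add_assoc]
      rfl
    rw [e1, integral_prod _ hfint]
    have hpd := posDef_of_isSymm hS hs hSs
    have hone := integral_trace_inv_pow_add_vecMulVec_le hp hB hlo hQ hpd hs hSs hm hmB hθ
    have hgint : Integrable (fun z => ((S + vecMulVec (p z) (p z))⁻¹ ^ m).trace) F := by
      refine Integrable.of_bound (Measurable.aestronglyMeasurable ?_)
        (Fintype.card ι * s⁻¹ ^ m) (ae_of_all _ fun z => ?_)
      · refine measurable_trace_inv_pow (fun i j => ?_) m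
        simp only [Matrix.add_apply, vecMulVec_apply]
        fun_prop
      · have hpd := posDef_of_isSymm (hsymm (p z)) hs (hge (p z))
        rw [Real.norm_eq_abs, abs_of_nonneg (hpd.inv.posSemidef.pow m).trace_nonneg]
        exact trace_inv_pow_le hpd hs (hge (p z)) m
    have hq' : 0 ≤ 1 - q := by linarith
    rw [← hqdef] at hone
    clear_value q f
    have hbint : Integrable (fun z => (1 - q) ^ n * ((S + vecMulVec (p z) (p z))⁻¹ ^ m).trace) F :=
      hgint.const_mul _
    have hle : ∀ z, ∫ z', f (z, z') ∂(Measure.pi fun _ : Fin n => F)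
        ≤ (1 - q) ^ n * ((S + vecMulVec (p z) (p z))⁻¹ ^ m).trace
          + (1 - (1 - q) ^ n) * (Fintype.card ι * θ ^ m) := fun z => by
      have h := ih (hsymm (p z)) (hge (p z))
      simp only [hf]
      exact h
    calc ∫ z, ∫ z', f (z, z') ∂(Measure.pi fun _ : Fin n => F) ∂F
        ≤ ∫ z, ((1 - q) ^ n * ((S + vecMulVec (p z) (p z))⁻¹ ^ m).trace
          + (1 - (1 - q) ^ n) * (Fintype.card ι * θ ^ m)) ∂F := by
          exact integral_mono hfint.integral_prod_left (hbint.add (integrable_const _)) hle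
      _ = (1 - q) ^ n * ∫ z, ((S + vecMulVec (p z) (p z))⁻¹ ^ m).trace ∂F
          + (1 - (1 - q) ^ n) * (Fintype.card ι * θ ^ m) := by
          rw [integral_add hbint (integrable_const _), integral_const_mul]; simp
      _ ≤ (1 - q) ^ n * ((1 - q) * (S⁻¹ ^ m).trace + q * (Fintype.card ι * θ ^ m))
          + (1 - (1 - q) ^ n) * (Fintype.card ι * θ ^ m) :=
          add_le_add_left (mul_le_mul_of_nonneg_left hone (pow_nonneg hq' n)) _
      _ = _ := by ring

/-- Lower tail of the smallest eigenvalue of a sum of `n` independent copies of `pp'`. -/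
theorem exists_measurableSet_le_sum_sq {F : Measure X} [IsProbabilityMeasure F]
    {p : X → ι → ℝ} (hp : Measurable p) {B lo : ℝ} (hB : ∀ᵐ z ∂F, p z ⬝ᵥ p z ≤ B) (hlo : 0 < lo)
    (hloB : lo ≤ B) (hQ : ∀ b : ι → ℝ, lo * (b ⬝ᵥ b) ≤ ∫ z, (b ⬝ᵥ p z) ^ 2 ∂F)
    {n m : ℕ} (hm : 0 < m) (hmB : 48 * m * B ≤ lo * n) :
    ∃ G : Set (Fin n → X), MeasurableSet G ∧
      (Measure.pi fun _ : Fin n => F) Gᶜ ≤ ENNReal.ofReal (2 * Fintype.card ι / 2 ^ m) ∧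
      ∀ z ∈ G, ∀ b : ι → ℝ, lo / 24 * n * (b ⬝ᵥ b) ≤ ∑ i, (b ⬝ᵥ p (z i)) ^ 2 := by
  have hm1 : (1 : ℝ) ≤ m := by exact_mod_cast hm
  have hn : (0 : ℝ) < n := by
    by_contra h
    have h1 : lo * (n : ℝ) ≤ 0 := mul_nonpos_of_nonneg_of_nonpos hlo.le (not_lt.1 h)
    have : 0 < 48 * m * B := by have : 0 < B := hlo.trans_le hloB; positivity
    linarith
  -- The ridge `s` is the size of the eigenvalue bound to be proved: the ridged matrix will be shown
  -- to exceed `2s`, and the ridge is then subtracted.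
  set s : ℝ := lo / 24 * n with hs
  have hs0 : 0 < s := by positivity
  set f : (Fin n → X) → ℝ := fun z =>
    ((s • (1 : Matrix ι ι ℝ) + ∑ i, vecMulVec (p (z i)) (p (z i)))⁻¹ ^ m).trace with hf
  have hpi : ∀ i, Measurable fun z => p z i := fun i => by fun_prop
  have hfm : Measurable f := by
    refine measurable_trace_inv_pow (fun i j => ?_) m
    simp only [Matrix.add_apply, Matrix.sum_apply, vecMulVec_apply]
    fun_prop
  have hS1 : ∀ b : ι → ℝ, b ⬝ᵥ ((s • (1 : Matrix ι ι ℝ)) *ᵥ b) = s * (b ⬝ᵥ b) := by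
    intro b
    rw [smul_mulVec, one_mulVec, dotProduct_smul, smul_eq_mul]
  have hsymm1 : (s • (1 : Matrix ι ι ℝ)).IsSymm := by
    rw [IsSymm, transpose_smul, transpose_one]
  have hge : ∀ z : Fin n → X, ∀ b, s * (b ⬝ᵥ b) ≤
      b ⬝ᵥ ((s • (1 : Matrix ι ι ℝ) + ∑ i, vecMulVec (p (z i)) (p (z i))) *ᵥ b) := by
    intro z b
    rw [quadForm_add_sum_vecMulVec (v := fun i => p (z i)), hS1]
    exact le_add_of_nonneg_right (Finset.sum_nonneg fun _ _ => sq_nonneg _)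
  have hpd : ∀ z : Fin n → X,
      (s • (1 : Matrix ι ι ℝ) + ∑ i, vecMulVec (p (z i)) (p (z i))).PosDef := by
    intro z
    refine posDef_of_isSymm ?_ hs0 (hge z)
    rw [IsSymm, transpose_add, transpose_sum, hsymm1]
    simp [transpose_vecMulVec]
  have hf0 : ∀ z, 0 ≤ f z := fun z => ((hpd z).inv.posSemidef.pow m).trace_nonneg
  have hfint : Integrable f (Measure.pi fun _ : Fin n => F) := by
    refine Integrable.of_bound hfm.aestronglyMeasurable (Fintype.card ι * s⁻¹ ^ m)
      (ae_of_all _ fun z => ?_)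
    rw [Real.norm_eq_abs, abs_of_nonneg (hf0 z)]
    exact trace_inv_pow_le (hpd z) hs0 (hge z) m
  -- With this level the contraction rate `q = (m/3) lo θ` satisfies `nq = 2m`. The initial trace is
  -- thus damped by `exp(-2m) ≤ 4⁻ᵐ`, to the size of the limiting level.
  set θ : ℝ := (4 * s)⁻¹ with hθ
  have hqn : m / 3 * lo * θ * n = 2 * m := by rw [hθ, hs]; field_simp; norm_num
  have hq1 : m / 3 * lo * θ ≤ 1 := by
    have h1 : m / 3 * lo * θ * n ≤ 1 * n := by
      rw [hqn, one_mul]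
      have : lo * (48 * m) ≤ lo * n := by
        calc lo * (48 * m) = 48 * m * lo := by ring
          _ ≤ 48 * m * B := by gcongr
          _ ≤ _ := hmB
      have := le_of_mul_le_mul_left this hlo
      linarith
    exact le_of_mul_le_mul_right h1 hn
  have hE := integral_trace_inv_pow_add_sum_vecMulVec_le hp hB hlo hQ hs0 hm
    (by rw [hs]; linarith) (θ := θ) (by positivity) hq1 n hsymm1 (fun b => (hS1 b).ge)
  have hE2 : ∫ z, f z ∂(Measure.pi fun _ : Fin n => F) ≤ 2 * Fintype.card ι * θ ^ m := by
    refine hE.trans ?_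
    have hq0 : 0 ≤ m / 3 * lo * θ := by positivity
    have hp1 : (1 - m / 3 * lo * θ) ^ n ≤ 4⁻¹ ^ m := by
      calc (1 - m / 3 * lo * θ) ^ n ≤ Real.exp (-(m / 3 * lo * θ)) ^ n := by
            have : 0 ≤ 1 - m / 3 * lo * θ := by linarith
            gcongr
            exact Real.one_sub_le_exp_neg _
        _ = Real.exp (-2) ^ m := by
            rw [← Real.exp_nat_mul, ← Real.exp_nat_mul]; congr 1; linarith
        _ ≤ 4⁻¹ ^ m := by
            gcongr
            rw [Real.exp_neg]
            gcongr
            have := Real.add_one_le_exp 1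
            rw [show (2:ℝ) = 1 + 1 by norm_num, Real.exp_add]
            nlinarith
    have hp0 : 0 ≤ (1 - m / 3 * lo * θ) ^ n := pow_nonneg (by linarith) _
    have htr := trace_inv_pow_le (posDef_of_isSymm hsymm1 hs0 fun b => (hS1 b).ge) hs0
      (fun b => (hS1 b).ge) m
    calc _ ≤ 4⁻¹ ^ m * (Fintype.card ι * s⁻¹ ^ m) + 1 * (Fintype.card ι * θ ^ m) := by
          refine add_le_add (mul_le_mul hp1 htr ?_ (by positivity)) ?_
          · exact ((posDef_of_isSymm hsymm1 hs0 fun b => (hS1 b).ge).inv.posSemidef.pow m).trace_nonneg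
          · refine mul_le_mul_of_nonneg_right (by linarith) (by positivity)
      _ = _ := by
          have e4 : θ ^ m = 4⁻¹ ^ m * s⁻¹ ^ m := by rw [hθ, mul_inv, mul_pow]
          rw [e4]; ring
  -- Markov's inequality at `(2s)⁻ᵐ` against a mean of at most `2 card (4s)⁻ᵐ` leaves the factor
  -- `2⁻ᵐ`.
  refine ⟨{z | f z < (2 * s)⁻¹ ^ m}, measurableSet_lt hfm measurable_const, ?_, ?_⟩
  · have hmk := mul_meas_ge_le_integral_of_nonneg (ae_of_all _ hf0) hfint ((2 * s)⁻¹ ^ m)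
    have hset : {z | f z < (2 * s)⁻¹ ^ m}ᶜ = {z | (2 * s)⁻¹ ^ m ≤ f z} := by
      ext z; simp
    rw [hset, ← ENNReal.ofReal_toReal (measure_ne_top _ {z | (2 * s)⁻¹ ^ m ≤ f z})]
    refine ENNReal.ofReal_le_ofReal ?_
    change (Measure.pi fun _ : Fin n => F).real _ ≤ _
    have hpos : 0 < (2 * s)⁻¹ ^ m := by positivity
    have h3 := hmk.trans hE2
    rw [← le_div_iff₀' hpos] at h3
    refine h3.trans (le_of_eq ?_)
    rw [hθ, show (4 * s)⁻¹ = (2 * s)⁻¹ * 2⁻¹ by rw [← mul_inv]; ring, mul_pow]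
    have : (2 : ℝ)⁻¹ ^ m * 2 ^ m = 1 := by rw [← mul_pow]; norm_num
    rw [div_eq_div_iff (by positivity) (by positivity)]
    calc _ = 2 * Fintype.card ι * (2 * s)⁻¹ ^ m * ((2 : ℝ)⁻¹ ^ m * 2 ^ m) := by ring
      _ = _ := by rw [this, mul_one]
  · intro z hz b
    have h := le_quadForm_of_trace_inv_pow_lt (hpd z) (by positivity) hz b
    rw [quadForm_add_sum_vecMulVec (v := fun i => p (z i)), hS1] at h
    linarith

end LowerTail

/-! ### Population least squares and its normal equations. -/

section LeastSquares

variable {S : Type*} [MeasurableSpace S] {k : ℕ} {m : Measure S} [IsFiniteMeasure m]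
  {q : S → Euc k} {K lo : ℝ}

theorem Euc.inner_eq_sum (u v : Euc k) : inner ℝ u v = ∑ i, u i * v i := by
  rw [EuclideanSpace.inner_eq_star_dotProduct, dotProduct]
  exact Finset.sum_congr rfl fun i _ => by simp [mul_comm]

theorem Euc.norm_sq_eq_sum (u : Euc k) : ‖u‖ ^ 2 = ∑ i, u i ^ 2 := by
  rw [EuclideanSpace.real_norm_sq_eq]

theorem Euc.norm_sq_eq_dotProduct (u : Euc k) : ‖u‖ ^ 2 = u.ofLp ⬝ᵥ u.ofLp := by
  rw [Euc.norm_sq_eq_sum, dotProduct]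
  exact Finset.sum_congr rfl fun i _ => by rw [sq]

theorem Euc.inner_eq_dotProduct (u v : Euc k) : inner ℝ u v = u.ofLp ⬝ᵥ v.ofLp :=
  Euc.inner_eq_sum u v

theorem abs_inner_le_of_norm_le {v : Euc k} (hv : ‖v‖ ≤ K) (b : Euc k) :
    |inner ℝ v b| ≤ K * ‖b‖ :=
  (abs_real_inner_le_norm v b).trans (by gcongr)

theorem memLp_inner_of_bounded (hq : Measurable q) (hK : ∀ᵐ s ∂m, ‖q s‖ ≤ K) (b : Euc k)
    (e : ℝ≥0∞) : MemLp (fun s => inner ℝ (q s) b) e m :=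
  MemLp.of_bound (by fun_prop) (K * ‖b‖)
    (hK.mono fun _ hs => abs_inner_le_of_norm_le hs b)

theorem integrable_mul_inner (hq : Measurable q) (hK : ∀ᵐ s ∂m, ‖q s‖ ≤ K) {u : S → ℝ}
    (hu : MemLp u 2 m) (b : Euc k) : Integrable (fun s => u s * inner ℝ (q s) b) m :=
  hu.integrable_mul (memLp_inner_of_bounded hq hK b 2)

theorem abs_coord_le_norm (v : Euc k) (i : Fin k) : |v i| ≤ ‖v‖ := by
  have := PiLp.norm_apply_le v i
  simpa using this

theorem memLp_coord_of_bounded (hq : Measurable q) (hK : ∀ᵐ s ∂m, ‖q s‖ ≤ K) (i : Fin k)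
    (e : ℝ≥0∞) : MemLp (fun s => q s i) e m :=
  MemLp.of_bound (by fun_prop) K (hK.mono fun _ hs => (abs_coord_le_norm _ i).trans hs)

/-- The Gram matrix `∫ qq' dm`. -/
noncomputable def gram (m : Measure S) (q : S → Euc k) : Matrix (Fin k) (Fin k) ℝ :=
  Matrix.of fun a b => ∫ s, q s a * q s b ∂m

theorem isSymm_gram (m : Measure S) (q : S → Euc k) : (gram m q).IsSymm := by
  ext a b
  simp [gram, Matrix.transpose_apply, mul_comm]

theorem inner_gram (hq : Measurable q) (hK : ∀ᵐ s ∂m, ‖q s‖ ≤ K) (h b : Euc k) :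
    inner ℝ h (Matrix.toEuclideanLin (gram m q) b)
      = ∫ s, inner ℝ (q s) h * inner ℝ (q s) b ∂m := by
  have hi : ∀ i j, Integrable (fun s => h i * (q s i * q s j * b j)) m := fun i j =>
    (((memLp_coord_of_bounded hq hK i 2).integrable_mul
      (memLp_coord_of_bounded hq hK j 2)).mul_const _).const_mul _
  have e : ∀ s, inner ℝ (q s) h * inner ℝ (q s) b = ∑ i, ∑ j, h i * (q s i * q s j * b j) := by
    intro s
    rw [Euc.inner_eq_sum, Euc.inner_eq_sum, Finset.sum_mul_sum]
    refine Finset.sum_congr rfl fun i _ => Finset.sum_congr rfl fun j _ => by ring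
  simp_rw [e]
  rw [integral_finsetSum _ fun i _ => integrable_finsetSum _ fun j _ => hi i j, Euc.inner_eq_sum]
  refine Finset.sum_congr rfl fun i _ => ?_
  rw [integral_finsetSum _ fun j _ => hi i j, Matrix.toLpLin_apply]
  simp only [Matrix.mulVec, dotProduct, gram, Matrix.of_apply, Finset.mul_sum]
  refine Finset.sum_congr rfl fun j _ => ?_
  rw [integral_const_mul, integral_mul_const]

theorem exists_gram_eq (hq : Measurable q) (hK : ∀ᵐ s ∂m, ‖q s‖ ≤ K) (hlo : 0 < lo)
    (hQ : ∀ b, lo * ‖b‖ ^ 2 ≤ ∫ s, (inner ℝ (q s) b) ^ 2 ∂m) (v : Euc k) :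
    ∃ b, Matrix.toEuclideanLin (gram m q) b = v := by
  have hinj : Function.Injective (Matrix.toEuclideanLin (gram m q)) := by
    rw [← LinearMap.ker_eq_bot, LinearMap.ker_eq_bot']
    intro b hb
    have h1 := inner_gram hq hK b b
    rw [hb, inner_zero_right] at h1
    have h2 := hQ b
    simp_rw [sq (inner ℝ (q _) b)] at h2
    rw [← h1] at h2
    have h3 : ‖b‖ ^ 2 ≤ 0 := by
      by_contra h
      have := mul_pos hlo (not_le.1 h)
      linarith
    have h4 : ‖b‖ ^ 2 = 0 := le_antisymm h3 (by positivity)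
    simpa using h4
  exact LinearMap.injective_iff_surjective.1 hinj v

theorem eq_of_normal_equations (hq : Measurable q) (hK : ∀ᵐ s ∂m, ‖q s‖ ≤ K) (hlo : 0 < lo)
    (hQ : ∀ b, lo * ‖b‖ ^ 2 ≤ ∫ s, (inner ℝ (q s) b) ^ 2 ∂m) {u : S → ℝ} (hu : MemLp u 2 m)
    {b b' : Euc k} (h : ∀ h, ∫ s, (u s - inner ℝ (q s) b) * inner ℝ (q s) h ∂m = 0)
    (h' : ∀ h, ∫ s, (u s - inner ℝ (q s) b') * inner ℝ (q s) h ∂m = 0) : b = b' := by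
  have hi : ∀ c, Integrable (fun s => (u s - inner ℝ (q s) c) * inner ℝ (q s) (b - b')) m :=
    fun c => integrable_mul_inner hq hK (hu.sub (memLp_inner_of_bounded hq hK c 2)) _
  have h1 : ∫ s, (inner ℝ (q s) (b - b')) ^ 2 ∂m = 0 := by
    have : ∀ s, (inner ℝ (q s) (b - b')) ^ 2
        = (u s - inner ℝ (q s) b') * inner ℝ (q s) (b - b')
          - (u s - inner ℝ (q s) b) * inner ℝ (q s) (b - b') := by
      intro s; rw [inner_sub_right]; ring
    simp_rw [this]
    rw [integral_sub (hi b') (hi b), h, h', sub_zero]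
  have h2 := hQ (b - b')
  rw [h1] at h2
  have h3 : ‖b - b'‖ ^ 2 ≤ 0 := by
    by_contra h
    have := mul_pos hlo (not_le.1 h)
    linarith
  have h4 : ‖b - b'‖ ^ 2 = 0 := le_antisymm h3 (by positivity)
  rw [← sub_eq_zero]
  simpa using h4

/-- The minimiser is an arbitrary choice, so existence and uniqueness must be supplied. A solution
of the normal equations exists since the Gram matrix is invertible; Pythagoras shows that it
minimises and that any other minimiser is at distance zero from it. -/
theorem leastSquares_normal_equations (hq : Measurable q) (hK : ∀ᵐ s ∂m, ‖q s‖ ≤ K)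
    (hlo : 0 < lo) (hQ : ∀ b, lo * ‖b‖ ^ 2 ≤ ∫ s, (inner ℝ (q s) b) ^ 2 ∂m) {u : S → ℝ}
    (hu : MemLp u 2 m) (h : Euc k) :
    ∫ s, (u s - inner ℝ (q s) (leastSquares m u q)) * inner ℝ (q s) h ∂m = 0 := by
  obtain ⟨b₀, hb₀⟩ := exists_gram_eq hq hK hlo hQ
    (WithLp.toLp 2 fun i => ∫ s, u s * q s i ∂m)
  have hnormal : ∀ h, ∫ s, (u s - inner ℝ (q s) b₀) * inner ℝ (q s) h ∂m = 0 := by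
    intro h
    have h1 := inner_gram hq hK h b₀
    rw [hb₀, Euc.inner_eq_sum] at h1
    have h2 : ∫ s, u s * inner ℝ (q s) h ∂m = ∑ i, h i * ∫ s, u s * q s i ∂m := by
      have : ∀ s, u s * inner ℝ (q s) h = ∑ i, h i * (u s * q s i) := by
        intro s
        rw [Euc.inner_eq_sum, Finset.mul_sum]
        exact Finset.sum_congr rfl fun i _ => by ring
      have hi : ∀ i, Integrable (fun s => u s * q s i) m := fun i =>
        hu.integrable_mul (memLp_coord_of_bounded hq hK i 2)
      simp_rw [this]
      rw [integral_finsetSum _ fun i _ => (hi i).const_mul _]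
      simp_rw [integral_const_mul]
    simp_rw [sub_mul]
    rw [integral_sub (integrable_mul_inner hq hK hu h)
      (integrable_mul_inner hq hK (memLp_inner_of_bounded hq hK b₀ 2) h), h2]
    simp_rw [mul_comm (inner ℝ (q _) b₀)]
    rw [← h1]
    simp
  have hL : ∀ c, MemLp (fun s => u s - inner ℝ (q s) c) 2 m := fun c =>
    hu.sub (memLp_inner_of_bounded hq hK c 2)
  have hsq : ∀ c, ∫ s, (u s - inner ℝ (q s) c) ^ 2 ∂m
      = ∫ s, (u s - inner ℝ (q s) b₀) ^ 2 ∂m + ∫ s, (inner ℝ (q s) (b₀ - c)) ^ 2 ∂m := by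
    intro c
    have : ∀ s, (u s - inner ℝ (q s) c) ^ 2 = (u s - inner ℝ (q s) b₀) ^ 2
        + (inner ℝ (q s) (b₀ - c)) ^ 2
        + 2 * ((u s - inner ℝ (q s) b₀) * inner ℝ (q s) (b₀ - c)) := by
      intro s; rw [inner_sub_right]; ring
    have hi1 := (hL b₀).integrable_sq
    have hi2 := (memLp_inner_of_bounded hq hK (b₀ - c) 2).integrable_sq
    have hi3 : Integrable (fun s => (u s - inner ℝ (q s) b₀) ^ 2
        + (inner ℝ (q s) (b₀ - c)) ^ 2) m := hi1.add hi2
    simp_rw [this]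
    rw [integral_add hi3 ((integrable_mul_inner hq hK (hL b₀) _).const_mul _),
      integral_add hi1 hi2, integral_const_mul, hnormal, mul_zero, add_zero]
  -- The criterion is defined by an integral in `[0, ∞]`; square integrability makes it finite and
  -- reduces it to a real integral.
  have hlint : ∀ c, ∫⁻ s, ENNReal.ofReal ((u s - inner ℝ (q s) c) ^ 2) ∂m
      = ENNReal.ofReal (∫ s, (u s - inner ℝ (q s) c) ^ 2 ∂m) := fun c =>
    (ofReal_integral_eq_lintegral_ofReal (hL c).integrable_sq
      (ae_of_all _ fun s => sq_nonneg _)).symm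
  have hmin : IsLeastSquares m u q b₀ := by
    intro b'
    rw [hlint, hlint]
    refine ENNReal.ofReal_le_ofReal ?_
    rw [hsq b']
    exact le_add_of_nonneg_right (integral_nonneg fun s => sq_nonneg _)
  have hspec : IsLeastSquares m u q (leastSquares m u q) := Classical.epsilon_spec ⟨b₀, hmin⟩
  have hle := hspec b₀
  rw [hlint, hlint, ENNReal.ofReal_le_ofReal_iff (integral_nonneg fun s => sq_nonneg _),
    hsq (leastSquares m u q)] at hle
  have h2 := hQ (b₀ - leastSquares m u q)
  have h3 : ‖b₀ - leastSquares m u q‖ ^ 2 ≤ 0 := by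
    by_contra h
    have := mul_pos hlo (not_le.1 h)
    linarith
  have h4 : ‖b₀ - leastSquares m u q‖ ^ 2 = 0 := le_antisymm h3 (by positivity)
  have h5 : b₀ = leastSquares m u q := by
    rw [← sub_eq_zero]
    simpa using h4
  rw [← h5]
  exact hnormal h

end LeastSquares

/-- The quantitative content, for one sample size, of the conditions on a series model. -/
structure Regular {d : ℕ} (M : Model d) (lo hi Ξ V C R : ℝ) : Prop where
  lo_pos : 0 < lo
  hi_pos : 0 < hi
  V_nonneg : 0 ≤ V
  C_pos : 0 < C
  R_nonneg : 0 ≤ R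
  spec : ∀ t ∈ spectrum ℝ M.Q, lo ≤ t ∧ t ≤ hi
  norm_p_le : ∀ᵐ x ∂M.F, ‖M.p x‖ ≤ Ξ
  condVar_le : ∀ᵐ x ∂M.F, M.condVar x ≤ ENNReal.ofReal V
  le_condVar : ∀ᵐ x ∂M.F, ENNReal.ofReal C ≤ M.condVar x
  noise_mean : ∀ᵐ x ∂M.F, ∫ t, (t - M.g x) ∂M.cond x = 0
  abs_r_le : ∀ᵐ x ∂M.F, |M.r x| ≤ R

/-! ### Conditional moments of the errors and the population projection. -/

namespace Model

variable {d : ℕ} (M : Model d)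

/-- The regression error `ε = y - g(x)`. -/
noncomputable def noise (z : Euc d × ℝ) : ℝ := z.2 - M.g z.1

theorem measurable_noise : Measurable M.noise :=
  measurable_snd.sub (M.measurable_g.comp measurable_fst)

instance : IsProbabilityMeasure M.F := by unfold Model.F; infer_instance

theorem measurable_r : Measurable M.r := by
  have h1 := M.measurable_g
  have h2 := M.measurable_p
  unfold Model.r Model.rOf
  fun_prop

theorem F_eq_map : M.F = M.law.map Prod.fst := rfl

theorem integral_fst {f : Euc d → ℝ} (hf : Measurable f) :
    ∫ z, f z.1 ∂M.law = ∫ x, f x ∂M.F := by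
  rw [F_eq_map, integral_map measurable_fst.aemeasurable hf.aestronglyMeasurable]

theorem ae_fst {P : Euc d → Prop} (h : ∀ᵐ x ∂M.F, P x) : ∀ᵐ z ∂M.law, P z.1 := by
  rw [F_eq_map] at h
  exact ae_of_ae_map measurable_fst.aemeasurable h

theorem integrable_fst {f : Euc d → ℝ} (hf : Integrable f M.F) :
    Integrable (fun z => f z.1) M.law := by
  rw [F_eq_map] at hf
  exact hf.comp_measurable measurable_fst

/-- Disintegrating the joint law turns conditional moments into moments weighted by any function of
the covariate. All uses of the tail and variance conditions pass through this identity. -/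
theorem lintegral_mul_noise_sq_restrict {φ : Euc d → ℝ≥0∞} (hφ : Measurable φ) (t : ℝ) :
    ∫⁻ z, φ z.1 * {z | t < |M.noise z|}.indicator (fun z => ENNReal.ofReal (M.noise z ^ 2)) z ∂M.law
      = ∫⁻ x, φ x * M.condTail t x ∂M.F := by
  have hm := M.measurable_noise
  have hs : MeasurableSet {z | t < |M.noise z|} := measurableSet_lt (by fun_prop) (by fun_prop)
  have hmi : Measurable ({z | t < |M.noise z|}.indicator
      (fun z => ENNReal.ofReal (M.noise z ^ 2))) := Measurable.indicator (by fun_prop) hs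
  conv_lhs => rw [← M.law.disintegrate M.law.condKernel]
  rw [Measure.lintegral_compProd (by fun_prop)]
  refine lintegral_congr fun x => ?_
  change ∫⁻ b, φ x * {z | t < |M.noise z|}.indicator
    (fun z => ENNReal.ofReal (M.noise z ^ 2)) (x, b) ∂M.law.condKernel x = _
  rw [lintegral_const_mul _ (by fun_prop)]
  congr 1
  have hx : MeasurableSet {y : ℝ | t < |y - M.g x|} :=
    measurableSet_lt (by fun_prop) (by fun_prop)
  rw [Model.condTail, ← lintegral_indicator hx]
  rfl

theorem lintegral_mul_noise_sq {φ : Euc d → ℝ≥0∞} (hφ : Measurable φ) :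
    ∫⁻ z, φ z.1 * ENNReal.ofReal (M.noise z ^ 2) ∂M.law = ∫⁻ x, φ x * M.condVar x ∂M.F := by
  -- A negative threshold makes the truncation void.
  have h := M.lintegral_mul_noise_sq_restrict hφ (-1)
  have e1 : {z : Euc d × ℝ | (-1 : ℝ) < |M.noise z|} = Set.univ := by
    ext z; simpa using lt_of_lt_of_le (by norm_num) (abs_nonneg _)
  have e2 : ∀ x, M.condTail (-1) x = M.condVar x := by
    intro x
    have : {y : ℝ | (-1 : ℝ) < |y - M.g x|} = Set.univ := by
      ext z; simpa using lt_of_lt_of_le (by norm_num) (abs_nonneg _)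
    rw [Model.condTail, this, Measure.restrict_univ, Model.condVar]
  simpa [e1, e2] using h

end Model

namespace Regular

variable {d : ℕ} {M : Model d} {lo hi Ξ V C R : ℝ} (H : Regular M lo hi Ξ V C R)

include H

theorem integral_mul_noise_sq {φ : Euc d → ℝ} (hφ : Measurable φ) (hφ0 : ∀ x, 0 ≤ φ x)
    (hφi : Integrable φ M.F) :
    Integrable (fun z => φ z.1 * M.noise z ^ 2) M.law ∧
      ∫ z, φ z.1 * M.noise z ^ 2 ∂M.law ≤ V * ∫ x, φ x ∂M.F ∧
      C * ∫ x, φ x ∂M.F ≤ ∫ z, φ z.1 * M.noise z ^ 2 ∂M.law := by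
  have hm := M.measurable_noise
  have h := M.lintegral_mul_noise_sq (φ := fun x => ENNReal.ofReal (φ x)) (by fun_prop)
  simp_rw [← ENNReal.ofReal_mul (hφ0 _)] at h
  have hF : ∫⁻ x, ENNReal.ofReal (φ x) ∂M.F = ENNReal.ofReal (∫ x, φ x ∂M.F) :=
    (ofReal_integral_eq_lintegral_ofReal hφi (ae_of_all _ hφ0)).symm
  have hI0 : 0 ≤ ∫ x, φ x ∂M.F := integral_nonneg hφ0
  have hup : ∫⁻ x, ENNReal.ofReal (φ x) * M.condVar x ∂M.F
      ≤ ENNReal.ofReal (V * ∫ x, φ x ∂M.F) := by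
    rw [ENNReal.ofReal_mul H.V_nonneg, ← hF, ← lintegral_const_mul _ (by fun_prop)]
    refine lintegral_mono_ae (H.condVar_le.mono fun x hx => ?_)
    rw [mul_comm]; gcongr
  have hdown : ENNReal.ofReal (C * ∫ x, φ x ∂M.F)
      ≤ ∫⁻ x, ENNReal.ofReal (φ x) * M.condVar x ∂M.F := by
    rw [ENNReal.ofReal_mul H.C_pos.le, ← hF, ← lintegral_const_mul _ (by fun_prop)]
    refine lintegral_mono_ae (H.le_condVar.mono fun x hx => ?_)
    rw [mul_comm]; gcongr
  rw [← h] at hup hdown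
  have hnn : ∀ z : Euc d × ℝ, 0 ≤ φ z.1 * M.noise z ^ 2 :=
    fun z => mul_nonneg (hφ0 _) (sq_nonneg _)
  have hint : Integrable (fun z => φ z.1 * M.noise z ^ 2) M.law := by
    refine ⟨by fun_prop, ?_⟩
    rw [hasFiniteIntegral_iff_ofReal (ae_of_all _ hnn)]
    exact hup.trans_lt ENNReal.ofReal_lt_top
  have e := ofReal_integral_eq_lintegral_ofReal hint (ae_of_all _ hnn)
  rw [← e] at hup hdown
  refine ⟨hint, ?_, ?_⟩
  · exact (ENNReal.ofReal_le_ofReal_iff (mul_nonneg H.V_nonneg hI0)).1 hup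
  · exact (ENNReal.ofReal_le_ofReal_iff (integral_nonneg hnn)).1 hdown

theorem memLp_noise : MemLp M.noise 2 M.law := by
  have hm := M.measurable_noise
  rw [memLp_two_iff_integrable_sq (by fun_prop)]
  simpa using (H.integral_mul_noise_sq (φ := fun _ => 1) measurable_const (fun _ => zero_le_one)
    (integrable_const _)).1

theorem integrable_mul_noise {φ : Euc d → ℝ} (hφ : Measurable φ) {K : ℝ} (hK : ∀ x, |φ x| ≤ K) :
    Integrable (fun z => φ z.1 * M.noise z) M.law :=
  (H.memLp_noise.integrable (by norm_num)).bdd_mul (c := K) (hφ.comp measurable_fst).aestronglyMeasurable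
    (ae_of_all _ fun z => hK z.1)

theorem integral_mul_noise {φ : Euc d → ℝ} (hφ : Measurable φ) {K : ℝ} (hK : ∀ x, |φ x| ≤ K) :
    ∫ z, φ z.1 * M.noise z ∂M.law = 0 := by
  have hi := H.integrable_mul_noise hφ hK
  rw [← M.law.disintegrate M.law.condKernel] at hi ⊢
  rw [Measure.integral_compProd hi]
  refine integral_eq_zero_of_ae (H.noise_mean.mono fun x hx => ?_)
  simp only [Model.noise, Pi.zero_apply]
  rw [integral_const_mul]
  exact mul_eq_zero_of_right _ hx

/-- Weights that are only almost everywhere bounded. -/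
theorem integral_mul_noise_of_ae {φ : Euc d → ℝ} (hφ : Measurable φ) {K : ℝ}
    (hK : ∀ᵐ x ∂M.F, |φ x| ≤ K) :
    Integrable (fun z => φ z.1 * M.noise z) M.law ∧ ∫ z, φ z.1 * M.noise z ∂M.law = 0 := by
  have hs : MeasurableSet {x | |φ x| ≤ K} := measurableSet_le (by fun_prop) (by fun_prop)
  have hψ : Measurable ({x | |φ x| ≤ K}.indicator φ) := hφ.indicator hs
  have hb : ∀ x, |{x | |φ x| ≤ K}.indicator φ x| ≤ |K| := by
    intro x
    by_cases hx : |φ x| ≤ K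
    · rw [Set.indicator_of_mem (by exact hx)]; exact hx.trans (le_abs_self _)
    · rw [Set.indicator_of_notMem (by exact hx)]; simp
  have he : (fun z : Euc d × ℝ => {x | |φ x| ≤ K}.indicator φ z.1 * M.noise z)
      =ᵐ[M.law] fun z => φ z.1 * M.noise z := by
    filter_upwards [M.ae_fst hK] with z hz
    rw [Set.indicator_of_mem (by exact hz)]
  exact ⟨(H.integrable_mul_noise hψ hb).congr he,
    (integral_congr_ae he).symm.trans (H.integral_mul_noise hψ hb)⟩

theorem quadForm_Q (b : Euc M.k) :
    lo * ‖b‖ ^ 2 ≤ ∫ x, (inner ℝ (M.p x) b) ^ 2 ∂M.F ∧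
      ∫ x, (inner ℝ (M.p x) b) ^ 2 ∂M.F ≤ hi * ‖b‖ ^ 2 := by
  have hQ : M.Q.IsHermitian := by
    rw [Matrix.IsHermitian, Matrix.conjTranspose_eq_transpose_of_trivial]
    exact isSymm_gram M.F M.p
  have e : ∫ x, (inner ℝ (M.p x) b) ^ 2 ∂M.F = b.ofLp ⬝ᵥ (M.Q *ᵥ b.ofLp) := by
    have := inner_gram M.measurable_p H.norm_p_le b b
    simp_rw [sq]
    rw [← this, Euc.inner_eq_dotProduct]
    rfl
  obtain ⟨U, hU, hU', hd⟩ := exists_orthogonal_diagonalization hQ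
  have hl : ∀ i, lo ≤ hQ.eigenvalues i ∧ hQ.eigenvalues i ≤ hi := fun i =>
    H.spec _ (hQ.eigenvalues_mem_spectrum_real i)
  have h1 := (congrArg (fun A => b.ofLp ⬝ᵥ (A *ᵥ b.ofLp)) hd).trans
    (dotProduct_conj_diagonal_mulVec U _ b.ofLp)
  have h2 : ‖b‖ ^ 2 = ∑ i, (Uᵀ *ᵥ b.ofLp) i ^ 2 := by
    have : b.ofLp ⬝ᵥ b.ofLp = b.ofLp ⬝ᵥ ((U * Matrix.diagonal 1 * Uᵀ) *ᵥ b.ofLp) := by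
      rw [show Matrix.diagonal (1 : Fin M.k → ℝ) = 1 from Matrix.diagonal_one, Matrix.mul_one, hU',
        Matrix.one_mulVec]
    rw [Euc.norm_sq_eq_dotProduct, this, dotProduct_conj_diagonal_mulVec]; simp
  rw [e, h1, h2, Finset.mul_sum, Finset.mul_sum]
  constructor <;>
  · gcongr with i
    first | exact (hl i).1 | exact (hl i).2

theorem memLp_g : MemLp M.g 2 M.F := by
  have h1 : MemLp M.r 2 M.F := MemLp.of_bound M.measurable_r.aestronglyMeasurable R H.abs_r_le
  have h2 := h1.add (memLp_inner_of_bounded M.measurable_p H.norm_p_le (M.betaOf M.g) 2)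
  refine h2.ae_eq (ae_of_all _ fun x => ?_)
  simp [Model.r, Model.rOf]

theorem integral_r_mul_inner (h : Euc M.k) : ∫ x, M.r x * inner ℝ (M.p x) h ∂M.F = 0 :=
  leastSquares_normal_equations M.measurable_p H.norm_p_le H.lo_pos (fun b => (H.quadForm_Q b).1)
    H.memLp_g h

/-- The errors are orthogonal to every bounded function of the covariate, in particular to `p`, so
the outcome and `g` satisfy the same normal equations. -/
theorem beta_eq : M.beta = M.betaOf M.g := by
  have hp : Measurable fun z : Euc d × ℝ => M.p z.1 := M.measurable_p.comp measurable_fst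
  have hK := M.ae_fst H.norm_p_le
  have hQ : ∀ b, lo * ‖b‖ ^ 2 ≤ ∫ z, (inner ℝ (M.p z.1) b) ^ 2 ∂M.law := by
    intro b
    have hpm := M.measurable_p
    rw [M.integral_fst (f := fun x => (inner ℝ (M.p x) b) ^ 2) (by fun_prop)]
    exact (H.quadForm_Q b).1
  have hg : MemLp (fun z : Euc d × ℝ => M.g z.1) 2 M.law := by
    have := H.memLp_g
    rw [M.F_eq_map] at this
    exact this.comp_of_map measurable_fst.aemeasurable
  have hy : MemLp (fun z : Euc d × ℝ => z.2) 2 M.law := by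
    refine (H.memLp_noise.add hg).ae_eq (ae_of_all _ fun z => ?_)
    simp [Model.noise]
  refine eq_of_normal_equations hp hK H.lo_pos hQ hy
    (fun h => leastSquares_normal_equations hp hK H.lo_pos hQ hy h) fun h => ?_
  have hpm := M.measurable_p
  have hgm := M.measurable_g
  have e : ∀ z : Euc d × ℝ, (z.2 - inner ℝ (M.p z.1) (M.betaOf M.g)) * inner ℝ (M.p z.1) h
      = inner ℝ (M.p z.1) h * M.noise z + M.r z.1 * inner ℝ (M.p z.1) h := by
    intro z; simp only [Model.noise, Model.r, Model.rOf]; ring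
  obtain ⟨hi1, hi2⟩ := H.integral_mul_noise_of_ae (φ := fun x => inner ℝ (M.p x) h) (by fun_prop)
    (H.norm_p_le.mono fun _ hs => abs_inner_le_of_norm_le hs h)
  have hri : Integrable (fun x => M.r x * inner ℝ (M.p x) h) M.F :=
    integrable_mul_inner M.measurable_p H.norm_p_le
      (MemLp.of_bound M.measurable_r.aestronglyMeasurable R H.abs_r_le) h
  simp_rw [e]
  have hrm := M.measurable_r
  rw [integral_add hi1 (M.integrable_fst hri), hi2,
    M.integral_fst (f := fun x => M.r x * inner ℝ (M.p x) h) (by fun_prop),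
    H.integral_r_mul_inner, add_zero]

end Regular

/-! ### Fubini in one coordinate and second moments of independent sums. -/

section ProductMeasure

variable {Z : Type*} [MeasurableSpace Z] {ν : Measure Z} [IsProbabilityMeasure ν]

/-- Isolates observation `i`, so that the conditional moments of its error can be applied with all
other observations frozen. -/
theorem integral_pi_insertNth {n : ℕ} (i : Fin (n + 1)) {f : (Fin (n + 1) → Z) → ℝ}
    (hf : Integrable f (Measure.pi fun _ => ν)) :
    ∫ z, f z ∂(Measure.pi fun _ => ν)
        = ∫ w, ∫ z, f (i.insertNth z w) ∂ν ∂(Measure.pi fun _ : Fin n => ν) ∧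
      Integrable (fun w => ∫ z, f (i.insertNth z w) ∂ν) (Measure.pi fun _ : Fin n => ν) ∧
      ∀ᵐ w ∂(Measure.pi fun _ : Fin n => ν), Integrable (fun z => f (i.insertNth z w)) ν := by
  have hmp := (measurePreserving_piFinSuccAbove (fun _ : Fin (n + 1) => ν) i).symm
  have hint := (hmp.integrable_comp_emb
    (MeasurableEquiv.measurableEmbedding _) (g := f)).2 hf
  have e := hmp.integral_comp' f
  have hint' := hint.swap
  refine ⟨?_, hint'.integral_prod_left, hint'.prod_right_ae⟩
  rw [← e]
  exact integral_prod_symm _ hint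

theorem integral_norm_sq_sum_sub_le {k n : ℕ} {w : Z → Euc k} (hw : Measurable w) {K : ℝ}
    (hK : ∀ᵐ z ∂ν, ‖w z‖ ≤ K) {v : Euc k} (hv : ∀ a, v a = ∫ z, w z a ∂ν) :
    Integrable (fun z : Fin n → Z => ‖∑ i, (w (z i) - v)‖ ^ 2) (Measure.pi fun _ => ν) ∧
    ∫ z : Fin n → Z, ‖∑ i, (w (z i) - v)‖ ^ 2 ∂(Measure.pi fun _ => ν)
      ≤ n * ∫ z, ‖w z‖ ^ 2 ∂ν := by
  have hL : ∀ a, MemLp (fun z => w z a) 2 ν := fun a => memLp_coord_of_bounded hw hK a 2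
  have hLi : ∀ (a : Fin k) (i : Fin n),
      MemLp (fun z : Fin n → Z => w (z i) a) 2 (Measure.pi fun _ => ν) := fun a i =>
    (hL a).comp_measurePreserving (measurePreserving_eval (fun _ : Fin n => ν) i)
  have hS : ∀ a, MemLp (fun z : Fin n → Z => ∑ i, (w (z i) a - v a)) 2
      (Measure.pi fun _ => ν) := fun a =>
    memLp_finsetSum _ fun i _ => (hLi a i).sub (memLp_const _)
  have e : ∀ z : Fin n → Z, ‖∑ i, (w (z i) - v)‖ ^ 2 = ∑ a, (∑ i, (w (z i) a - v a)) ^ 2 := by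
    intro z
    rw [Euc.norm_sq_eq_sum]
    simp
  have hint : ∀ a, Integrable (fun z : Fin n → Z => (∑ i, (w (z i) a - v a)) ^ 2)
      (Measure.pi fun _ => ν) := fun a => (hS a).integrable_sq
  simp_rw [e]
  refine ⟨integrable_finsetSum _ fun a _ => hint a, ?_⟩
  rw [integral_finsetSum _ fun a _ => hint a]
  have e2 : ∀ z, ‖w z‖ ^ 2 = ∑ a, (w z a) ^ 2 := fun z => Euc.norm_sq_eq_sum _
  simp_rw [e2]
  rw [integral_finsetSum _ fun a _ => (hL a).integrable_sq, Finset.mul_sum]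
  refine Finset.sum_le_sum fun a _ => ?_
  have hvar := variance_sum_pi (ι := Fin n) (μ := fun _ => ν) (X := fun _ z => w z a)
    fun _ => hL a
  rw [variance_eq_integral] at hvar
  · have hmean : ∫ z : Fin n → Z, (∑ i, fun z : Fin n → Z => w (z i) a) z ∂(Measure.pi fun _ => ν)
        = ∑ _i : Fin n, v a := by
      simp only [Finset.sum_apply]
      rw [integral_finsetSum _ fun i _ => (hLi a i).integrable (by norm_num)]
      refine Finset.sum_congr rfl fun i _ => ?_
      rw [hv a, integral_comp_eval (μ := fun _ : Fin n => ν) (f := fun z => w z a)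
        (hL a).aestronglyMeasurable]
    rw [hmean] at hvar
    simp only [Finset.sum_apply, ← Finset.sum_sub_distrib] at hvar
    rw [hvar]
    simp only [Finset.sum_const, Finset.card_univ, Fintype.card_fin, nsmul_eq_mul]
    gcongr
    exact variance_le_expectation_sq (hL a).aestronglyMeasurable
  · exact (memLp_finsetSum' _ fun i _ => hLi a i).aestronglyMeasurable.aemeasurable

end ProductMeasure

/-! ### Errors weighted by functions of all the covariates. -/

section Weights

variable {d : ℕ} {M : Model d} {lo hi Ξ V C R : ℝ}

theorem fst_comp_insertNth {n : ℕ} (i : Fin (n + 1)) (z : Euc d × ℝ) (w : Fin n → Euc d × ℝ) :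
    (fun l => (i.insertNth (α := fun _ => Euc d × ℝ) z w l).1)
      = i.insertNth (α := fun _ => Euc d) z.1 fun l => (w l).1 := by
  funext l
  refine Fin.succAboveCases i ?_ (fun j => ?_) l <;> simp

theorem measurable_insertNth_left {n : ℕ} (i : Fin (n + 1)) (w : Fin n → Euc d) :
    Measurable fun x : Euc d => i.insertNth (α := fun _ => Euc d) x w := by
  refine measurable_pi_iff.2 fun l => ?_
  refine Fin.succAboveCases i ?_ (fun j => ?_) l
  · simp only [Fin.insertNth_apply_same]
    exact measurable_id
  · simp

/-- Sums of errors with weights depending on all covariates: conditionally on the covariates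
the summands are orthogonal. -/
theorem Regular.integral_sum_mul_noise_sq_le (H : Regular M lo hi Ξ V C R) {n : ℕ}
    {h : (Fin n → Euc d) → Fin n → ℝ} (hm : ∀ i, Measurable fun x => h x i) {K : ℝ}
    (hK : ∀ x i, |h x i| ≤ K) :
    Integrable (fun z : Fin n → Euc d × ℝ => (∑ i, h (fun l => (z l).1) i * M.noise (z i)) ^ 2)
        (Measure.pi fun _ => M.law) ∧
    ∫ z : Fin n → Euc d × ℝ, (∑ i, h (fun l => (z l).1) i * M.noise (z i)) ^ 2
        ∂(Measure.pi fun _ => M.law)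
      ≤ V * ∫ z : Fin n → Euc d × ℝ, ∑ i, h (fun l => (z l).1) i ^ 2
        ∂(Measure.pi fun _ => M.law) := by
  have hnm := M.measurable_noise
  have hX : Measurable fun z : Fin n → Euc d × ℝ => fun l => (z l).1 := by fun_prop
  have hhm : ∀ i, Measurable fun z : Fin n → Euc d × ℝ => h (fun l => (z l).1) i :=
    fun i => (hm i).comp hX
  have hL : ∀ i : Fin n, MemLp (fun z : Fin n → Euc d × ℝ => M.noise (z i)) 2
      (Measure.pi fun _ => M.law) := fun i =>
    H.memLp_noise.comp_measurePreserving (measurePreserving_eval (fun _ : Fin n => M.law) i)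
  have hT : ∀ i j : Fin n, Integrable (fun z : Fin n → Euc d × ℝ =>
      (h (fun l => (z l).1) i * h (fun l => (z l).1) j) * (M.noise (z i) * M.noise (z j)))
      (Measure.pi fun _ => M.law) := by
    intro i j
    refine ((hL i).integrable_mul (hL j)).bdd_mul (c := K * K)
      ((hhm i).mul (hhm j)).aestronglyMeasurable (ae_of_all _ fun z => ?_)
    rw [Real.norm_eq_abs, abs_mul]
    have := hK (fun l => (z l).1) i
    have := hK (fun l => (z l).1) j
    gcongr
    exact (abs_nonneg _).trans this
  -- With the other observations frozen, the integrand is a bounded function of covariate `i` times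
  -- error `i`, which integrates to zero.
  have hcross : ∀ i j : Fin n, i ≠ j → ∫ z : Fin n → Euc d × ℝ,
      (h (fun l => (z l).1) i * h (fun l => (z l).1) j) * (M.noise (z i) * M.noise (z j))
      ∂(Measure.pi fun _ => M.law) = 0 := by
    intro i j hij
    cases n with
    | zero => exact i.elim0
    | succ n =>
      obtain ⟨j', rfl⟩ := Fin.exists_succAbove_eq hij.symm
      rw [(integral_pi_insertNth i (hT i (i.succAbove j'))).1]
      refine integral_eq_zero_of_ae (ae_of_all _ fun w => ?_)
      simp only [fst_comp_insertNth, Fin.insertNth_apply_same, Fin.insertNth_apply_succAbove,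
        Pi.zero_apply, ← mul_assoc]
      rw [integral_mul_const]
      refine mul_eq_zero_of_left ?_ _
      refine H.integral_mul_noise (φ := fun x => h (i.insertNth x fun l => (w l).1) i *
        h (i.insertNth x fun l => (w l).1) (i.succAbove j')) ?_ (K := K * K) fun x => ?_
      · exact ((hm _).comp (measurable_insertNth_left i _)).mul
          ((hm _).comp (measurable_insertNth_left i _))
      · have h1 := hK (i.insertNth x fun l => (w l).1) i
        have h2 := hK (i.insertNth x fun l => (w l).1) (i.succAbove j')
        rw [abs_mul]
        gcongr
        exact (abs_nonneg _).trans h1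
  have hsq : ∀ i : Fin n, Integrable (fun z : Fin n → Euc d × ℝ => h (fun l => (z l).1) i ^ 2)
      (Measure.pi fun _ => M.law) := by
    intro i
    refine Integrable.of_bound ((hhm i).pow_const 2).aestronglyMeasurable (K ^ 2)
      (ae_of_all _ fun z => ?_)
    rw [Real.norm_eq_abs, abs_pow]
    have := hK (fun l => (z l).1) i
    gcongr
  have hdiag : ∀ i : Fin n, ∫ z : Fin n → Euc d × ℝ,
      (h (fun l => (z l).1) i * h (fun l => (z l).1) i) * (M.noise (z i) * M.noise (z i))
      ∂(Measure.pi fun _ => M.law)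
      ≤ V * ∫ z : Fin n → Euc d × ℝ, h (fun l => (z l).1) i ^ 2 ∂(Measure.pi fun _ => M.law) := by
    intro i
    cases n with
    | zero => exact i.elim0
    | succ n =>
      obtain ⟨e1, i1, -⟩ := integral_pi_insertNth i (hT i i)
      obtain ⟨e2, i2, -⟩ := integral_pi_insertNth i (hsq i)
      rw [e1, e2, ← integral_const_mul]
      refine integral_mono i1 (i2.const_mul _) fun w => ?_
      simp only [fst_comp_insertNth, Fin.insertNth_apply_same, ← sq]
      have hφ : Measurable fun x => h (i.insertNth x fun l => (w l).1) i ^ 2 :=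
        ((hm _).comp (measurable_insertNth_left i _)).pow_const 2
      have hφi : Integrable (fun x => h (i.insertNth x fun l => (w l).1) i ^ 2) M.F := by
        refine Integrable.of_bound hφ.aestronglyMeasurable (K ^ 2) (ae_of_all _ fun x => ?_)
        rw [Real.norm_eq_abs, abs_pow]
        have := hK (i.insertNth x fun l => (w l).1) i
        gcongr
      have := (H.integral_mul_noise_sq hφ (fun x => sq_nonneg _) hφi).2.1
      rwa [← M.integral_fst hφ] at this
  have hexp : ∀ z : Fin n → Euc d × ℝ, (∑ i, h (fun l => (z l).1) i * M.noise (z i)) ^ 2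
      = ∑ i, ∑ j, (h (fun l => (z l).1) i * h (fun l => (z l).1) j)
        * (M.noise (z i) * M.noise (z j)) := by
    intro z
    rw [sq, Finset.sum_mul_sum]
    exact Finset.sum_congr rfl fun i _ => Finset.sum_congr rfl fun j _ => by ring
  simp_rw [hexp]
  refine ⟨integrable_finsetSum _ fun i _ => integrable_finsetSum _ fun j _ => hT i j, ?_⟩
  rw [integral_finsetSum _ fun i _ => integrable_finsetSum _ fun j _ => hT i j,
    integral_finsetSum _ fun i _ => hsq i, Finset.mul_sum]
  refine Finset.sum_le_sum fun i _ => ?_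
  rw [integral_finsetSum _ fun j _ => hT i j, Finset.sum_eq_single i]
  · exact hdiag i
  · exact fun j _ hj => hcross i j hj.symm
  · simp

end Weights

/-! ### The empirical normal equations and the empirical linear system. -/

section Sample

variable {d n : ℕ} {M : Model d} {lo hi Ξ V C R : ℝ}

theorem IsEstimate.normal_equations {k : ℕ} {p : Euc d → Euc k} {x : Fin n → Euc d}
    {y : Fin n → ℝ} {b : Euc k} (hb : IsEstimate p x y b) (h : Euc k) :
    ∑ i, (y i - inner ℝ (p (x i)) b) * inner ℝ (p (x i)) h = 0 := by
  rcases Nat.eq_zero_or_pos n with rfl | hn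
  · simp
  have hn' : (0 : ℝ) < (n : ℝ)⁻¹ := by positivity
  set A := ∑ i, (y i - inner ℝ (p (x i)) b) * inner ℝ (p (x i)) h
  set B := ∑ i, (inner ℝ (p (x i)) h) ^ 2 with hB
  have hB0 : 0 ≤ B := Finset.sum_nonneg fun _ _ => sq_nonneg _
  -- Perturbing the minimiser by `t • h` gives a quadratic inequality for all `t`, which forces `A =
  -- 0`. It is tested below at `A / (B + 1)`, where the 1 avoids dividing by `B = 0`.
  have key : ∀ t : ℝ, 2 * t * A ≤ t ^ 2 * B := by
    intro t
    have h1 := le_of_mul_le_mul_left (hb (b + t • h)) hn'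
    have h2 : ∑ i, (y i - inner ℝ (p (x i)) (b + t • h)) ^ 2
        = ∑ i, (y i - inner ℝ (p (x i)) b) ^ 2 - 2 * t * A + t ^ 2 * B := by
      rw [Finset.mul_sum, hB, Finset.mul_sum, ← Finset.sum_sub_distrib, ← Finset.sum_add_distrib]
      refine Finset.sum_congr rfl fun i _ => ?_
      rw [inner_add_right, inner_smul_right]; ring
    linarith
  by_contra hA
  have h1 := key (A / (B + 1))
  have h2 : A / (B + 1) * (B + 1) = A := by field_simp
  have h3 : 0 < A ^ 2 := by positivity
  have h4 : 2 * (A / (B + 1)) * A * (B + 1) ^ 2 ≤ (A / (B + 1)) ^ 2 * B * (B + 1) ^ 2 := by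
    gcongr
  have h5 : 2 * (A / (B + 1)) * A * (B + 1) ^ 2 = 2 * A ^ 2 * (B + 1) := by field_simp
  have h6 : (A / (B + 1)) ^ 2 * B * (B + 1) ^ 2 = A ^ 2 * B := by field_simp
  rw [h5, h6] at h4
  nlinarith

/-- Measurable solution of the empirical linear system `Q̂ b = v`. -/
theorem exists_measurable_solution {k : ℕ} {p : Euc d → Euc k} (hp : Measurable p)
    {v : (Fin n → Euc d) → Euc k} (hv : Measurable v) {G : Set (Fin n → Euc d)}
    (hG : MeasurableSet G) {τ : ℝ} (hτ : 0 < τ)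
    (hlow : ∀ x ∈ G, ∀ b : Euc k, τ * ‖b‖ ^ 2 ≤ (n : ℝ)⁻¹ * ∑ i, (inner ℝ (p (x i)) b) ^ 2) :
    ∃ b : (Fin n → Euc d) → Euc k, Measurable b ∧
      (∀ x ∈ G, ∀ h, (n : ℝ)⁻¹ * ∑ i, inner ℝ (p (x i)) (b x) * inner ℝ (p (x i)) h
        = inner ℝ (v x) h) ∧
      (∀ x, ‖b x‖ ≤ ‖v x‖ / τ) ∧
      ∀ x, (n : ℝ)⁻¹ * ∑ i, (inner ℝ (p (x i)) (b x)) ^ 2 ≤ ‖v x‖ ^ 2 / τ := by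
  classical
  set S : (Fin n → Euc d) → Matrix (Fin k) (Fin k) ℝ := fun x =>
    (n : ℝ)⁻¹ • ∑ i, Matrix.vecMulVec (p (x i)).ofLp (p (x i)).ofLp with hS
  have hSm : ∀ i j, Measurable fun x => S x i j := by
    intro i j
    simp only [hS, Matrix.smul_apply, Matrix.sum_apply, Matrix.vecMulVec_apply]
    fun_prop
  have hSv : ∀ x (b h : Euc k), h.ofLp ⬝ᵥ (S x *ᵥ b.ofLp)
      = (n : ℝ)⁻¹ * ∑ i, inner ℝ (p (x i)) b * inner ℝ (p (x i)) h := by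
    intro x b h
    simp only [hS, Matrix.smul_mulVec, dotProduct_smul, smul_eq_mul, Matrix.sum_mulVec,
      dotProduct_sum]
    congr 1
    refine Finset.sum_congr rfl fun i _ => ?_
    rw [Matrix.vecMulVec_mulVec, Euc.inner_eq_dotProduct, Euc.inner_eq_dotProduct]
    simp [dotProduct_comm]
  have hSym : ∀ x, (S x).IsSymm := by
    intro x
    simp [hS, Matrix.IsSymm, Matrix.transpose_smul, Matrix.transpose_sum,
      Matrix.transpose_vecMulVec]
  have hpd : ∀ x ∈ G, (S x).PosDef := by
    intro x hx
    refine posDef_of_isSymm (hSym x) hτ fun b => ?_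
    have h1 := hlow x hx (WithLp.toLp 2 b)
    rw [Euc.norm_sq_eq_dotProduct] at h1
    have h2 := hSv x (WithLp.toLp 2 b) (WithLp.toLp 2 b)
    simp only [← sq] at h2
    rw [← h2] at h1
    exact h1
  -- Setting `b` to zero off `G` keeps it measurable and makes the norm bounds hold everywhere.
  set b : (Fin n → Euc d) → Euc k :=
    G.indicator fun x => WithLp.toLp 2 ((S x)⁻¹ *ᵥ (v x).ofLp) with hb
  have hbm : Measurable b := by
    refine Measurable.indicator ?_ hG
    refine (WithLp.measurable_toLp 2 _).comp (measurable_pi_iff.2 fun i => ?_)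
    simp only [Matrix.mulVec, dotProduct]
    refine Finset.measurable_fun_sum _ fun j _ => (measurable_inv_entry hSm i j).mul ?_
    fun_prop
  have hsol : ∀ x ∈ G, ∀ h, (n : ℝ)⁻¹ * ∑ i, inner ℝ (p (x i)) (b x) * inner ℝ (p (x i)) h
        = inner ℝ (v x) h := by
    intro x hx h
    have hu : IsUnit (S x).det := (Matrix.isUnit_iff_isUnit_det _).1 (hpd x hx).isUnit
    rw [← hSv, hb, Set.indicator_of_mem hx]
    simp only
    rw [Matrix.mulVec_mulVec, Matrix.mul_nonsing_inv _ hu, Matrix.one_mulVec,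
      Euc.inner_eq_dotProduct, dotProduct_comm]
  have hnorm : ∀ x, ‖b x‖ ≤ ‖v x‖ / τ := by
    intro x
    by_cases hx : x ∈ G
    · have h1 := hlow x hx (b x)
      have h2 := hsol x hx (b x)
      simp only [← sq] at h2
      rw [h2] at h1
      have h3 := real_inner_le_norm (v x) (b x)
      rw [le_div_iff₀ hτ]
      by_contra hcon
      push Not at hcon
      have h4 : 0 < ‖b x‖ := by
        by_contra h0
        have : ‖b x‖ = 0 := le_antisymm (not_lt.1 h0) (norm_nonneg _)
        rw [this, zero_mul] at hcon
        exact absurd hcon (not_lt.2 (norm_nonneg _))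
      nlinarith
    · rw [hb, Set.indicator_of_notMem hx, norm_zero]; positivity
  refine ⟨b, hbm, hsol, hnorm, fun x => ?_⟩
  by_cases hx : x ∈ G
  · have h2 := hsol x hx (b x)
    simp only [← sq] at h2
    rw [h2]
    calc _ ≤ ‖v x‖ * ‖b x‖ := real_inner_le_norm _ _
      _ ≤ ‖v x‖ * (‖v x‖ / τ) := by gcongr; exact hnorm x
      _ = _ := by ring
  · have : b x = 0 := by rw [hb, Set.indicator_of_notMem hx]
    rw [this]
    simp only [inner_zero_right]
    norm_num
    positivity

end Sample

/-! ### The linearisation error of the estimator. -/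

section Remainder

variable {d n : ℕ} {M : Model d} {lo hi Ξ V C R : ℝ}

theorem ConditionA1.map_eq_pi {Ω : Type*} [MeasurableSpace Ω] {μ : Measure Ω}
    [IsProbabilityMeasure μ] {x : Fin n → Ω → Euc d} {y : Fin n → Ω → ℝ}
    (hA : ConditionA1 M μ x y) :
    μ.map (fun ω i => (x i ω, y i ω)) = Measure.pi fun _ : Fin n => M.law := by
  have hm : ∀ i, AEMeasurable (fun ω => (x i ω, y i ω)) μ := fun i =>
    ((hA.measurable_x i).prodMk (hA.measurable_y i)).aemeasurable
  rw [(iIndepFun_iff_map_fun_eq_pi_map hm).1 hA.indep]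
  congr 1
  funext i
  exact hA.map_eq i

theorem map_fst_pi (n : ℕ) :
    (Measure.pi fun _ : Fin n => M.law).map (fun z i => (z i).1)
      = Measure.pi fun _ : Fin n => M.F :=
  (measurePreserving_pi (fun _ : Fin n => M.law) (fun _ => M.F)
    fun _ => ⟨measurable_fst, rfl⟩).map_eq

/-- The linear part of the scaled estimation error. -/
noncomputable def linPart {n : ℕ} (M : Model d) (a : Euc M.k) (ρ : Euc d → ℝ)
    (z : Fin n → Euc d × ℝ) : ℝ :=
  (Real.sqrt n)⁻¹ * ∑ i, inner ℝ (M.p (z i).1) a * (M.noise (z i) + ρ (z i).1)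

namespace Regular

variable (H : Regular M lo hi Ξ V C R)

include H

theorem integral_norm_p_sq_le : ∫ x, ‖M.p x‖ ^ 2 ∂M.F ≤ M.k * hi := by
  have hL := fun a => memLp_coord_of_bounded M.measurable_p H.norm_p_le a 2
  simp_rw [Euc.norm_sq_eq_sum]
  rw [integral_finsetSum _ fun a _ => (hL a).integrable_sq]
  calc _ ≤ ∑ _a : Fin M.k, hi := by
        refine Finset.sum_le_sum fun a _ => ?_
        have := (H.quadForm_Q (EuclideanSpace.single a (1 : ℝ))).2
        simpa [EuclideanSpace.inner_single_right] using this
    _ = _ := by simp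

/-- The trace of `Q` is `E‖p‖²`. Thus the rate condition on `Ξ` also controls `k`, which gives `k ≤
n` eventually. -/
theorem card_mul_lo_le : M.k * lo ≤ Ξ ^ 2 := by
  have hL := fun a => memLp_coord_of_bounded M.measurable_p H.norm_p_le a 2
  have h1 : M.k * lo ≤ ∫ x, ‖M.p x‖ ^ 2 ∂M.F := by
    simp_rw [Euc.norm_sq_eq_sum]
    rw [integral_finsetSum _ fun a _ => (hL a).integrable_sq]
    calc M.k * lo = ∑ _a : Fin M.k, lo := by simp
      _ ≤ _ := by
        refine Finset.sum_le_sum fun a _ => ?_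
        have := (H.quadForm_Q (EuclideanSpace.single a (1 : ℝ))).1
        simpa [EuclideanSpace.inner_single_right] using this
  refine h1.trans ?_
  calc _ ≤ ∫ _x, Ξ ^ 2 ∂M.F := by
        refine integral_mono_of_nonneg (ae_of_all _ fun x => sq_nonneg _) (integrable_const _) ?_
        filter_upwards [H.norm_p_le] with x hx
        gcongr
    _ = _ := by simp

/-- With high probability the empirical Gram matrix is bounded below, and the regressors obey
their almost sure bound. -/
theorem exists_good_event (hk : 0 < M.k) {m : ℕ} (hm : 0 < m)
    (hmn : 48 * m * Ξ ^ 2 ≤ lo * n) :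
    ∃ G : Set (Fin n → Euc d), MeasurableSet G ∧
      (Measure.pi fun _ : Fin n => M.F) Gᶜ ≤ ENNReal.ofReal (2 * M.k / 2 ^ m) ∧
      (∀ x ∈ G, ∀ i, ‖M.p (x i)‖ ≤ Ξ) ∧
      ∀ x ∈ G, ∀ b : Euc M.k,
        lo / 24 * ‖b‖ ^ 2 ≤ (n : ℝ)⁻¹ * ∑ i, (inner ℝ (M.p (x i)) b) ^ 2 := by
  have hpm := M.measurable_p
  have hloB : lo ≤ Ξ ^ 2 := by
    have h1 : (1 : ℝ) ≤ M.k := by exact_mod_cast hk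
    have := H.card_mul_lo_le
    nlinarith [H.lo_pos]
  obtain ⟨G, hG, hGp, hGl⟩ := exists_measurableSet_le_sum_sq (F := M.F)
    (p := fun x => (M.p x).ofLp) (n := n) (m := m) (by fun_prop) (B := Ξ ^ 2) (lo := lo)
    (by
      filter_upwards [H.norm_p_le] with x hx
      rw [← Euc.norm_sq_eq_dotProduct]
      gcongr) H.lo_pos hloB
    (fun b => by
      have h1 := (H.quadForm_Q (WithLp.toLp 2 b)).1
      rw [Euc.norm_sq_eq_dotProduct] at h1
      refine h1.trans (le_of_eq (integral_congr_ae (ae_of_all _ fun x => ?_)))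
      simp only [Euc.inner_eq_dotProduct, dotProduct_comm]) hm hmn
  have hn : 0 < (n : ℝ) := by
    have h1 : (1 : ℝ) ≤ m := by exact_mod_cast hm
    by_contra h
    have h2 : lo * (n : ℝ) ≤ 0 := mul_nonpos_of_nonneg_of_nonpos H.lo_pos.le (not_lt.1 h)
    nlinarith [H.lo_pos]
  have hB : MeasurableSet {x : Fin n → Euc d | ∀ i, ‖M.p (x i)‖ ≤ Ξ} := by
    rw [Set.ofPred_forall]
    exact MeasurableSet.iInter fun i => measurableSet_le (by fun_prop) measurable_const
  have hB0 : (Measure.pi fun _ : Fin n => M.F) {x : Fin n → Euc d | ∀ i, ‖M.p (x i)‖ ≤ Ξ}ᶜ = 0 := by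
    have : ∀ᵐ x ∂(Measure.pi fun _ : Fin n => M.F), ∀ i, ‖M.p (x i)‖ ≤ Ξ := by
      rw [ae_all_iff]
      intro i
      exact (measurePreserving_eval (fun _ : Fin n => M.F) i).quasiMeasurePreserving.ae H.norm_p_le
    exact this
  refine ⟨G ∩ {x | ∀ i, ‖M.p (x i)‖ ≤ Ξ}, hG.inter hB, ?_, fun x hx => hx.2, fun x hx b => ?_⟩
  · rw [Set.compl_inter]
    refine (measure_union_le _ _).trans ?_
    rw [hB0, add_zero]
    simpa using hGp
  · have h1 := hGl x hx.1 b.ofLp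
    rw [← Euc.norm_sq_eq_dotProduct] at h1
    have h2 : ∀ i, b.ofLp ⬝ᵥ (M.p (x i)).ofLp = inner ℝ (M.p (x i)) b := fun i => by
      rw [Euc.inner_eq_dotProduct, dotProduct_comm]
    simp only [h2] at h1
    rw [inv_mul_eq_div, le_div_iff₀ hn]
    linarith

/-- The three terms bound the failure of the empirical eigenvalue bound, the part of the remainder
carried by the errors (Chebyshev), and the part carried by the approximation error (Markov). The
free parameter `l` comes from a weighted arithmetic-geometric mean inequality and is optimised
later. -/
theorem measure_remainder_gt_le {Ω : Type*} [MeasurableSpace Ω] {μ : Measure Ω}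
    [IsProbabilityMeasure μ] {x : Fin n → Ω → Euc d} {y : Fin n → Ω → ℝ}
    (hA : ConditionA1 M μ x y) {bHat : Ω → Euc M.k}
    (hb : ∀ᵐ ω ∂μ, IsEstimate M.p (fun i => x i ω) (fun i => y i ω) (bHat ω))
    (hk : 0 < M.k) {m : ℕ} (hm : 0 < m) (hmn : 48 * m * Ξ ^ 2 ≤ lo * n)
    {α a : Euc M.k} (ha : Matrix.toEuclideanLin M.Q a = α) {δ l : ℝ} (hδ : 0 < δ) (hl : 0 < l) :
    μ {ω | δ < |Real.sqrt n * inner ℝ α (bHat ω - M.beta)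
        - linPart M a M.r (fun i => (x i ω, y i ω))|}
      ≤ ENNReal.ofReal (2 * M.k / 2 ^ m)
        + ENNReal.ofReal (4 / δ ^ 2 * (V / (lo / 24) * (Ξ ^ 2 * (hi * ‖a‖ ^ 2) / n)))
        + ENNReal.ofReal ((l * (Ξ ^ 2 * (hi * ‖a‖ ^ 2) / n) + M.k * hi * R ^ 2 / l)
            / (δ * (lo / 24))) := by
  have hpm := M.measurable_p
  have hrm := M.measurable_r
  have hnm := M.measurable_noise
  have hlo := H.lo_pos
  set τ : ℝ := lo / 24 with hτ
  have hτ0 : 0 < τ := by positivity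
  have hn : 0 < (n : ℝ) := by
    have h1 : (1 : ℝ) ≤ m := by exact_mod_cast hm
    have hloB : lo ≤ Ξ ^ 2 := by
      have h1 : (1 : ℝ) ≤ M.k := by exact_mod_cast hk
      have := H.card_mul_lo_le
      nlinarith [H.lo_pos]
    by_contra h
    have h2 : lo * (n : ℝ) ≤ 0 := mul_nonpos_of_nonneg_of_nonpos H.lo_pos.le (not_lt.1 h)
    nlinarith [H.lo_pos]
  have hsn : 0 < Real.sqrt n := Real.sqrt_pos.2 hn
  have hsn2 : Real.sqrt n * Real.sqrt n = n := Real.mul_self_sqrt hn.le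
  obtain ⟨G, hG, hGp, hGb, hGl⟩ := H.exists_good_event (n := n) hk hm hmn
  -- the deviation `v = (Q - Q̂) a`
  set v : (Fin n → Euc d) → Euc M.k := fun x' =>
    α - (n : ℝ)⁻¹ • ∑ i, inner ℝ (M.p (x' i)) a • M.p (x' i) with hv
  have hvm : Measurable v := by
    have hs : Measurable fun x' : Fin n → Euc d =>
        ∑ i, inner ℝ (M.p (x' i)) a • M.p (x' i) :=
      Finset.measurable_fun_sum _ fun i _ => by fun_prop
    exact measurable_const.sub (hs.const_smul ((n : ℝ)⁻¹))
  obtain ⟨b, hbm, hbsol, hbnorm, hbsq⟩ := exists_measurable_solution hpm hvm hG hτ0 hGl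
  -- truncate to the good event
  set h : (Fin n → Euc d) → Fin n → ℝ := fun x' i => G.indicator
    (fun x' => inner ℝ (M.p (x' i)) (b x')) x' with hh
  set X : (Fin n → Euc d × ℝ) → Fin n → Euc d := fun z i => (z i).1 with hX
  have hXm : Measurable X := by fun_prop
  have hhm : ∀ i, Measurable fun x' => h x' i := fun i =>
    Measurable.indicator (by fun_prop) hG
  -- A crude bound, needed only for integrability; the truncation to `G` makes it hold everywhere
  -- rather than almost surely.
  have hhK : ∀ x' i, |h x' i| ≤ |Ξ| * ((‖α‖ + (n : ℝ)⁻¹ * (n * (|Ξ| * ‖a‖ * |Ξ|))) / τ) := by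
    intro x' i
    by_cases hx : x' ∈ G
    · simp only [hh, Set.indicator_of_mem hx]
      have hp : ∀ i, ‖M.p (x' i)‖ ≤ |Ξ| := fun i => (hGb x' hx i).trans (le_abs_self _)
      refine (abs_inner_le_of_norm_le (hp i) _).trans ?_
      gcongr
      refine (hbnorm x').trans ?_
      gcongr
      refine (norm_sub_le _ _).trans ?_
      gcongr
      rw [norm_smul, Real.norm_eq_abs, abs_of_pos (inv_pos.2 hn)]
      gcongr
      refine (norm_sum_le _ _).trans ?_
      calc _ ≤ ∑ _i : Fin n, |Ξ| * ‖a‖ * |Ξ| := by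
            refine Finset.sum_le_sum fun i _ => ?_
            rw [norm_smul, Real.norm_eq_abs]
            have h1 := abs_inner_le_of_norm_le (hp i) a
            have h2 := hp i
            gcongr
        _ = _ := by simp
    · simp only [hh, Set.indicator_of_notMem hx, abs_zero]
      positivity
  set P : Measure (Fin n → Euc d × ℝ) := Measure.pi fun _ => M.law with hP
  -- second moment of the deviation
  have hv2 : Integrable (fun z => ‖v (X z)‖ ^ 2) P ∧
      ∫ z, ‖v (X z)‖ ^ 2 ∂P ≤ Ξ ^ 2 * (hi * ‖a‖ ^ 2) / n := by
    have hw : ∀ᵐ z ∂M.law, ‖inner ℝ (M.p z.1) a • M.p z.1‖ ≤ Ξ * ‖a‖ * Ξ := by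
      filter_upwards [M.ae_fst H.norm_p_le] with z hz
      rw [norm_smul, Real.norm_eq_abs]
      have h1 := abs_inner_le_of_norm_le hz a
      have h2 := (abs_nonneg _).trans h1
      gcongr
    have hmean : ∀ c, α c = ∫ z, (inner ℝ (M.p z.1) a • M.p z.1) c ∂M.law := by
      intro c
      have h1 := inner_gram hpm H.norm_p_le (EuclideanSpace.single c (1 : ℝ)) a
      have h2 : gram M.F M.p = M.Q := rfl
      rw [h2, ha] at h1
      have h3 : ∀ z : Euc d × ℝ, (inner ℝ (M.p z.1) a • M.p z.1) c
          = (fun x' => inner ℝ (M.p x') a * M.p x' c) z.1 := fun z => rfl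
      simp_rw [h3]
      rw [M.integral_fst (f := fun x' => inner ℝ (M.p x') a * M.p x' c) (by fun_prop)]
      simp only [EuclideanSpace.inner_single_right, EuclideanSpace.inner_single_left] at h1
      simpa [mul_comm] using h1
    obtain ⟨hI, hle⟩ := integral_norm_sq_sum_sub_le (n := n) (ν := M.law)
      (w := fun z => inner ℝ (M.p z.1) a • M.p z.1) (by fun_prop) hw hmean
    have hvX : ∀ z, ‖v (X z)‖ ^ 2 = ((n : ℝ)⁻¹) ^ 2 *
        ‖∑ i, (inner ℝ (M.p (z i).1) a • M.p (z i).1 - α)‖ ^ 2 := by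
      intro z
      have : v (X z) = -((n : ℝ)⁻¹ • ∑ i, (inner ℝ (M.p (z i).1) a • M.p (z i).1 - α)) := by
        simp only [hv, hX, Finset.sum_sub_distrib, Finset.sum_const, Finset.card_univ,
          Fintype.card_fin, smul_sub, ← Nat.cast_smul_eq_nsmul ℝ, smul_smul]
        rw [inv_mul_cancel₀ hn.ne', one_smul]
        abel
      rw [this, norm_neg, norm_smul, Real.norm_eq_abs, abs_of_pos (inv_pos.2 hn), mul_pow]
    simp_rw [hvX]
    refine ⟨hI.const_mul _, ?_⟩
    rw [integral_const_mul]
    have hsecond : ∫ z, ‖inner ℝ (M.p z.1) a • M.p z.1‖ ^ 2 ∂M.law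
        ≤ Ξ ^ 2 * (hi * ‖a‖ ^ 2) := by
      rw [M.integral_fst (f := fun x' => ‖inner ℝ (M.p x') a • M.p x'‖ ^ 2) (by fun_prop)]
      calc _ ≤ ∫ x', Ξ ^ 2 * (inner ℝ (M.p x') a) ^ 2 ∂M.F := by
            refine integral_mono_of_nonneg (ae_of_all _ fun x => sq_nonneg _)
              ((memLp_inner_of_bounded hpm H.norm_p_le a 2).integrable_sq.const_mul _) ?_
            filter_upwards [H.norm_p_le] with x' hx'
            rw [norm_smul, mul_pow, Real.norm_eq_abs, sq_abs, mul_comm]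
            gcongr
        _ ≤ _ := by
            rw [integral_const_mul]
            have := (H.quadForm_Q a).2
            gcongr
    calc _ ≤ ((n : ℝ)⁻¹) ^ 2 * (n * (Ξ ^ 2 * (hi * ‖a‖ ^ 2))) := by
          gcongr
          exact hle.trans (by gcongr)
      _ = _ := by field_simp
  -- second moment of the score of the approximation error
  set W : (Fin n → Euc d × ℝ) → Euc M.k := fun z =>
    ∑ i, (M.r (z i).1 • M.p (z i).1 - 0) with hW
  have hW2 : Integrable (fun z => ‖W z‖ ^ 2) P ∧
      ∫ z, ‖W z‖ ^ 2 ∂P ≤ n * (M.k * hi * R ^ 2) := by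
    have hR0 := H.R_nonneg
    have hw : ∀ᵐ z ∂M.law, ‖M.r z.1 • M.p z.1‖ ≤ R * Ξ := by
      filter_upwards [M.ae_fst H.norm_p_le, M.ae_fst H.abs_r_le] with z hz hz'
      rw [norm_smul, Real.norm_eq_abs]
      gcongr
    have hmean : ∀ c, (0 : Euc M.k) c = ∫ z, (M.r z.1 • M.p z.1) c ∂M.law := by
      intro c
      have h1 := H.integral_r_mul_inner (EuclideanSpace.single c (1 : ℝ))
      have h3 : ∀ z : Euc d × ℝ, (M.r z.1 • M.p z.1) c
          = (fun x' => M.r x' * M.p x' c) z.1 := fun z => rfl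
      simp_rw [h3]
      rw [M.integral_fst (f := fun x' => M.r x' * M.p x' c) (by fun_prop)]
      simpa [EuclideanSpace.inner_single_right] using h1.symm
    obtain ⟨hI, hle⟩ := integral_norm_sq_sum_sub_le (n := n) (ν := M.law)
      (w := fun z => M.r z.1 • M.p z.1) (by fun_prop) hw hmean
    refine ⟨hI, hle.trans ?_⟩
    gcongr
    rw [M.integral_fst (f := fun x' => ‖M.r x' • M.p x'‖ ^ 2) (by fun_prop)]
    have hpi : Integrable (fun x' => ‖M.p x'‖ ^ 2) M.F := by
      refine Integrable.of_bound (by fun_prop) (Ξ ^ 2) ?_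
      filter_upwards [H.norm_p_le] with x' hx'
      rw [Real.norm_eq_abs, abs_of_nonneg (sq_nonneg _)]
      gcongr
    calc _ ≤ ∫ x', R ^ 2 * ‖M.p x'‖ ^ 2 ∂M.F := by
          refine integral_mono_of_nonneg (ae_of_all _ fun x => sq_nonneg _)
            (hpi.const_mul _) ?_
          filter_upwards [H.abs_r_le] with x' hx'
          rw [norm_smul, mul_pow, Real.norm_eq_abs]
          gcongr
      _ ≤ _ := by
          rw [integral_const_mul]
          have := H.integral_norm_p_sq_le
          calc R ^ 2 * ∫ x', ‖M.p x'‖ ^ 2 ∂M.F ≤ R ^ 2 * (M.k * hi) := by gcongr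
            _ = _ := by ring
  -- the two parts of the remainder
  set D₁ : (Fin n → Euc d × ℝ) → ℝ := fun z =>
    (Real.sqrt n)⁻¹ * ∑ i, h (X z) i * M.noise (z i) with hD₁
  set D₂ : (Fin n → Euc d × ℝ) → ℝ := fun z =>
    (Real.sqrt n)⁻¹ * (‖v (X z)‖ / τ * ‖W z‖) with hD₂
  have hD₁m : Measurable D₁ := by
    refine Measurable.const_mul (Finset.measurable_fun_sum _ fun i _ => ?_) _
    exact ((hhm i).comp hXm).mul (by fun_prop)
  have hWm : Measurable W := Finset.measurable_fun_sum _ fun i _ => by fun_prop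
  have hD₂m : Measurable D₂ := by fun_prop
  set A : ℝ := Ξ ^ 2 * (hi * ‖a‖ ^ 2) / n with hAdef
  -- Given the covariates the errors are orthogonal, so the second moment is at most `V` times the
  -- mean of `b'Q̂b`, itself at most `‖v‖²/τ`.
  have hD₁P : P {z | δ / 2 ≤ |D₁ z|} ≤ ENNReal.ofReal (4 / δ ^ 2 * (V / τ * A)) := by
    obtain ⟨hI, hle⟩ := H.integral_sum_mul_noise_sq_le hhm hhK
    have hsum : ∫ z, ∑ i, h (X z) i ^ 2 ∂P ≤ n * (A / τ) := by
      calc _ ≤ ∫ z, n * (‖v (X z)‖ ^ 2 / τ) ∂P := by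
            refine integral_mono_of_nonneg
              (ae_of_all _ fun z => Finset.sum_nonneg fun i _ => sq_nonneg _)
              ((hv2.1.div_const τ).const_mul _) (ae_of_all _ fun z => ?_)
            have h1 := hbsq (X z)
            rw [inv_mul_eq_div, div_le_iff₀ hn] at h1
            simp only
            refine le_trans ?_ (h1.trans (le_of_eq (mul_comm _ _)))
            refine Finset.sum_le_sum fun i _ => ?_
            by_cases hx : X z ∈ G
            · simp only [hh, Set.indicator_of_mem hx]; exact le_rfl
            · simpa [hh, Set.indicator_of_notMem hx] using sq_nonneg _
        _ = n * ((∫ z, ‖v (X z)‖ ^ 2 ∂P) / τ) := by rw [integral_const_mul, integral_div]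
        _ ≤ _ := by
            have := hv2.2
            gcongr
    have hsq : ∀ z, D₁ z ^ 2 = (n : ℝ)⁻¹ * (∑ i, h (X z) i * M.noise (z i)) ^ 2 := by
      intro z
      rw [hD₁, mul_pow, inv_pow, Real.sq_sqrt hn.le]
    have hI2 : Integrable (fun z => D₁ z ^ 2) P := by
      simp_rw [hsq]; exact hI.const_mul _
    have hE : ∫ z, D₁ z ^ 2 ∂P ≤ V / τ * A := by
      simp_rw [hsq]
      rw [integral_const_mul]
      have hV := H.V_nonneg
      calc _ ≤ (n : ℝ)⁻¹ * (V * (n * (A / τ))) := by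
            gcongr
            exact hle.trans (by gcongr)
        _ = _ := by field_simp
    have hmk := mul_meas_ge_le_integral_of_nonneg (ae_of_all P fun z => sq_nonneg (D₁ z)) hI2
      ((δ / 2) ^ 2)
    have hset : {z | δ / 2 ≤ |D₁ z|} = {z | (δ / 2) ^ 2 ≤ D₁ z ^ 2} := by
      ext z
      simp only [Set.mem_ofPred_eq]
      rw [← sq_abs (D₁ z), pow_le_pow_iff_left₀ (by positivity) (abs_nonneg _) (by norm_num)]
    rw [hset, ← ENNReal.ofReal_toReal (measure_ne_top P {z | (δ / 2) ^ 2 ≤ D₁ z ^ 2})]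
    refine ENNReal.ofReal_le_ofReal ?_
    have h3 := hmk.trans hE
    rw [← le_div_iff₀' (by positivity)] at h3
    refine h3.trans (le_of_eq ?_)
    field_simp
    norm_num
  have hD₂P : P {z | δ / 2 ≤ D₂ z}
      ≤ ENNReal.ofReal ((l * A + M.k * hi * R ^ 2 / l) / (δ * τ)) := by
    have hb1 : ∀ z, D₂ z ≤ (l * ‖v (X z)‖ ^ 2 + (n * l)⁻¹ * ‖W z‖ ^ 2) / (2 * τ) := by
      intro z
      -- A weighted square splits the product `‖v‖ ‖W‖`, so the known second moments also give its
      -- integrability.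
      have h1 : 2 * (‖v (X z)‖ * ((Real.sqrt n)⁻¹ * ‖W z‖))
          ≤ l * ‖v (X z)‖ ^ 2 + (n * l)⁻¹ * ‖W z‖ ^ 2 := by
        have h2 : 0 ≤ (l * ‖v (X z)‖ - (Real.sqrt n)⁻¹ * ‖W z‖) ^ 2 / l := by positivity
        have h3 : (l * ‖v (X z)‖ - (Real.sqrt n)⁻¹ * ‖W z‖) ^ 2 / l
            = l * ‖v (X z)‖ ^ 2 + ((Real.sqrt n) ^ 2 * l)⁻¹ * ‖W z‖ ^ 2
              - 2 * (‖v (X z)‖ * ((Real.sqrt n)⁻¹ * ‖W z‖)) := by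
          field_simp
          ring
        rw [h3, Real.sq_sqrt hn.le] at h2
        linarith
      rw [le_div_iff₀ (by positivity)]
      calc D₂ z * (2 * τ) = 2 * (‖v (X z)‖ * ((Real.sqrt n)⁻¹ * ‖W z‖)) := by
            rw [hD₂]; field_simp
        _ ≤ _ := h1
    have hD₂0 : ∀ z, 0 ≤ D₂ z := fun z => by simp only [hD₂]; positivity
    have hbi : Integrable (fun z => (l * ‖v (X z)‖ ^ 2 + (n * l)⁻¹ * ‖W z‖ ^ 2) / (2 * τ)) P :=
      ((hv2.1.const_mul _).add (hW2.1.const_mul _)).div_const _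
    have hI : Integrable D₂ P := hbi.mono' hD₂m.aestronglyMeasurable
      (ae_of_all _ fun z => by rw [Real.norm_eq_abs, abs_of_nonneg (hD₂0 z)]; exact hb1 z)
    have hE : ∫ z, D₂ z ∂P ≤ (l * A + M.k * hi * R ^ 2 / l) / (2 * τ) := by
      refine (integral_mono hI hbi hb1).trans ?_
      rw [integral_div, integral_add (hv2.1.const_mul _) (hW2.1.const_mul _), integral_const_mul,
        integral_const_mul]
      have h1 := hv2.2
      have h2 := hW2.2
      calc _ ≤ (l * A + (n * l)⁻¹ * (n * (M.k * hi * R ^ 2))) / (2 * τ) := by gcongr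
        _ = _ := by field_simp
    have hmk := mul_meas_ge_le_integral_of_nonneg (ae_of_all P hD₂0) hI (δ / 2)
    rw [← ENNReal.ofReal_toReal (measure_ne_top P {z | δ / 2 ≤ D₂ z})]
    refine ENNReal.ofReal_le_ofReal ?_
    have h3 := hmk.trans hE
    rw [← le_div_iff₀' (by positivity)] at h3
    refine h3.trans (le_of_eq ?_)
    field_simp
  -- transfer to the sample
  have hzm : Measurable fun ω => fun i => ((x i ω, y i ω) : Euc d × ℝ) :=
    measurable_pi_iff.2 fun i => (hA.measurable_x i).prodMk (hA.measurable_y i)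
  have hmap := hA.map_eq_pi
  have hGP : P (X ⁻¹' Gᶜ) ≤ ENNReal.ofReal (2 * M.k / 2 ^ m) := by
    rw [← map_fst_pi, Measure.map_apply hXm hG.compl] at hGp
    exact hGp
  -- The estimator enters only through this almost sure inclusion; its right side is a measurable
  -- event in the data, whose law is the product measure.
  have hsub : {ω | δ < |Real.sqrt n * inner ℝ α (bHat ω - M.beta)
        - linPart M a M.r (fun i => (x i ω, y i ω))|}
      ≤ᵐ[μ] (fun ω => fun i => ((x i ω, y i ω) : Euc d × ℝ)) ⁻¹'
        (X ⁻¹' Gᶜ ∪ {z | δ / 2 ≤ |D₁ z|} ∪ {z | δ / 2 ≤ D₂ z}) := by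
    filter_upwards [hb] with ω hω hmem
    set z : Fin n → Euc d × ℝ := fun i => (x i ω, y i ω) with hz
    by_contra hcon
    have hcon' : z ∉ X ⁻¹' Gᶜ ∪ {z | δ / 2 ≤ |D₁ z|} ∪ {z | δ / 2 ≤ D₂ z} := hcon
    simp only [Set.mem_union, not_or, Set.mem_preimage, Set.mem_compl_iff, not_not,
      Set.mem_ofPred_eq, not_le] at hcon'
    obtain ⟨⟨hzG, hz1⟩, hz2⟩ := hcon'
    set Δ := bHat ω - M.beta with hΔ
    have hne : ∀ h', ∑ i, inner ℝ (M.p (X z i)) Δ * inner ℝ (M.p (X z i)) h'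
        = ∑ i, (M.noise (z i) + M.r (X z i)) * inner ℝ (M.p (X z i)) h' := by
      intro h'
      have h1 := hω.normal_equations h'
      rw [← sub_eq_zero, ← neg_eq_zero, ← Finset.sum_sub_distrib, ← Finset.sum_neg_distrib, ← h1]
      refine Finset.sum_congr rfl fun i _ => ?_
      simp only [hΔ, inner_sub_right, Model.noise, Model.r, Model.rOf, H.beta_eq, hX, hz]
      ring
    have h1 := hne (b (X z))
    have h2 := hbsol (X z) hzG Δ
    have h3 := hne a
    -- Since `α = Qa`, the difference of `α'Δ` and `a'Q̂Δ` is `v'Δ`. Next, `v'Δ = b'Q̂Δ`, and the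
    -- empirical normal equations express this through errors and biases.
    have h4 : (n : ℝ) * inner ℝ α Δ - ∑ i, inner ℝ (M.p (X z i)) Δ * inner ℝ (M.p (X z i)) a
        = n * inner ℝ (v (X z)) Δ := by
      simp only [hv, inner_sub_left, inner_smul_left, sum_inner, mul_sub]
      simp only [conj_trivial]
      rw [mul_inv_cancel_left₀ hn.ne']
      congr 1
      exact Finset.sum_congr rfl fun i _ => mul_comm _ _
    have h5 : (n : ℝ) * inner ℝ (v (X z)) Δ
        = ∑ i, (M.noise (z i) + M.r (X z i)) * inner ℝ (M.p (X z i)) (b (X z)) := by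
      rw [← h2, mul_inv_cancel_left₀ hn.ne', ← h1]
      exact Finset.sum_congr rfl fun i _ => mul_comm _ _
    have h6 : Real.sqrt n * inner ℝ α Δ - linPart M a M.r z
        = D₁ z + (Real.sqrt n)⁻¹ * inner ℝ (b (X z)) (W z) := by
      have e1 : Real.sqrt n * inner ℝ α Δ = (Real.sqrt n)⁻¹ * (n * inner ℝ α Δ) := by
        have : (Real.sqrt n)⁻¹ * n = Real.sqrt n := by
          rw [inv_mul_eq_div, div_eq_iff hsn.ne', hsn2]
        rw [← mul_assoc, this]
      have e2 : n * inner ℝ α Δ = ∑ i, (M.noise (z i) + M.r (X z i)) * inner ℝ (M.p (X z i)) a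
          + ∑ i, (M.noise (z i) + M.r (X z i)) * inner ℝ (M.p (X z i)) (b (X z)) := by
        linarith
      rw [e1, e2, linPart, hD₁, hW, inner_sum]
      simp only [hh, Set.indicator_of_mem hzG]
      rw [← mul_sub, ← mul_add]
      congr 1
      have e3 : ∑ i, inner ℝ (M.p (z i).1) a * (M.noise (z i) + M.r (z i).1)
          = ∑ i, (M.noise (z i) + M.r (X z i)) * inner ℝ (M.p (X z i)) a :=
        Finset.sum_congr rfl fun i _ => mul_comm _ _
      rw [e3, add_sub_cancel_left, ← Finset.sum_add_distrib]
      refine Finset.sum_congr rfl fun i _ => ?_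
      rw [sub_zero, inner_smul_right, real_inner_comm (M.p (z i).1) (b (X z))]
      simp only [hX]
      ring
    have h7 : |(Real.sqrt n)⁻¹ * inner ℝ (b (X z)) (W z)| ≤ D₂ z := by
      rw [abs_mul, abs_of_pos (inv_pos.2 hsn), hD₂]
      refine mul_le_mul_of_nonneg_left ?_ (inv_pos.2 hsn).le
      exact (abs_real_inner_le_norm _ _).trans
        (mul_le_mul_of_nonneg_right (hbnorm _) (norm_nonneg _))
    have h8 : δ < |Real.sqrt n * inner ℝ α Δ - linPart M a M.r z| := hmem
    rw [h6] at h8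
    have h9 := abs_add_le (D₁ z) ((Real.sqrt n)⁻¹ * inner ℝ (b (X z)) (W z))
    linarith
  refine (measure_mono_ae hsub).trans ?_
  have hms : MeasurableSet (X ⁻¹' Gᶜ ∪ {z | δ / 2 ≤ |D₁ z|} ∪ {z | δ / 2 ≤ D₂ z}) := by
    refine ((hXm hG.compl).union (measurableSet_le measurable_const ?_)).union
      (measurableSet_le measurable_const hD₂m)
    exact hD₁m.abs
  rw [← Measure.map_apply hzm hms, hmap]
  exact (measure_union_le _ _).trans
    (add_le_add ((measure_union_le _ _).trans (add_le_add hGP hD₁P)) hD₂P)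

end Regular

end Remainder

/-! ### Norms through the square root of a matrix as quadratic forms. -/

section SquareRoot

variable {k : ℕ} {A : Matrix (Fin k) (Fin k) ℝ}

theorem isHermitian_msqrt (A : Matrix (Fin k) (Fin k) ℝ) : (msqrt A).IsHermitian :=
  cfc_predicate Real.sqrt A

theorem msqrt_mul_self (hA : A.PosSemidef) : msqrt A * msqrt A = A := by
  have hs : IsSelfAdjoint A := hA.isHermitian
  have hnn : ∀ t ∈ spectrum ℝ A, 0 ≤ t := by
    intro t ht
    rw [hA.isHermitian.spectrum_real_eq_range_eigenvalues] at ht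
    obtain ⟨i, rfl⟩ := ht
    exact hA.eigenvalues_nonneg i
  rw [msqrt, ← cfc_mul Real.sqrt Real.sqrt A]
  conv_rhs => rw [← cfc_id ℝ A]
  exact cfc_congr fun t ht => Real.mul_self_sqrt (hnn t ht)

theorem rowNorm_eq_norm_sVec (A : Matrix (Fin k) (Fin k) ℝ) (α : Euc k) :
    rowNorm A α = ‖sVec A α‖ := by
  have h : (msqrt A)ᵀ = msqrt A := by
    rw [← Matrix.conjTranspose_eq_transpose_of_trivial]
    exact isHermitian_msqrt A
  rw [rowNorm, sVec, ← Matrix.mulVec_transpose, h]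
  rfl

theorem inner_toEuclideanLin (B : Matrix (Fin k) (Fin k) ℝ) (u v : Euc k) :
    inner ℝ u (Matrix.toEuclideanLin B v) = u.ofLp ⬝ᵥ (B *ᵥ v.ofLp) := by
  rw [Euc.inner_eq_dotProduct]
  rfl

theorem inner_toEuclideanLin_symm {B : Matrix (Fin k) (Fin k) ℝ} (hB : B.IsSymm) (u v : Euc k) :
    inner ℝ u (Matrix.toEuclideanLin B v) = inner ℝ (Matrix.toEuclideanLin B u) v := by
  rw [inner_toEuclideanLin, real_inner_comm, inner_toEuclideanLin, Matrix.dotProduct_mulVec,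
    ← Matrix.mulVec_transpose, hB.eq, dotProduct_comm]

theorem toEuclideanLin_mul (B D : Matrix (Fin k) (Fin k) ℝ) (v : Euc k) :
    Matrix.toEuclideanLin (B * D) v
      = Matrix.toEuclideanLin B (Matrix.toEuclideanLin D v) := by
  ext i
  change ((B * D) *ᵥ v.ofLp) i = (B *ᵥ (D *ᵥ v.ofLp)) i
  rw [Matrix.mulVec_mulVec]

theorem norm_sVec_sq (hA : A.PosSemidef) (v : Euc k) :
    ‖sVec A v‖ ^ 2 = inner ℝ v (Matrix.toEuclideanLin A v) := by
  have h : (msqrt A).IsSymm := by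
    rw [Matrix.IsSymm, ← Matrix.conjTranspose_eq_transpose_of_trivial]
    exact isHermitian_msqrt A
  rw [← real_inner_self_eq_norm_sq, sVec, ← inner_toEuclideanLin_symm h, ← toEuclideanLin_mul,
    msqrt_mul_self hA]

theorem norm_sVec_smul (A : Matrix (Fin k) (Fin k) ℝ) (t : ℝ) (v : Euc k) :
    ‖sVec A (t • v)‖ = |t| * ‖sVec A v‖ := by
  rw [sVec, map_smul, norm_smul, Real.norm_eq_abs]
  rfl

end SquareRoot

/-- `Q⁻¹ E[(ε_i + ρ(x_i))² p_i p_i'] Q⁻¹`. -/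
noncomputable def Model.Omega {d : ℕ} (M : Model d) (ρ : Euc d → ℝ) :
    Matrix (Fin M.k) (Fin M.k) ℝ :=
  M.Q⁻¹ * (Matrix.of fun a b =>
    ∫ z, (M.noise z + ρ z.1) ^ 2 * (M.p z.1 a * M.p z.1 b) ∂M.law) * M.Q⁻¹

theorem Model.Omega_r {d : ℕ} (M : Model d) : M.Omega M.r = M.OmegaTilde := rfl

theorem Model.Omega_zero {d : ℕ} (M : Model d) : M.Omega (fun _ => 0) = M.OmegaZero := by
  simp only [Model.Omega, add_zero]
  rfl

theorem Model.isSymm_Q {d : ℕ} (M : Model d) : M.Q.IsSymm := isSymm_gram M.F M.p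

theorem Model.isSymm_inv_Q {d : ℕ} (M : Model d) : (M.Q⁻¹).IsSymm := by
  rw [Matrix.IsSymm, Matrix.transpose_nonsing_inv, M.isSymm_Q.eq]

/-! ### Variance of the linear part: formula, lower bound and tails. -/

namespace Regular

variable {d : ℕ} {M : Model d} {lo hi Ξ V C R : ℝ} (H : Regular M lo hi Ξ V C R)

include H

theorem isUnit_det_Q : IsUnit M.Q.det := by
  rw [← Matrix.isUnit_iff_isUnit_det, ← spectrum.zero_notMem_iff ℝ]
  intro h
  exact absurd (H.spec 0 h).1 (not_le.2 H.lo_pos)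

theorem toEuclideanLin_Q_inv (α : Euc M.k) :
    Matrix.toEuclideanLin M.Q (Matrix.toEuclideanLin M.Q⁻¹ α) = α := by
  rw [← toEuclideanLin_mul, Matrix.mul_nonsing_inv _ H.isUnit_det_Q]
  ext i
  change ((1 : Matrix _ _ ℝ) *ᵥ α.ofLp) i = α i
  rw [Matrix.one_mulVec]

theorem integral_inner_mul_inner (h b : Euc M.k) :
    ∫ x, inner ℝ (M.p x) h * inner ℝ (M.p x) b ∂M.F
      = inner ℝ h (Matrix.toEuclideanLin M.Q b) :=
  (inner_gram M.measurable_p H.norm_p_le h b).symm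

theorem norm_le_of_Q_eq {a α : Euc M.k} (ha : Matrix.toEuclideanLin M.Q a = α) :
    lo * ‖a‖ ≤ ‖α‖ := by
  have h1 := (H.quadForm_Q a).1
  have h2 := H.integral_inner_mul_inner a a
  simp_rw [← sq] at h2
  rw [h2, ha] at h1
  have h3 := real_inner_le_norm a α
  rcases (norm_nonneg a).eq_or_lt with h | h
  · rw [← h, mul_zero]; exact norm_nonneg _
  · have : ‖a‖ * (lo * ‖a‖) ≤ ‖a‖ * ‖α‖ := by nlinarith
    exact le_of_mul_le_mul_left this h

/-- This is `Q² ≤ hi Q` tested at `a`, obtained by expanding `E(hi a'p - α'p)² ≥ 0` and using `Q ≤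
hi`. -/
theorem norm_sq_le_of_Q_eq {a α : Euc M.k} (ha : Matrix.toEuclideanLin M.Q a = α) :
    ‖α‖ ^ 2 ≤ hi * ∫ x, (inner ℝ (M.p x) a) ^ 2 ∂M.F := by
  have hL := fun b => memLp_inner_of_bounded M.measurable_p H.norm_p_le b 2
  have h0 : 0 ≤ ∫ x, (hi * inner ℝ (M.p x) a - inner ℝ (M.p x) α) ^ 2 ∂M.F :=
    integral_nonneg fun _ => sq_nonneg _
  have e : ∀ x, (hi * inner ℝ (M.p x) a - inner ℝ (M.p x) α) ^ 2
      = hi ^ 2 * (inner ℝ (M.p x) a) ^ 2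
        - 2 * hi * (inner ℝ (M.p x) α * inner ℝ (M.p x) a) + (inner ℝ (M.p x) α) ^ 2 := by
    intro x; ring
  simp_rw [e] at h0
  have i1 := ((hL a).integrable_sq).const_mul (hi ^ 2)
  have i2 := ((hL α).integrable_mul (hL a)).const_mul (2 * hi)
  have i3 := (hL α).integrable_sq
  have h1 := integral_add (i1.sub i2) i3
  have h2 := integral_sub i1 i2
  simp only [Pi.sub_apply, Pi.mul_apply] at h1 h2
  rw [h1, h2, integral_const_mul, integral_const_mul, H.integral_inner_mul_inner, ha,
    real_inner_self_eq_norm_sq] at h0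
  have h3 := (H.quadForm_Q α).2
  have hhi := H.hi_pos
  have : 0 ≤ hi * (hi * ∫ x, (inner ℝ (M.p x) a) ^ 2 ∂M.F - ‖α‖ ^ 2) := by nlinarith
  have := nonneg_of_mul_nonneg_right this hhi
  linarith

section Variance

variable {ρ : Euc d → ℝ} (hρm : Measurable ρ) (hρ : ∀ᵐ x ∂M.F, |ρ x| ≤ R)

include hρm hρ

theorem memLp_noise_add : MemLp (fun z => M.noise z + ρ z.1) 2 M.law :=
  H.memLp_noise.add (MemLp.of_bound (hρm.comp measurable_fst).aestronglyMeasurable R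
    (M.ae_fst hρ))

theorem integrable_sq_mul_coord (a b : Fin M.k) :
    Integrable (fun z => (M.noise z + ρ z.1) ^ 2 * (M.p z.1 a * M.p z.1 b)) M.law := by
  have hpm := M.measurable_p
  have hm : Measurable fun z : Euc d × ℝ => M.p z.1 a * M.p z.1 b := by fun_prop
  refine (H.memLp_noise_add hρm hρ).integrable_sq.mul_bdd (c := Ξ * Ξ) hm.aestronglyMeasurable ?_
  filter_upwards [M.ae_fst H.norm_p_le] with z hz
  rw [norm_mul]
  exact mul_le_mul ((abs_coord_le_norm _ _).trans hz) ((abs_coord_le_norm _ _).trans hz)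
    (norm_nonneg _) ((norm_nonneg _).trans hz)

theorem integrable_sq_inner_mul (a : Euc M.k) :
    Integrable (fun z => (inner ℝ (M.p z.1) a) ^ 2 * (M.noise z + ρ z.1) ^ 2) M.law := by
  have hpm := M.measurable_p
  have hm : Measurable fun z : Euc d × ℝ => (inner ℝ (M.p z.1) a) ^ 2 := by fun_prop
  refine (H.memLp_noise_add hρm hρ).integrable_sq.bdd_mul (c := (Ξ * ‖a‖) ^ 2)
    hm.aestronglyMeasurable ?_
  filter_upwards [M.ae_fst H.norm_p_le] with z hz
  rw [norm_pow, Real.norm_eq_abs]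
  have := abs_inner_le_of_norm_le hz a
  gcongr

theorem dotProduct_middle_mulVec (a : Euc M.k) :
    a.ofLp ⬝ᵥ ((Matrix.of fun i j => ∫ z, (M.noise z + ρ z.1) ^ 2 * (M.p z.1 i * M.p z.1 j)
      ∂M.law) *ᵥ a.ofLp)
      = ∫ z, (inner ℝ (M.p z.1) a) ^ 2 * (M.noise z + ρ z.1) ^ 2 ∂M.law := by
  have hI : ∀ i j, Integrable (fun z =>
      a i * ((M.noise z + ρ z.1) ^ 2 * (M.p z.1 i * M.p z.1 j) * a j)) M.law := fun i j =>
    ((H.integrable_sq_mul_coord hρm hρ i j).mul_const _).const_mul _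
  have e : ∀ z : Euc d × ℝ, (inner ℝ (M.p z.1) a) ^ 2 * (M.noise z + ρ z.1) ^ 2
      = ∑ i, ∑ j, a i * ((M.noise z + ρ z.1) ^ 2 * (M.p z.1 i * M.p z.1 j) * a j) := by
    intro z
    rw [Euc.inner_eq_sum, sq, Finset.sum_mul_sum, Finset.sum_mul]
    refine Finset.sum_congr rfl fun i _ => ?_
    rw [Finset.sum_mul]
    exact Finset.sum_congr rfl fun j _ => by ring
  simp_rw [e]
  rw [integral_finsetSum _ fun i _ => integrable_finsetSum _ fun j _ => hI i j]
  simp only [dotProduct, Matrix.mulVec, Matrix.of_apply]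
  refine Finset.sum_congr rfl fun i _ => ?_
  rw [integral_finsetSum _ fun j _ => hI i j, Finset.mul_sum]
  refine Finset.sum_congr rfl fun j _ => ?_
  rw [integral_const_mul, integral_mul_const]

theorem inner_Omega (α : Euc M.k) :
    inner ℝ α (Matrix.toEuclideanLin (M.Omega ρ) α)
      = ∫ z, (inner ℝ (M.p z.1) (Matrix.toEuclideanLin M.Q⁻¹ α)) ^ 2
          * (M.noise z + ρ z.1) ^ 2 ∂M.law := by
  rw [Model.Omega, toEuclideanLin_mul, toEuclideanLin_mul,
    inner_toEuclideanLin_symm M.isSymm_inv_Q, inner_toEuclideanLin,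
    H.dotProduct_middle_mulVec hρm hρ]

theorem posSemidef_Omega : (M.Omega ρ).PosSemidef := by
  refine Matrix.PosSemidef.of_dotProduct_mulVec_nonneg ?_ fun v => ?_
  · have hS : (Matrix.of fun i j => ∫ z, (M.noise z + ρ z.1) ^ 2 * (M.p z.1 i * M.p z.1 j)
        ∂M.law).IsSymm := by
      ext i j
      simp only [Matrix.transpose_apply, Matrix.of_apply]
      exact integral_congr_ae (ae_of_all _ fun z => by simp only; ring)
    rw [Matrix.IsHermitian, Matrix.conjTranspose_eq_transpose_of_trivial, Model.Omega,
      Matrix.transpose_mul, Matrix.transpose_mul, hS.eq, M.isSymm_inv_Q.eq, Matrix.mul_assoc]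
  · have h := H.inner_Omega hρm hρ (WithLp.toLp 2 v)
    rw [inner_toEuclideanLin] at h
    simp only [star_trivial]
    rw [h]
    exact integral_nonneg fun z => by positivity

theorem norm_sVec_Omega_sq (α : Euc M.k) :
    ‖sVec (M.Omega ρ) α‖ ^ 2
      = ∫ z, (inner ℝ (M.p z.1) (Matrix.toEuclideanLin M.Q⁻¹ α)) ^ 2
          * (M.noise z + ρ z.1) ^ 2 ∂M.law := by
  rw [norm_sVec_sq (H.posSemidef_Omega hρm hρ), H.inner_Omega hρm hρ]

/-- The cross term `2 E[(a'p)² ρ ε]` vanishes because `E[ε | x] = 0`, so including the bias `ρ` can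
only increase the variance. -/
theorem C_mul_le_variance (a : Euc M.k) :
    C * ∫ x, (inner ℝ (M.p x) a) ^ 2 ∂M.F
      ≤ ∫ z, (inner ℝ (M.p z.1) a) ^ 2 * (M.noise z + ρ z.1) ^ 2 ∂M.law := by
  have hpm := M.measurable_p
  have hsq := (memLp_inner_of_bounded M.measurable_p H.norm_p_le a 2).integrable_sq
  obtain ⟨i1, -, h1⟩ := H.integral_mul_noise_sq (φ := fun x => (inner ℝ (M.p x) a) ^ 2)
    (by fun_prop) (fun x => sq_nonneg _) hsq
  obtain ⟨i2, h2⟩ := H.integral_mul_noise_of_ae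
    (φ := fun x => 2 * ((inner ℝ (M.p x) a) ^ 2 * ρ x)) (by fun_prop)
    (K := 2 * ((Ξ * ‖a‖) ^ 2 * R)) (by
      filter_upwards [H.norm_p_le, hρ] with x hx hx'
      have := abs_inner_le_of_norm_le hx a
      rw [abs_mul, abs_mul, abs_pow, abs_of_pos (by norm_num : (0 : ℝ) < 2)]
      gcongr)
  refine h1.trans ?_
  rw [← add_zero (∫ z, _ * M.noise z ^ 2 ∂M.law), ← h2, ← integral_add i1 i2]
  refine integral_mono (i1.add i2) (H.integrable_sq_inner_mul hρm hρ a) fun z => ?_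
  simp only
  nlinarith [sq_nonneg (inner ℝ (M.p z.1) a * ρ z.1)]

/-- Once `T ≥ 2R`, the event `|ε + ρ| > T` forces `|ε| > T/2 ≥ |ρ|`, whence `(ε + ρ)² ≤ 4ε²`. The
bias thus drops out of the truncated moment at the cost of a factor 4. -/
theorem integral_tail_le (a : Euc M.k) {T : ℝ} (hT : 2 * R ≤ T) (hs : M.supTail (T / 2) ≠ ⊤) :
    ∫ z in {z | T < |M.noise z + ρ z.1|},
        (inner ℝ (M.p z.1) a) ^ 2 * (M.noise z + ρ z.1) ^ 2 ∂M.law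
      ≤ 4 * ((M.supTail (T / 2)).toReal * ∫ x, (inner ℝ (M.p x) a) ^ 2 ∂M.F) := by
  have hpm := M.measurable_p
  have hnm := M.measurable_noise
  have hsq := (memLp_inner_of_bounded M.measurable_p H.norm_p_le a 2).integrable_sq
  obtain ⟨i1, -, -⟩ := H.integral_mul_noise_sq (φ := fun x => (inner ℝ (M.p x) a) ^ 2)
    (by fun_prop) (fun x => sq_nonneg _) hsq
  have hS : MeasurableSet {z | T / 2 < |M.noise z|} := measurableSet_lt (by fun_prop) (by fun_prop)
  have hS' : MeasurableSet {z | T < |M.noise z + ρ z.1|} :=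
    measurableSet_lt (by fun_prop) (by fun_prop)
  have key : ∫ z in {z | T / 2 < |M.noise z|}, (inner ℝ (M.p z.1) a) ^ 2 * M.noise z ^ 2 ∂M.law
      ≤ (M.supTail (T / 2)).toReal * ∫ x, (inner ℝ (M.p x) a) ^ 2 ∂M.F := by
    rw [← integral_indicator hS, integral_eq_lintegral_of_nonneg_ae
      (ae_of_all _ fun z => Set.indicator_nonneg (fun _ _ => by positivity) _)
      (i1.aestronglyMeasurable.indicator hS)]
    refine ENNReal.toReal_le_of_le_ofReal
      (mul_nonneg ENNReal.toReal_nonneg (integral_nonneg fun _ => sq_nonneg _)) ?_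
    have e : ∀ z : Euc d × ℝ, ENNReal.ofReal ({z | T / 2 < |M.noise z|}.indicator
        (fun z => (inner ℝ (M.p z.1) a) ^ 2 * M.noise z ^ 2) z)
        = ENNReal.ofReal ((inner ℝ (M.p z.1) a) ^ 2) * {z | T / 2 < |M.noise z|}.indicator
          (fun z => ENNReal.ofReal (M.noise z ^ 2)) z := by
      intro z
      by_cases hz : z ∈ {z | T / 2 < |M.noise z|}
      · rw [Set.indicator_of_mem hz, Set.indicator_of_mem hz, ENNReal.ofReal_mul (sq_nonneg _)]
      · rw [Set.indicator_of_notMem hz, Set.indicator_of_notMem hz, ENNReal.ofReal_zero, mul_zero]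
    simp_rw [e]
    rw [M.lintegral_mul_noise_sq_restrict
        (φ := fun x => ENNReal.ofReal ((inner ℝ (M.p x) a) ^ 2)) (by fun_prop),
      ENNReal.ofReal_mul ENNReal.toReal_nonneg, ENNReal.ofReal_toReal hs,
      ofReal_integral_eq_lintegral_ofReal hsq (ae_of_all _ fun _ => sq_nonneg _),
      ← lintegral_const_mul _ (by fun_prop)]
    refine lintegral_mono_ae ?_
    filter_upwards [ENNReal.ae_le_essSup (μ := M.F) (M.condTail (T / 2))] with x hx
    rw [mul_comm]
    gcongr
    exact hx
  refine le_trans ?_ (mul_le_mul_of_nonneg_left key (by norm_num))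
  rw [← integral_const_mul, ← integral_indicator hS, ← integral_indicator hS']
  refine integral_mono_ae ((H.integrable_sq_inner_mul hρm hρ a).indicator hS')
    ((i1.const_mul 4).indicator hS) ?_
  filter_upwards [M.ae_fst hρ] with z hz
  by_cases h1 : z ∈ {z | T < |M.noise z + ρ z.1|}
  · have h2 : T < |M.noise z + ρ z.1| := h1
    have h3 := abs_add_le (M.noise z) (ρ z.1)
    have h4 : T / 2 < |M.noise z| := by linarith
    have h5 : |M.noise z + ρ z.1| ≤ 2 * |M.noise z| := by linarith
    have h6 : z ∈ {z | T / 2 < |M.noise z|} := h4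
    rw [Set.indicator_of_mem h1, Set.indicator_of_mem h6]
    have h7 : (M.noise z + ρ z.1) ^ 2 ≤ 4 * M.noise z ^ 2 := by
      rw [← sq_abs (M.noise z + ρ z.1), ← sq_abs (M.noise z)]
      nlinarith [abs_nonneg (M.noise z + ρ z.1)]
    calc _ ≤ (inner ℝ (M.p z.1) a) ^ 2 * (4 * M.noise z ^ 2) := by gcongr
      _ = _ := by ring
  · rw [Set.indicator_of_notMem h1]
    exact Set.indicator_nonneg (fun _ _ => by positivity) _

theorem integral_inner_mul_noise_add (a : Euc M.k)
    (h0 : ∫ x, ρ x * inner ℝ (M.p x) a ∂M.F = 0) :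
    ∫ z, inner ℝ (M.p z.1) a * (M.noise z + ρ z.1) ∂M.law = 0 := by
  have hpm := M.measurable_p
  obtain ⟨i1, h1⟩ := H.integral_mul_noise_of_ae (φ := fun x => inner ℝ (M.p x) a) (by fun_prop)
    (K := Ξ * ‖a‖) (H.norm_p_le.mono fun x hx => abs_inner_le_of_norm_le hx a)
  have i2 : Integrable (fun x => ρ x * inner ℝ (M.p x) a) M.F :=
    integrable_mul_inner hpm H.norm_p_le (MemLp.of_bound (by fun_prop) R hρ) a
  have e : ∀ z : Euc d × ℝ, inner ℝ (M.p z.1) a * (M.noise z + ρ z.1)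
      = inner ℝ (M.p z.1) a * M.noise z + (fun x => ρ x * inner ℝ (M.p x) a) z.1 := by
    intro z; ring
  simp_rw [e]
  rw [integral_add i1 (M.integrable_fst i2), h1, zero_add,
    M.integral_fst (f := fun x => ρ x * inner ℝ (M.p x) a) (by fun_prop), h0]

end Variance

/-- The centring term is zero because `r` is orthogonal to `p` in the population. -/
theorem R2_eq {n : ℕ} (α : Euc M.k) (x : Fin n → Euc d) :
    M.R2 α x = (Real.sqrt n)⁻¹ *
      ∑ i, M.r (x i) * inner ℝ (M.p (x i)) (Matrix.toEuclideanLin M.Q⁻¹ α) := by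
  have hpm := M.measurable_p
  have hrm := M.measurable_r
  have hI : Integrable (fun x' => M.r x' • M.p x') M.F := by
    refine Integrable.of_bound (by fun_prop) (R * Ξ) ?_
    filter_upwards [H.norm_p_le, H.abs_r_le] with x' h1 h2
    have := H.R_nonneg
    rw [norm_smul, Real.norm_eq_abs]
    gcongr
  have h0 : ∫ x', M.r x' • M.p x' ∂M.F = 0 := by
    refine ext_inner_left ℝ fun h => ?_
    rw [← integral_inner hI, inner_zero_right, ← H.integral_r_mul_inner h]
    exact integral_congr_ae (ae_of_all _ fun x' => by
      simp only [inner_smul_right, real_inner_comm])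
  rw [Model.R2, inner_toEuclideanLin_symm M.isSymm_inv_Q, h0, inner_smul_right, inner_sum]
  congr 1
  refine Finset.sum_congr rfl fun i _ => ?_
  rw [sub_zero, inner_smul_right, real_inner_comm]

end Regular

/-! ### Calculus of convergence to zero in probability. -/

section ToZeroInProb

variable {Ω : ℕ → Type*} [∀ n, MeasurableSpace (Ω n)] {μ : ∀ n, Measure (Ω n)}
  {U V Y : ∀ n, Ω n → ℝ}

theorem ToZeroInProb.of_eventually_abs_le (hU : ToZeroInProb μ U) {K : ℝ} (hK : 0 < K)
    (h : ∀ᶠ n in atTop, ∀ ω, |Y n ω| ≤ K * |U n ω|) : ToZeroInProb μ Y := by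
  intro δ hδ
  refine tendsto_of_tendsto_of_tendsto_of_le_of_le' tendsto_const_nhds (hU (δ / K) (by positivity))
    (Eventually.of_forall fun _ => zero_le) ?_
  filter_upwards [h] with n hn
  refine measure_mono fun ω hω => ?_
  have h1 : δ < |Y n ω| := hω
  change δ / K < |U n ω|
  rw [div_lt_iff₀' hK]
  exact h1.trans_le (hn ω)

theorem ToZeroInProb.add (hU : ToZeroInProb μ U) (hV : ToZeroInProb μ V) :
    ToZeroInProb μ (fun n ω => U n ω + V n ω) := by
  intro δ hδ
  have h := (hU (δ / 2) (by positivity)).add (hV (δ / 2) (by positivity))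
  rw [add_zero] at h
  refine tendsto_of_tendsto_of_tendsto_of_le_of_le tendsto_const_nhds h
    (fun _ => zero_le) fun n => ?_
  refine (measure_mono fun ω hω => ?_).trans (measure_union_le _ _)
  have h1 : δ < |U n ω + V n ω| := hω
  by_contra hcon
  simp only [Set.mem_union, Set.mem_ofPred_eq, not_or, not_lt] at hcon
  have := abs_add_le (U n ω) (V n ω)
  linarith [hcon.1, hcon.2]

theorem toZeroInProb_zero : ToZeroInProb μ (fun _ _ => 0) := by
  intro δ hδ
  simp [not_lt.2 hδ.le]

theorem toZeroInProb_const {t : ℕ → ℝ} (ht : Tendsto t atTop (𝓝 0)) :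
    ToZeroInProb μ (fun n _ => t n) := by
  intro δ hδ
  refine tendsto_const_nhds.congr' ?_
  filter_upwards [(tendsto_zero_iff_abs_tendsto_zero t).1 ht |>.eventually (gt_mem_nhds hδ)]
    with n hn
  have : ¬ δ < |t n| := not_lt.2 (le_of_lt hn)
  simp [this]

end ToZeroInProb

/-- A sequence of regular models with shared constants, under the rate and tail conditions. -/
structure RegularSeq {d : ℕ} (M : ℕ → Model d) (lo hi V C : ℝ) (Ξ R : ℕ → ℝ) : Prop where
  regular : ∀ᶠ n in atTop, Regular (M n) lo hi (Ξ n) V C (R n)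
  rate : Tendsto (fun n : ℕ => Ξ n ^ 2 * (Real.log n / n)) atTop (𝓝 0)
  rate_bias : Tendsto (fun n : ℕ => Ξ n ^ 2 * (Real.log n / n) * ((M n).k * R n ^ 2)) atTop (𝓝 0)
  tail : Tendsto (fun t : ℝ => ⨆ n, (M n).supTail t) atTop (𝓝 0)

theorem eventually_one_le_log : ∀ᶠ n : ℕ in atTop, 1 ≤ Real.log n :=
  (Real.tendsto_log_atTop.comp tendsto_natCast_atTop_atTop).eventually (eventually_ge_atTop 1)

/-- The power `m = 2(log₂ n + 1)` of the trace potential: `2^m ≥ n²` makes the failure probability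
`2k/2^m` at most `2/n` when `k ≤ n`. -/
theorem sq_le_two_pow_of_log (n : ℕ) : (n : ℝ) ^ 2 ≤ 2 ^ (2 * (Nat.log 2 n + 1)) := by
  have h : (n : ℝ) ≤ 2 ^ (Nat.log 2 n + 1) := by
    exact_mod_cast (Nat.lt_pow_succ_log_self (b := 2) (by norm_num) n).le
  rw [mul_comm 2, pow_mul]
  gcongr

theorem two_mul_log_add_one_le {n : ℕ} (hn : 1 ≤ Real.log n) :
    ((2 * (Nat.log 2 n + 1) : ℕ) : ℝ) ≤ 6 * Real.log n := by
  have hn0 : n ≠ 0 := by rintro rfl; norm_num at hn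
  have h1 : Real.log ((2 : ℝ) ^ Nat.log 2 n) ≤ Real.log n := by
    refine Real.log_le_log (by positivity) ?_
    exact_mod_cast Nat.pow_log_le_self 2 hn0
  rw [Real.log_pow] at h1
  have h2 := Real.log_two_gt_d9
  push_cast
  have h3 : (0 : ℝ) ≤ Nat.log 2 n := Nat.cast_nonneg _
  nlinarith

theorem Model.k_pos_of_norm_eq_one {d : ℕ} {M : Model d} {α : Euc M.k} (hα : ‖α‖ = 1) :
    0 < M.k := by
  rcases Nat.eq_zero_or_pos M.k with h | h
  · have h1 : ‖α‖ ^ 2 = 0 := by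
      rw [Euc.norm_sq_eq_sum]
      have : IsEmpty (Fin M.k) := by rw [h]; infer_instance
      exact Finset.sum_of_isEmpty _
    rw [hα] at h1
    norm_num at h1
  · exact h

/-! ### Asymptotics along a sequence of regular models. -/

namespace RegularSeq

variable {d : ℕ} {M : ℕ → Model d} {lo hi V C : ℝ} {Ξ R : ℕ → ℝ} {Ω : ℕ → Type*}
  [∀ n, MeasurableSpace (Ω n)] {μ : ∀ n, Measure (Ω n)} [∀ n, IsProbabilityMeasure (μ n)]
  {x : ∀ n, Fin n → Ω n → Euc d} {y : ∀ n, Fin n → Ω n → ℝ}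
  {betaHat : ∀ n, Ω n → Euc (M n).k}

theorem remainder_toZeroInProb (H : RegularSeq M lo hi V C Ξ R)
    (hb : ∀ n, ∀ᵐ ω ∂μ n,
      IsEstimate (M n).p (fun i => x n i ω) (fun i => y n i ω) (betaHat n ω))
    (hA1 : ∀ n, ConditionA1 (M n) (μ n) (x n) (y n))
    {α : ∀ n, Euc (M n).k} (hα : ∀ n, ‖α n‖ = 1) :
    ToZeroInProb μ (fun n ω => Real.sqrt n * inner ℝ (α n) (betaHat n ω - (M n).beta)
      - linPart (M n) (Matrix.toEuclideanLin (M n).Q⁻¹ (α n)) (M n).r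
          (fun i => (x n i ω, y n i ω))) := by
  intro δ hδ
  obtain ⟨n₀, hn₀⟩ := H.regular.exists
  have hlo := hn₀.lo_pos
  have hhi := hn₀.hi_pos
  have hV := hn₀.V_nonneg
  set A : ℕ → ℝ := fun n => Ξ n ^ 2 * (Real.log n / n) * (hi / lo ^ 2) with hA
  set s : ℕ → ℝ := fun n => A n * ((M n).k * hi * R n ^ 2) with hs
  have hA0 : Tendsto A atTop (𝓝 0) := by simpa using H.rate.mul_const (hi / lo ^ 2)
  have hs0 : Tendsto s atTop (𝓝 0) := by
    have := H.rate_bias.mul_const (hi / lo ^ 2 * hi)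
    rw [zero_mul] at this
    refine this.congr fun n => ?_
    simp only [hs, hA]
    ring
  have hsq0 : Tendsto (fun n => Real.sqrt (s n)) atTop (𝓝 0) := by simpa using hs0.sqrt
  have he : Tendsto (fun n : ℕ => (n : ℝ)⁻¹) atTop (𝓝 0) := tendsto_inv_atTop_nhds_zero_nat
  have hB : Tendsto (fun n : ℕ => ENNReal.ofReal (2 * (n : ℝ)⁻¹)
      + ENNReal.ofReal (4 / δ ^ 2 * (V / (lo / 24) * A n))
      + ENNReal.ofReal ((Real.sqrt (s n) + (n : ℝ)⁻¹ + Real.sqrt (s n)) / (δ * (lo / 24))))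
      atTop (𝓝 0) := by
    have h1 := ENNReal.tendsto_ofReal (he.const_mul 2)
    have h2 := ENNReal.tendsto_ofReal ((hA0.const_mul (V / (lo / 24))).const_mul (4 / δ ^ 2))
    have h3 := ENNReal.tendsto_ofReal (((hsq0.add he).add hsq0).div_const (δ * (lo / 24)))
    simpa using (h1.add h2).add h3
  refine tendsto_of_tendsto_of_tendsto_of_le_of_le' tendsto_const_nhds hB
    (Eventually.of_forall fun _ => zero_le) ?_
  -- The threshold `lo/288` is `lo/(48·6)`: the eigenvalue bound requires `48 m Ξ² ≤ lo n`, and `m ≤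
  -- 6 log n`.
  filter_upwards [H.regular, eventually_one_le_log, eventually_gt_atTop 0,
    H.rate.eventually (gt_mem_nhds (show (0 : ℝ) < lo / 288 by positivity))]
    with n hR hlog hn hrate
  have hn' : (0 : ℝ) < n := by exact_mod_cast hn
  have hk := Model.k_pos_of_norm_eq_one (hα n)
  have hk1 : (1 : ℝ) ≤ (M n).k := by exact_mod_cast hk
  have hkΞ := hR.card_mul_lo_le
  have hΞ : 0 < Ξ n ^ 2 := lt_of_lt_of_le (by positivity) hkΞ
  rw [← mul_div_assoc, div_lt_iff₀ hn'] at hrate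
  have hΞlog : Ξ n ^ 2 ≤ Ξ n ^ 2 * Real.log n := le_mul_of_one_le_right hΞ.le hlog
  have hkn : ((M n).k : ℝ) ≤ n := by nlinarith
  set m := 2 * (Nat.log 2 n + 1) with hm
  have hmlog : (m : ℝ) ≤ 6 * Real.log n := two_mul_log_add_one_le hlog
  have hmn : 48 * m * Ξ n ^ 2 ≤ lo * n := by
    have : (m : ℝ) * Ξ n ^ 2 ≤ 6 * Real.log n * Ξ n ^ 2 := by gcongr
    linarith
  have ha := hR.toEuclideanLin_Q_inv (α n)
  set a := Matrix.toEuclideanLin (M n).Q⁻¹ (α n) with hadef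
  have hanorm : ‖a‖ ≤ 1 / lo := by
    rw [le_div_iff₀' hlo, ← hα n]
    exact hR.norm_le_of_Q_eq ha
  have hApos : 0 < A n := by simp only [hA]; positivity
  have hAle : Ξ n ^ 2 * (hi * ‖a‖ ^ 2) / n ≤ A n := by
    calc _ ≤ Ξ n ^ 2 * Real.log n * (hi * (1 / lo) ^ 2) / n := by gcongr
      _ = _ := by simp only [hA]; field_simp
  have hs1 : 0 ≤ s n := by simp only [hs]; positivity
  -- This nearly optimal weight balances the two terms: `l A = √s + 1/n` and `s/(lA) ≤ √s`. The
  -- summand `1/n` keeps `l` positive when the bias bound is zero.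
  set l := (Real.sqrt (s n) + (n : ℝ)⁻¹) / A n with hl
  have hnum : 0 < Real.sqrt (s n) + (n : ℝ)⁻¹ := by positivity
  have hl0 : 0 < l := by positivity
  refine (hR.measure_remainder_gt_le (hA1 n) (hb n) hk (m := m) (by omega) hmn ha hδ hl0).trans ?_
  refine add_le_add (add_le_add (ENNReal.ofReal_le_ofReal ?_) (ENNReal.ofReal_le_ofReal ?_))
    (ENNReal.ofReal_le_ofReal ?_)
  · have h2 := sq_le_two_pow_of_log n
    rw [← hm] at h2
    rw [div_le_iff₀ (by positivity)]
    calc 2 * ((M n).k : ℝ) ≤ 2 * n := by linarith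
      _ = 2 * (n : ℝ)⁻¹ * (n : ℝ) ^ 2 := by field_simp
      _ ≤ _ := by gcongr
  · gcongr
  · refine div_le_div_of_nonneg_right (add_le_add ?_ ?_) (by positivity)
    · calc _ ≤ l * A n := by gcongr
        _ = _ := by rw [hl, div_mul_cancel₀ _ hApos.ne']
    · rw [hl, div_div_eq_mul_div, div_le_iff₀ hnum]
      calc ((M n).k : ℝ) * hi * R n ^ 2 * A n = Real.sqrt (s n) * Real.sqrt (s n) := by
            rw [Real.mul_self_sqrt hs1, hs]; ring
        _ ≤ _ := by
          gcongr
          exact le_add_of_nonneg_right (by positivity)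

/-- The function `ρ` is the part of the approximation error kept in the linear statistic and in its
variance; `hdiff` says that the discarded part is negligible. The choices `ρ = r` and `ρ = 0` give
the two covariance matrices. -/
theorem toStdNormal_of_toZeroInProb (H : RegularSeq M lo hi V C Ξ R)
    (hbm : ∀ n, AEMeasurable (betaHat n) (μ n))
    (hb : ∀ n, ∀ᵐ ω ∂μ n,
      IsEstimate (M n).p (fun i => x n i ω) (fun i => y n i ω) (betaHat n ω))
    (hA1 : ∀ n, ConditionA1 (M n) (μ n) (x n) (y n))
    {α : ∀ n, Euc (M n).k} (hα : ∀ n, ‖α n‖ = 1)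
    {ρ : ℕ → Euc d → ℝ} (hρm : ∀ n, Measurable (ρ n))
    (hρ : ∀ᶠ n in atTop, ∀ᵐ x' ∂(M n).F, |ρ n x'| ≤ R n)
    (hρ0 : ∀ᶠ n in atTop, ∀ b, ∫ x', ρ n x' * inner ℝ ((M n).p x') b ∂(M n).F = 0)
    (hdiff : ToZeroInProb μ (fun n ω => (Real.sqrt n)⁻¹ * ∑ i,
      ((M n).r (x n i ω) - ρ n (x n i ω)) *
        inner ℝ ((M n).p (x n i ω)) (Matrix.toEuclideanLin (M n).Q⁻¹ (α n)))) :
    ToStdNormal μ (fun n ω => Real.sqrt n *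
      (inner ℝ (α n) (betaHat n ω - (M n).beta) / ‖sVec ((M n).Omega (ρ n)) (α n)‖)) := by
  have hrem := H.remainder_toZeroInProb hb hA1 hα
  obtain ⟨n₀, hn₀⟩ := H.regular.exists
  have hlo := hn₀.lo_pos
  have hhi := hn₀.hi_pos
  have hC := hn₀.C_pos
  set a : ∀ n, Euc (M n).k := fun n => Matrix.toEuclideanLin (M n).Q⁻¹ (α n) with ha
  set σ : ℕ → ℝ := fun n => ‖sVec ((M n).Omega (ρ n)) (α n)‖ with hσ
  set κ : ℝ := Real.sqrt (C / hi) with hκ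
  have hκ0 : 0 < κ := Real.sqrt_pos.2 (by positivity)
  have hvar : ∀ᶠ n in atTop, σ n ^ 2
      = ∫ z, (inner ℝ ((M n).p z.1) (a n)) ^ 2 * ((M n).noise z + ρ n z.1) ^ 2 ∂(M n).law := by
    filter_upwards [H.regular, hρ] with n hR hρn
    exact hR.norm_sVec_Omega_sq (hρm n) hρn (α n)
  have hvarC : ∀ᶠ n in atTop, C * ∫ x', (inner ℝ ((M n).p x') (a n)) ^ 2 ∂(M n).F ≤ σ n ^ 2 := by
    filter_upwards [H.regular, hρ, hvar] with n hR hρn hv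
    rw [hv]
    exact hR.C_mul_le_variance (hρm n) hρn (a n)
  -- Combine `σ² ≥ C a'Qa` with `1 = ‖α‖² ≤ hi a'Qa`.
  have hσκ : ∀ᶠ n in atTop, κ ≤ σ n := by
    filter_upwards [H.regular, hvarC] with n hR hv
    have h1 := hR.norm_sq_le_of_Q_eq (hR.toEuclideanLin_Q_inv (α n))
    rw [hα n, one_pow] at h1
    refine Real.sqrt_le_iff.2 ⟨norm_nonneg _, le_trans ?_ hv⟩
    rw [div_le_iff₀ hhi]
    calc C = C * 1 := (mul_one C).symm
      _ ≤ C * (hi * ∫ x', (inner ℝ ((M n).p x') (a n)) ^ 2 ∂(M n).F) := by gcongr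
      _ = _ := by ring
  have hpm := fun n => (M n).measurable_p
  have hnm := fun n => (M n).measurable_noise
  set f : ∀ _ : ℕ, Euc d × ℝ → ℝ := fun n z =>
    inner ℝ ((M n).p z.1) (a n) * ((M n).noise z + ρ n z.1) / σ n with hf
  have hfm : ∀ n, Measurable (f n) := by
    intro n
    have h1 := hpm n
    have h2 := hnm n
    have h3 := hρm n
    exact Measurable.div_const (by fun_prop) _
  have hzm : ∀ n i, Measurable fun ω => ((x n i ω, y n i ω) : Euc d × ℝ) := fun n i =>
    ((hA1 n).measurable_x i).prodMk ((hA1 n).measurable_y i)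
  have hCLT : ToStdNormal μ (fun n ω => (Real.sqrt n)⁻¹ * ∑ i, f n (x n i ω, y n i ω)) := by
    have : ∀ n, IsProbabilityMeasure ((M n).law.map (f n)) := fun n =>
      Measure.isProbabilityMeasure_map (hfm n).aemeasurable
    refine toStdNormal_of_lindeberg (X := fun n i ω => f n (x n i ω, y n i ω))
      (ρ := fun n => (M n).law.map (f n))
      (fun n i => ((hfm n).comp (hzm n i)).aemeasurable) ?_ ?_ ?_ ?_ ?_
    · intro n i
      rw [← (hA1 n).map_eq i, Measure.map_map (hfm n) (hzm n i)]
      rfl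
    · intro n
      exact (hA1 n).indep.comp (fun _ => f n) fun _ => hfm n
    · filter_upwards [H.regular, hρ, hρ0] with n hR hρn h0
      rw [integral_map (hfm n).aemeasurable (by fun_prop)]
      simp only [hf]
      rw [integral_div, hR.integral_inner_mul_noise_add (hρm n) hρn (a n) (h0 _), zero_div]
    · filter_upwards [hvar, hσκ] with n hv hk
      rw [integral_map (hfm n).aemeasurable (by fun_prop)]
      simp only [hf, div_pow, mul_pow]
      rw [integral_div, ← hv, div_self]
      exact pow_ne_zero _ (hκ0.trans_le hk).ne'
    · intro δ hδ
      set w : ℕ → ℝ := fun n => Real.sqrt (Ξ n ^ 2 * (Real.log n / n)) with hw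
      have hw0 : Tendsto w atTop (𝓝 0) := by simpa using H.rate.sqrt
      have hwb : Tendsto (fun n : ℕ => Real.sqrt (Ξ n ^ 2 * (Real.log n / n)
          * ((M n).k * R n ^ 2))) atTop (𝓝 0) := by simpa using H.rate_bias.sqrt
      -- The facts `log n ≥ 1` and `k ≥ 1` weaken the two rate conditions to bounds on `Ξ/√n` and on
      -- `R w`.
      have hevn : ∀ᶠ n : ℕ in atTop, 0 < w n ∧ Ξ n ≤ w n * Real.sqrt n ∧
          R n * w n ≤ Real.sqrt (Ξ n ^ 2 * (Real.log n / n) * ((M n).k * R n ^ 2)) := by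
        filter_upwards [H.regular, eventually_one_le_log, eventually_gt_atTop 0] with n hR hlog hn
        have hn' : (0 : ℝ) < n := by exact_mod_cast hn
        have hk1 : (1 : ℝ) ≤ (M n).k := by
          exact_mod_cast Model.k_pos_of_norm_eq_one (hα n)
        have hΞ : 0 < Ξ n ^ 2 := lt_of_lt_of_le (by positivity) hR.card_mul_lo_le
        have hR0 := hR.R_nonneg
        refine ⟨Real.sqrt_pos.2 (by positivity), ?_, ?_⟩
        · rw [hw, ← Real.sqrt_mul (by positivity)]
          refine Real.le_sqrt_of_sq_le ?_
          have : Ξ n ^ 2 * (Real.log n / n) * n = Ξ n ^ 2 * Real.log n := by field_simp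
          rw [this]
          exact le_mul_of_one_le_right hΞ.le hlog
        · refine Real.le_sqrt_of_sq_le ?_
          rw [mul_pow, hw, Real.sq_sqrt (by positivity), mul_comm]
          gcongr
          exact le_mul_of_one_le_left (sq_nonneg _) hk1
      -- A standardised summand above `δ√n` forces `|ε + ρ|` above this level, since `|a'p| ≤
      -- w√n/lo` and `σ ≥ κ`. It diverges as `w → 0`, and eventually exceeds `2R` because `R w → 0`.
      set T : ℕ → ℝ := fun n => δ * κ * lo / w n with hT
      have hTinf : Tendsto T atTop atTop := by
        have : Tendsto w atTop (𝓝[>] 0) := tendsto_nhdsWithin_iff.2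
          ⟨hw0, hevn.mono fun n hn => hn.1⟩
        exact (this.inv_tendsto_nhdsGT_zero).const_mul_atTop (by positivity)
      have hsup : Tendsto (fun n => ⨆ n', (M n').supTail (T n / 2)) atTop (𝓝 0) :=
        H.tail.comp (hTinf.atTop_div_const (by norm_num))
      have hsup' : Tendsto (fun n => 4 / C * (⨆ n', (M n').supTail (T n / 2)).toReal) atTop
          (𝓝 0) := by
        simpa using ((ENNReal.tendsto_toReal ENNReal.zero_ne_top).comp hsup).const_mul (4 / C)
      refine tendsto_of_tendsto_of_tendsto_of_le_of_le' tendsto_const_nhds hsup'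
        (Eventually.of_forall fun n => integral_nonneg fun v => sq_nonneg v) ?_
      filter_upwards [H.regular, hρ, hvarC, hσκ, hevn, eventually_gt_atTop 0,
        hsup.eventually (gt_mem_nhds ENNReal.zero_lt_top),
        hwb.eventually (gt_mem_nhds (show 0 < δ * κ * lo / 2 by positivity))]
        with n hR hρn hvn hσn hwn hn hfin hRw
      have hn' : (0 : ℝ) < n := by exact_mod_cast hn
      have hsn : 0 < Real.sqrt n := Real.sqrt_pos.2 hn'
      obtain ⟨hw1, hw2, hw3⟩ := hwn
      have hσ0 : 0 < σ n := hκ0.trans_le hσn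
      have hTR : 2 * R n ≤ T n := by
        rw [hT, le_div_iff₀ hw1]
        linarith
      have hle : (M n).supTail (T n / 2) ≤ ⨆ n', (M n').supTail (T n / 2) :=
        le_iSup (fun n' => (M n').supTail (T n / 2)) n
      have hanorm : ‖a n‖ ≤ 1 / lo := by
        rw [le_div_iff₀' hlo, ← hα n]
        exact hR.norm_le_of_Q_eq (hR.toEuclideanLin_Q_inv (α n))
      have htail := hR.integral_tail_le (hρm n) hρn (a n) hTR (hle.trans_lt hfin).ne
      have hsm : MeasurableSet {v : ℝ | δ * Real.sqrt n < |v|} :=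
        measurableSet_lt (by fun_prop) (by fun_prop)
      rw [setIntegral_map hsm (by fun_prop) (hfm n).aemeasurable]
      have hfI : Integrable (fun z => f n z ^ 2) (M n).law := by
        simp only [hf, div_pow, mul_pow]
        exact (hR.integrable_sq_inner_mul (hρm n) hρn (a n)).div_const _
      have hsub : f n ⁻¹' {v : ℝ | δ * Real.sqrt n < |v|}
          ≤ᵐ[(M n).law] {z | T n < |(M n).noise z + ρ n z.1|} := by
        filter_upwards [(M n).ae_fst hR.norm_p_le] with z hz hmem
        have h1 : δ * Real.sqrt n < |f n z| := hmem
        change T n < |(M n).noise z + ρ n z.1|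
        rw [hT, div_lt_iff₀ hw1]
        have h2 : |inner ℝ ((M n).p z.1) (a n)| ≤ w n * Real.sqrt n * (1 / lo) := by
          refine (abs_inner_le_of_norm_le (hz.trans hw2) (a n)).trans ?_
          gcongr
        rw [hf, abs_div, abs_mul, abs_of_pos hσ0, lt_div_iff₀ hσ0] at h1
        have h3 : δ * Real.sqrt n * κ
            < w n * Real.sqrt n * (1 / lo) * |(M n).noise z + ρ n z.1| := by
          calc δ * Real.sqrt n * κ ≤ δ * Real.sqrt n * σ n := by gcongr
            _ < _ := h1
            _ ≤ _ := by gcongr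
        have h4 : Real.sqrt n * (δ * κ * lo)
            < Real.sqrt n * (|(M n).noise z + ρ n z.1| * w n) := by
          have h5 := mul_lt_mul_of_pos_right h3 hlo
          have h6 : w n * Real.sqrt n * (1 / lo) * |(M n).noise z + ρ n z.1| * lo
              = Real.sqrt n * (|(M n).noise z + ρ n z.1| * w n) := by field_simp
          linarith
        exact lt_of_mul_lt_mul_left h4 hsn.le
      refine (setIntegral_mono_set hfI.integrableOn (ae_of_all _ fun z => sq_nonneg _) hsub).trans ?_
      simp only [hf, div_pow, mul_pow]
      rw [integral_div, div_le_iff₀ (by positivity)]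
      refine htail.trans ?_
      have hI0 : 0 ≤ ∫ x', (inner ℝ ((M n).p x') (a n)) ^ 2 ∂(M n).F :=
        integral_nonneg fun _ => sq_nonneg _
      have htr := ENNReal.toReal_mono hfin.ne hle
      -- The second moment of `a'p` is not bounded separately: it cancels against `σ²`, leaving the
      -- factor `4/C`.
      calc 4 * (((M n).supTail (T n / 2)).toReal
              * ∫ x', (inner ℝ ((M n).p x') (a n)) ^ 2 ∂(M n).F)
          ≤ 4 * ((⨆ n', (M n').supTail (T n / 2)).toReal
              * ∫ x', (inner ℝ ((M n).p x') (a n)) ^ 2 ∂(M n).F) := by gcongr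
        _ = 4 / C * (⨆ n', (M n').supTail (T n / 2)).toReal
              * (C * ∫ x', (inner ℝ ((M n).p x') (a n)) ^ 2 ∂(M n).F) := by field_simp
        _ ≤ _ := by gcongr
  refine hCLT.of_toZeroInProb_sub (fun n => ?_) ?_
  · have := hbm n
    exact (((this.sub_const _).const_inner).div_const _).const_mul _
  · refine (hrem.add hdiff).of_eventually_abs_le (inv_pos.2 hκ0) ?_
    filter_upwards [hσκ] with n hk ω
    have hσ0 : 0 < σ n := hκ0.trans_le hk
    have e : Real.sqrt n * (inner ℝ (α n) (betaHat n ω - (M n).beta) / σ n)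
          - (Real.sqrt n)⁻¹ * ∑ i, f n (x n i ω, y n i ω)
        = (σ n)⁻¹ * (Real.sqrt n * inner ℝ (α n) (betaHat n ω - (M n).beta)
            - linPart (M n) (a n) (M n).r (fun i => (x n i ω, y n i ω))
          + (Real.sqrt n)⁻¹ * ∑ i, ((M n).r (x n i ω) - ρ n (x n i ω)) *
              inner ℝ ((M n).p (x n i ω)) (a n)) := by
      have e1 : ∑ i, f n (x n i ω, y n i ω) = (σ n)⁻¹ *
          (∑ i, inner ℝ ((M n).p (x n i ω)) (a n) *
              ((M n).noise (x n i ω, y n i ω) + (M n).r (x n i ω))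
            - ∑ i, ((M n).r (x n i ω) - ρ n (x n i ω)) *
              inner ℝ ((M n).p (x n i ω)) (a n)) := by
        rw [← Finset.sum_sub_distrib, Finset.mul_sum]
        refine Finset.sum_congr rfl fun i _ => ?_
        simp only [hf]
        ring
      rw [e1, linPart]
      ring
    rw [e, abs_mul, abs_of_pos (inv_pos.2 hσ0)]
    gcongr

end RegularSeq

/-! ### From the stated conditions to uniform constants and rates. -/

section Uniformity

variable {d : ℕ}

/-- Truncation at `t`. With one level `t` for all models, uniform integrability yields a uniform
upper bound on the conditional variance. -/
theorem Model.condVar_le (M : Model d) (t : ℝ) (x : Euc d) :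
    M.condVar x ≤ M.condTail t x + ENNReal.ofReal (t ^ 2) := by
  have hS : MeasurableSet {y : ℝ | t < |y - M.g x|} := measurableSet_lt (by fun_prop) (by fun_prop)
  have : IsProbabilityMeasure (M.cond x) := by unfold Model.cond; infer_instance
  rw [Model.condVar, Model.condTail, ← lintegral_add_compl _ hS]
  gcongr
  calc _ ≤ ∫⁻ _y in {y : ℝ | t < |y - M.g x|}ᶜ, ENNReal.ofReal (t ^ 2) ∂M.cond x := by
        refine setLIntegral_mono measurable_const fun y hy => ENNReal.ofReal_le_ofReal ?_
        have h1 : |y - M.g x| ≤ t := not_lt.1 hy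
        rw [← sq_abs]
        gcongr
    _ ≤ _ := by
      rw [setLIntegral_const]
      exact mul_le_of_le_one_right' prob_le_one

variable {M : ℕ → Model d} {c ℓ : ℕ → ℝ}

/-- An infinite `xi` would make the rate expression infinite, as its other factors are positive for
large `n`. -/
theorem xi_ne_top_of_rate
    (h_rate : Tendsto (fun n : ℕ =>
      ((M n).xi ^ 2 * ENNReal.ofReal (Real.log n / n)) ^ (1 / 2 : ℝ)
        * ENNReal.ofReal (1 + Real.sqrt (M n).k * ℓ n * c n)) atTop (𝓝 0))
    (hR : ∀ n, 0 ≤ ℓ n * c n) : ∀ᶠ n in atTop, (M n).xi ≠ ⊤ := by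
  filter_upwards [eventually_one_le_log, eventually_gt_atTop 0,
    h_rate.eventually (gt_mem_nhds ENNReal.zero_lt_top)] with n hlog hn hlt htop
  have hn' : (0 : ℝ) < n := by exact_mod_cast hn
  have h1 : ENNReal.ofReal (Real.log n / n) ≠ 0 := by
    rw [Ne, ENNReal.ofReal_eq_zero, not_le]
    positivity
  have h2 : ENNReal.ofReal (1 + Real.sqrt (M n).k * ℓ n * c n) ≠ 0 := by
    rw [Ne, ENNReal.ofReal_eq_zero, not_le, mul_assoc]
    have := hR n
    positivity
  rw [htop, ENNReal.top_pow (by norm_num), ENNReal.top_mul h1,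
    ENNReal.top_rpow_of_pos (by norm_num), ENNReal.top_mul h2] at hlt
  exact lt_irrefl _ hlt

theorem rates_of_rate
    (h_rate : Tendsto (fun n : ℕ =>
      ((M n).xi ^ 2 * ENNReal.ofReal (Real.log n / n)) ^ (1 / 2 : ℝ)
        * ENNReal.ofReal (1 + Real.sqrt (M n).k * ℓ n * c n)) atTop (𝓝 0))
    (hR : ∀ n, 0 ≤ ℓ n * c n) :
    Tendsto (fun n : ℕ => (M n).xi.toReal ^ 2 * (Real.log n / n)) atTop (𝓝 0) ∧
    Tendsto (fun n : ℕ => (M n).xi.toReal ^ 2 * (Real.log n / n) *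
      ((M n).k * (ℓ n * c n) ^ 2)) atTop (𝓝 0) := by
  have ht := ((ENNReal.tendsto_toReal ENNReal.zero_ne_top).comp h_rate).pow 2
  rw [ENNReal.toReal_zero, zero_pow two_ne_zero] at ht
  have ht' : Tendsto (fun n : ℕ => (M n).xi.toReal ^ 2 * (Real.log n / n) *
      (1 + Real.sqrt (M n).k * (ℓ n * c n)) ^ 2) atTop (𝓝 0) := by
    refine ht.congr' ?_
    filter_upwards [eventually_one_le_log] with n hlog
    have h0 : 0 ≤ Real.log n / n := by positivity
    have h1 := hR n
    simp only [Function.comp, ENNReal.toReal_mul, ← ENNReal.toReal_rpow, ENNReal.toReal_pow,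
      ENNReal.toReal_ofReal h0, mul_assoc (Real.sqrt _)]
    rw [ENNReal.toReal_ofReal (by positivity), ← Real.sqrt_eq_rpow, mul_pow,
      Real.sq_sqrt (by positivity)]
  constructor
  · refine tendsto_of_tendsto_of_tendsto_of_le_of_le' tendsto_const_nhds ht' ?_ ?_
    · filter_upwards [eventually_one_le_log] with n hlog
      positivity
    · filter_upwards [eventually_one_le_log] with n hlog
      have h1 := hR n
      refine le_mul_of_one_le_right (by positivity) (one_le_pow₀ ?_)
      exact le_add_of_nonneg_right (by positivity)
  · refine tendsto_of_tendsto_of_tendsto_of_le_of_le' tendsto_const_nhds ht' ?_ ?_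
    · filter_upwards [eventually_one_le_log] with n hlog
      positivity
    · filter_upwards [eventually_one_le_log] with n hlog
      have h1 := hR n
      refine mul_le_mul_of_nonneg_left ?_ (by positivity)
      have h2 : ((M n).k : ℝ) * (ℓ n * c n) ^ 2 = (Real.sqrt (M n).k * (ℓ n * c n)) ^ 2 := by
        rw [mul_pow (Real.sqrt _), Real.sq_sqrt (Nat.cast_nonneg _)]
      rw [h2]
      gcongr
      linarith

theorem exists_regularSeq
    {Ω : ℕ → Type*} [∀ n, MeasurableSpace (Ω n)] {μ : ∀ n, Measure (Ω n)}
    {x : ∀ n, Fin n → Ω n → Euc d} {y : ∀ n, Fin n → Ω n → ℝ}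
    (hA1 : ∀ n, ConditionA1 (M n) (μ n) (x n) (y n))
    (hA2 : ConditionA2 M)
    (hA3 : ∀ n, ConditionA3 (M n) (c n) (ℓ n))
    (h_ui : Tendsto (fun t : ℝ => ⨆ n, (M n).supTail t) atTop (𝓝 0))
    (h_low : ∃ C : ℝ≥0∞, 0 < C ∧ ∀ n, C ≤ (M n).sigmaLowSq)
    (h_rate : Tendsto (fun n : ℕ =>
      ((M n).xi ^ 2 * ENNReal.ofReal (Real.log n / n)) ^ (1 / 2 : ℝ)
        * ENNReal.ofReal (1 + Real.sqrt (M n).k * ℓ n * c n)) atTop (𝓝 0)) :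
    ∃ (lo hi V C : ℝ) (Ξ R : ℕ → ℝ), RegularSeq M lo hi V C Ξ R := by
  obtain ⟨lo, hi, hlo, hspec⟩ := hA2
  obtain ⟨C, hC, hlow⟩ := h_low
  obtain ⟨t, ht⟩ := (h_ui.eventually (gt_mem_nhds one_pos)).exists
  have hCt : min C 1 ≠ ⊤ := ne_top_of_le_ne_top ENNReal.one_ne_top (min_le_right _ _)
  have hr : ∀ n, ∀ x' ∈ (M n).𝒳, |(M n).r x'| ≤ ℓ n * c n := fun n =>
    ((hA3 n).2 _ (hA1 n).mem_G).2
  have hR : ∀ n, 0 ≤ ℓ n * c n := by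
    -- The covariate set is nonempty because it carries the covariates almost surely; so `ℓ c`
    -- dominates an absolute value.
    intro n
    obtain ⟨x', hx'⟩ := (hA1 n).mem_X.exists
    exact (abs_nonneg _).trans (hr n x' hx')
  obtain ⟨h1, h2⟩ := rates_of_rate h_rate hR
  -- The maximum keeps the upper eigenvalue bound positive even in dimension zero, where the
  -- spectrum is empty. The minimum makes the variance bound finite, and `1 + t ^ 2` uses a level
  -- `t` at which all tails are below 1.
  refine ⟨lo, max hi 1, 1 + t ^ 2, (min C 1).toReal, fun n => (M n).xi.toReal,
    fun n => ℓ n * c n, ?_, h1, h2, h_ui⟩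
  filter_upwards [xi_ne_top_of_rate h_rate hR] with n hxi
  refine ⟨hlo, lt_max_of_lt_right one_pos, by positivity,
    ENNReal.toReal_pos (lt_min hC one_pos).ne' hCt, hR n,
    fun s hs => ⟨(hspec n s hs).1, (hspec n s hs).2.trans (le_max_left _ _)⟩, ?_, ?_, ?_,
    (hA1 n).noise_mean, (hA1 n).mem_X.mono (hr n)⟩
  · filter_upwards [(hA1 n).mem_X] with x' hx'
    rw [← toReal_enorm]
    exact ENNReal.toReal_mono hxi (le_iSup₂ (f := fun x' _ => ‖(M n).p x'‖ₑ) x' hx')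
  · filter_upwards [ENNReal.ae_le_essSup (μ := (M n).F) ((M n).condTail t)] with x' hx'
    rw [ENNReal.ofReal_add zero_le_one (sq_nonneg _), ENNReal.ofReal_one]
    refine ((M n).condVar_le t x').trans ?_
    gcongr
    exact hx'.trans ((le_iSup (fun n => (M n).supTail t) n).trans ht.le)
  · filter_upwards [ae_essInf_le (μ := (M n).F) (f := (M n).condVar)] with x' hx'
    rw [ENNReal.ofReal_toReal hCt]
    exact (min_le_left _ _).trans ((hlow n).trans hx')

end Uniformity

/-! ### The two covariance matrices and arbitrary nonzero directions. -/

namespace RegularSeq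

variable {d : ℕ} {M : ℕ → Model d} {lo hi V C : ℝ} {Ξ R : ℕ → ℝ} {Ω : ℕ → Type*}
  [∀ n, MeasurableSpace (Ω n)] {μ : ∀ n, Measure (Ω n)} [∀ n, IsProbabilityMeasure (μ n)]
  {x : ∀ n, Fin n → Ω n → Euc d} {y : ∀ n, Fin n → Ω n → ℝ}
  {betaHat : ∀ n, Ω n → Euc (M n).k}

theorem toStdNormal_of_unit (H : RegularSeq M lo hi V C Ξ R)
    (hbm : ∀ n, AEMeasurable (betaHat n) (μ n))
    (hb : ∀ n, ∀ᵐ ω ∂μ n,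
      IsEstimate (M n).p (fun i => x n i ω) (fun i => y n i ω) (betaHat n ω))
    (hA1 : ∀ n, ConditionA1 (M n) (μ n) (x n) (y n))
    {α : ∀ n, Euc (M n).k} (hα : ∀ n, ‖α n‖ = 1)
    {W : ∀ n, Matrix (Fin (M n).k) (Fin (M n).k) ℝ}
    (hW : (∀ n, W n = (M n).OmegaTilde) ∨ ((∀ n, W n = (M n).OmegaZero) ∧
      ToZeroInProb μ (fun n ω => (M n).R2 (α n) (fun i => x n i ω)))) :
    ToStdNormal μ (fun n ω => Real.sqrt n *
      (inner ℝ (α n) (betaHat n ω - (M n).beta) / ‖sVec (W n) (α n)‖)) := by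
  rcases hW with hW | ⟨hW, hR2⟩
  · simp_rw [hW, ← Model.Omega_r]
    refine H.toStdNormal_of_toZeroInProb hbm hb hA1 hα (ρ := fun n => (M n).r)
      (fun n => (M n).measurable_r) (H.regular.mono fun n hn => hn.abs_r_le)
      (H.regular.mono fun n hn => hn.integral_r_mul_inner) ?_
    simp only [sub_self, zero_mul, Finset.sum_const_zero, mul_zero]
    exact toZeroInProb_zero
  · simp_rw [hW, ← Model.Omega_zero]
    refine H.toStdNormal_of_toZeroInProb hbm hb hA1 hα (ρ := fun _ _ => 0)
      (fun n => measurable_const) (H.regular.mono fun n hn => ae_of_all _ fun _ => ?_)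
      (Eventually.of_forall fun n b => by simp) ?_
    · rw [abs_zero]; exact hn.R_nonneg
    · refine hR2.of_eventually_abs_le one_pos ?_
      filter_upwards [H.regular] with n hn ω
      rw [hn.R2_eq, one_mul]
      simp only [sub_zero, le_refl]

/-- The studentised statistic is invariant under positive scaling of the direction. -/
theorem toStdNormal_of_ne_zero (H : RegularSeq M lo hi V C Ξ R)
    (hbm : ∀ n, AEMeasurable (betaHat n) (μ n))
    (hb : ∀ n, ∀ᵐ ω ∂μ n,
      IsEstimate (M n).p (fun i => x n i ω) (fun i => y n i ω) (betaHat n ω))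
    (hA1 : ∀ n, ConditionA1 (M n) (μ n) (x n) (y n))
    {v : ∀ n, Euc (M n).k} (hv : ∀ n, v n ≠ 0)
    {W : ∀ n, Matrix (Fin (M n).k) (Fin (M n).k) ℝ}
    (hW : (∀ n, W n = (M n).OmegaTilde) ∨ ((∀ n, W n = (M n).OmegaZero) ∧
      ToZeroInProb μ (fun n ω => (M n).R2 (‖v n‖⁻¹ • v n) (fun i => x n i ω)))) :
    ToStdNormal μ (fun n ω => Real.sqrt n *
      (inner ℝ (v n) (betaHat n ω - (M n).beta) / ‖sVec (W n) (v n)‖)) := by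
  have h0 : ∀ n, 0 < ‖v n‖ := fun n => norm_pos_iff.2 (hv n)
  have h := H.toStdNormal_of_unit hbm hb hA1 (α := fun n => ‖v n‖⁻¹ • v n)
    (fun n => norm_smul_inv_norm (𝕜 := ℝ) (hv n)) hW
  have e : ∀ n ω, inner ℝ (‖v n‖⁻¹ • v n) (betaHat n ω - (M n).beta)
        / ‖sVec (W n) (‖v n‖⁻¹ • v n)‖
      = inner ℝ (v n) (betaHat n ω - (M n).beta) / ‖sVec (W n) (v n)‖ := by
    intro n ω
    rw [norm_sVec_smul, inner_smul_left, abs_of_pos (inv_pos.2 (h0 n)), conj_trivial,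
      mul_div_mul_left _ _ (inv_pos.2 (h0 n)).ne']
  simpa only [e] using h

end RegularSeq

end LSSeries


theorem mainTheorem2 {d : ℕ} (M : ℕ → Model d)
    {Ω : ℕ → Type*} [∀ n, MeasurableSpace (Ω n)] (μ : ∀ n, Measure (Ω n))
    [∀ n, IsProbabilityMeasure (μ n)]
    (x : ∀ n, Fin n → Ω n → Euc d) (y : ∀ n, Fin n → Ω n → ℝ)
    (betaHat : ∀ n, Ω n → Euc (M n).k)
    (hbm : ∀ n, AEMeasurable (betaHat n) (μ n))
    (hb : ∀ n, ∀ᵐ ω ∂μ n,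
      IsEstimate (M n).p (fun i => x n i ω) (fun i => y n i ω) (betaHat n ω))
    (c ℓ : ℕ → ℝ)
    (hA1 : ∀ n, ConditionA1 (M n) (μ n) (x n) (y n))
    (hA2 : ConditionA2 M)
    (hA3 : ∀ n, ConditionA3 (M n) (c n) (ℓ n))
    (h_ui : Tendsto (fun t : ℝ => ⨆ n, (M n).supTail t) atTop (𝓝 0))
    (h_low : ∃ C : ℝ≥0∞, 0 < C ∧ ∀ n, C ≤ (M n).sigmaLowSq)
    (h_rate : Tendsto (fun n : ℕ =>
      ((M n).xi ^ 2 * ENNReal.ofReal (Real.log n / n)) ^ (1 / 2 : ℝ)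
        * ENNReal.ofReal (1 + Real.sqrt (M n).k * ℓ n * c n)) atTop (𝓝 0)) :
    (∀ α : ∀ n, Euc (M n).k, (∀ n, ‖α n‖ = 1) →
      ToStdNormal μ (fun n ω => Real.sqrt n *
        (inner ℝ (α n) (betaHat n ω - (M n).beta) / rowNorm (M n).OmegaTilde (α n))) ∧
      (ToZeroInProb μ (fun n ω => (M n).R2 (α n) (fun i => x n i ω)) →
        ToStdNormal μ (fun n ω => Real.sqrt n *
          (inner ℝ (α n) (betaHat n ω - (M n).beta) / rowNorm (M n).OmegaZero (α n))))) ∧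
    (∀ x₀ : ℕ → Euc d, (∀ n, x₀ n ∈ (M n).𝒳) → (∀ n, (M n).p (x₀ n) ≠ 0) →
      ∀ W : ∀ n, Matrix (Fin (M n).k) (Fin (M n).k) ℝ,
        ((∀ n, W n = (M n).OmegaTilde) ∨
          ((∀ n, W n = (M n).OmegaZero) ∧
            ToZeroInProb μ (fun n ω => (M n).R2
              (‖(M n).p (x₀ n)‖⁻¹ • (M n).p (x₀ n)) (fun i => x n i ω)))) →
        ToStdNormal μ (fun n ω => Real.sqrt n *
          (inner ℝ ((M n).p (x₀ n)) (betaHat n ω - (M n).beta)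
            / ‖sVec (W n) ((M n).p (x₀ n))‖)) ∧
        ((fun n : ℕ => Real.sqrt n * (M n).r (x₀ n)) =o[atTop]
            (fun n => ‖sVec (W n) ((M n).p (x₀ n))‖) →
          ToStdNormal μ (fun n ω => Real.sqrt n *
            ((inner ℝ ((M n).p (x₀ n)) (betaHat n ω) - (M n).g (x₀ n))
              / ‖sVec (W n) ((M n).p (x₀ n))‖)))) := by
  obtain ⟨lo, hi, V, C, Ξ, R, H⟩ := exists_regularSeq hA1 hA2 hA3 h_ui h_low h_rate
  refine ⟨fun α hα => ⟨?_, fun hR2 => ?_⟩, fun x₀ hx₀ hp W hW => ?_⟩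
  · simp_rw [rowNorm_eq_norm_sVec]
    exact H.toStdNormal_of_unit hbm hb hA1 hα (Or.inl fun _ => rfl)
  · simp_rw [rowNorm_eq_norm_sVec]
    exact H.toStdNormal_of_unit hbm hb hA1 hα (Or.inr ⟨fun _ => rfl, hR2⟩)
  · have h := H.toStdNormal_of_ne_zero hbm hb hA1 hp hW
    refine ⟨h, fun ho => h.of_toZeroInProb_sub (fun n => ?_) ?_⟩
    · exact ((((hbm n).const_inner).sub_const _).div_const _).const_mul _
    -- The two studentised statistics differ exactly by `-√n r(x)/‖s(x)‖`, which is deterministic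
    -- and tends to zero; this uses that `β` is the projection coefficient of `g`.
    · refine (toZeroInProb_const ho.tendsto_div_nhds_zero).of_eventually_abs_le one_pos ?_
      filter_upwards [H.regular] with n hn ω
      rw [one_mul, ← abs_neg]
      refine le_of_eq (congrArg _ ?_)
      rw [Model.r, Model.rOf, ← hn.beta_eq, inner_sub_right]
      ring
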